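/- An enumeration problem is a binary predicate $A\subseteq\{0,1\}^*\times\{0,1\}^*$ such that the set of solutions $A(x)=\{y : A(x,y)\}$ is finite for every instance $x$; solutions are \emph{not} required to be verifiable in polynomial time, nor to be of polynomial size. Algorithms are random access machines over the natural numbers, with direct and indirect addressing, comparison, addition, (truncated) subtraction and multiplication, read access to the length and to the letters of the input, and an instruction $\mathtt{Output}$ which outputs, in one instruction, the concatenation of the binary contents of a block of consecutive registers whose end points are read from registers. An arithmetic instruction (comparison included) takes time $1+\lfloor\log_2(a+b)\rfloor$ on arguments $a,b$ (with the logarithm read as $0$ when $a+b=0$); every other instruction takes time $1$; work registers are initially $0$. A machine $M$ solves $A$ if, on every input $x$, it halts after having output a sequence $y_1,\dots,y_s$ of pairwise distinct words with $A(x)=\{y_1,\dots,y_s\}$. Let $T(x,k)$ be the time used by $M$ on input $x$ up to and including its $k$-th output. Say that $M$ has - \emph{polynomial preprocessing} if there is a polynomial $p$ such that $T(x,1)\le p(|x|)$ for all $x$ (the halting time being taken in place of $T(x,1)$ if there is no output); - \emph{polynomial delay} if there is a polynomial $p$ such that $T(x,k+1)-T(x,k)\le p(|x|)$ for all $x$ and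 all $1\le k<s$; - \emph{strong polynomial delay} if there are constants $a\ge 0$ and $C>0$ such that $T(x,k)-T(x,k-1)<C\,|y_k|^a$ for all $x$ and all $1<k\le s$ (with $|y_k|$ replaced by $1$ if $y_k$ is the empty word). \textbf{Proposition.} There is an enumeration problem $A$ which is solved by a machine with polynomial preprocessing and polynomial delay, which moreover halts as soon as it has output the last solution, but which is not solved by any machine with polynomial preprocessing and strong polynomial delay, even if no bound is imposed on the time between the last output and the end of the computation. -/

import Mathlib

/-- Words over the binary alphabet. -/
abbrev Word := List Bool

/-- An enumeration problem is given by a binary predicate on words: `A x y` says that `y` is a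
solution of the instance `x`. -/
abbrev EnumProblem := Word → Word → Prop

namespace EnumRAM

/-- Instructions of the random access machine. `R a` is the content of the work register of
address `a`, `I a` the content of the (read-only) input register of address `a`. -/
inductive Instr
  /-- `R d := c` -/
  | const (d c : ℕ)
  /-- `R d := R s` -/
  | copy (d s : ℕ)
  /-- `R d := R (R s)` -/
  | load (d s : ℕ)
  /-- `R (R d) := R s` -/
  | store (d s : ℕ)
  /-- `R d := I (R s)` -/
  | read (d s : ℕ)
  /-- `R d := R s + R t` -/
  | add (d s t : ℕ)
  /-- `R d := R s - R t` (truncated at zero) -/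
  | sub (d s t : ℕ)
  /-- `R d := R s * R t` -/
  | mul (d s t : ℕ)
  /-- continue at instruction number `l` -/
  | jump (l : ℕ)
  /-- if `R s < R t`, continue at instruction number `l` -/
  | jumpLT (s t l : ℕ)
  /-- output the concatenation of the contents of the registers of addresses
  `R s, R s + 1, …, R t` -/
  | output (s t : ℕ)
  /-- stop -/
  | halt

/-- A random access machine is given by its program, a finite list of instructions. -/
structure RAM where
  program : List Instr

/-- The state of a machine during a computation: the number of the next instruction, the contents
of the work registers, the time used so far, and the list, in chronological order, of the words
output so far, each with the time at which it was output. -/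
structure State where
  pc : ℕ
  reg : ℕ → ℕ
  clock : ℕ
  out : List (ℕ × Word)

/-- At the start all work registers contain zero. -/
def State.init : State := ⟨0, fun _ => 0, 0, []⟩

/-- The binary numeral of a natural number, most significant bit first; the numeral of zero is the
one-letter word `0`. -/
def numeral (v : ℕ) : Word := if v = 0 then [false] else v.bits.reverse

/-- The concatenation of the binary numerals of the contents of the registers `a, a + 1, …, b`. -/
def outputWord (R : ℕ → ℕ) (a b : ℕ) : Word :=
  (List.range' a (b + 1 - a)).flatMap fun i => numeral (R i)

/-- The contents of the input registers on input `x`: register `0` contains the length of `x`,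
register `k`, for `1 ≤ k ≤ |x|`, contains the `k`-th letter of `x` (as `0` or `1`), all others
contain `0`. -/
def inputReg (x : Word) : ℕ → ℕ
  | 0 => x.length
  | k + 1 => (x.getD k false).toNat

/-- Time of an arithmetic operation (addition, subtraction, multiplication, comparison) on `a` and
`b`: logarithmic in `a + b`. All other instructions take time `1`. -/
def arithCost (a b : ℕ) : ℕ := 1 + Nat.log 2 (a + b)

/-- Write `v` into register `d`, spend time `c`, and go to the next instruction. -/
def State.write (s : State) (d v c : ℕ) : State :=
  { s with pc := s.pc + 1, reg := Function.update s.reg d v, clock := s.clock + c }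

/-- One step of the machine on input `x`. The machine stops at a `halt` instruction, and when the
instruction number is outside of the program. -/
def RAM.step (M : RAM) (x : Word) (s : State) : Option State :=
  let R := s.reg
  match M.program[s.pc]? with
  | none => none
  | some .halt => none
  | some (.const d c) => some (s.write d c 1)
  | some (.copy d a) => some (s.write d (R a) 1)
  | some (.load d a) => some (s.write d (R (R a)) 1)
  | some (.store d a) => some (s.write (R d) (R a) 1)
  | some (.read d a) => some (s.write d (inputReg x (R a)) 1)
  | some (.add d a b) => some (s.write d (R a + R b) (arithCost (R a) (R b)))
  | some (.sub d a b) => some (s.write d (R a - R b) (arithCost (R a) (R b)))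
  | some (.mul d a b) => some (s.write d (R a * R b) (arithCost (R a) (R b)))
  | some (.jump l) => some { s with pc := l, clock := s.clock + 1 }
  | some (.jumpLT a b l) =>
      some { s with
        pc := if R a < R b then l else s.pc + 1
        clock := s.clock + arithCost (R a) (R b) }
  | some (.output a b) =>
      some { s with
        pc := s.pc + 1
        clock := s.clock + 1
        out := s.out ++ [(s.clock + 1, outputWord R (R a) (R b))] }

/-- The final state of the computation of `M` on input `x`; undefined if `M` does not halt. -/
def RAM.run (M : RAM) (x : Word) : Part State :=
  StateTransition.eval (M.step x) State.init

/-- `M` solves the enumeration problem `A`: on every input `x` it halts, and the words that it has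
output are exactly the solutions of `x`, without repetition. (In particular every `x` has finitely
many solutions.) -/
def RAM.Solves (M : RAM) (A : EnumProblem) : Prop :=
  ∀ x, ∃ s ∈ M.run x, (s.out.map Prod.snd).Nodup ∧ ∀ y, y ∈ s.out.map Prod.snd ↔ A x y

/-- The time at which the first word is output, or the machine halts if there is no output. -/
def State.firstTime (s : State) : ℕ :=
  match s.out with
  | [] => s.clock
  | e :: _ => e.1

/-- Polynomial preprocessing: the first output (or the end of the computation if there is no
output) comes within a time polynomial in the size of the input. -/
def RAM.PolyPreprocessing (M : RAM) : Prop :=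
  ∃ p : Polynomial ℕ, ∀ x, ∀ s ∈ M.run x, s.firstTime ≤ p.eval x.length

/-- Polynomial delay: the time between two consecutive outputs is bounded by a polynomial in the
size of the input. -/
def RAM.PolyDelay (M : RAM) : Prop :=
  ∃ p : Polynomial ℕ, ∀ x, ∀ s ∈ M.run x, ∀ k e e',
    s.out[k]? = some e → s.out[k + 1]? = some e' → e'.1 ≤ e.1 + p.eval x.length

/-- Strong polynomial delay: the time between an output and the next one, `y`, is less than
`C * |y| ^ a` for constants `C` and `a`. (For the empty word the bound is `C`, so that it is not
impossible to output it after another word.) -/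
def RAM.StrongPolyDelay (M : RAM) : Prop :=
  ∃ a C : ℝ, 0 ≤ a ∧ 0 < C ∧ ∀ x, ∀ s ∈ M.run x, ∀ k e e',
    s.out[k]? = some e → s.out[k + 1]? = some e' →
      (e'.1 : ℝ) - (e.1 : ℝ) < C * ((max 1 e'.2.length : ℕ) : ℝ) ^ a

/-- No postprocessing: the machine halts as soon as it has output its last word. -/
def RAM.NoPostprocessing (M : RAM) : Prop :=
  ∀ x, ∀ s ∈ M.run x, ∀ e ∈ s.out.getLast?, s.clock = e.1

end EnumRAM

/-! The proof is a diagonalization against a superpolynomial number of very short solutions. For an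
instance `x` of length `n` let `m = ⌈log₂ n⌉` and `K = bound n = 2 ^ (1 + 2 + ⋯ + m)`. The solutions
are the numerals of `2, …, K - 1` (with `3` in place of a smaller `K`) and one further word, `1` or
`0`. To settle the latter, `x` is read as the code of a random access machine `M`, and a fixed
program `simulatorCode` runs `M` on this same `x` until `M` outputs the word `1`. The further word
is `0` if the simulation ends within about `n * K` steps, and `1` otherwise.

Upper bound (`enumerator_run`): a machine which carries out `n` steps of the simulation before each
numeral knows the further word when the numerals are exhausted. Its delays are polynomial in `n`,
and it halts right after the last output.

Lower bound (`not_solves`): let `M` solve the problem with preprocessing `p` and strong polynomial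
delay. Pad its code to length `n = 2 ^ m`. All solutions have length `O(m ^ 2)`, so the delays are
at most `d`, a polynomial in `log n`. There are at most `K` outputs, so `1`, if it is output, comes
within time `p + K * d`. The simulation up to this moment takes `O(f * ((d + 1) * (p + K * d) + p ^
2))` steps with `f` depending on `M` only. For large `m` this is less than `n * K`, since `d` is
polylogarithmic and `K` exceeds every polynomial in `n`. So if `M` outputs `1`, the simulation ends
in time and `1` is not a solution; if `M` does not, the simulation never ends and `1` is a solution.
Both contradict correctness.

The overhead of the simulation must not spoil the factor `n`. Registers may hold numbers with very
many bits, and copies and indirect accesses to them take time `1`. Hence the intermediate bit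
machines: they copy numbers and access arrays in one step, whatever the sizes, and do arithmetic bit
by bit. A step of `M` of time `δ` then takes `O(δ ^ 2 + 1)` steps (`exec_bodyCmd`), and the squares
add up to at most `p ^ 2 + d * time` (`RAM.sum_sq_le`). Conversely the enumerating machine
represents numbers by nodes of a shared binary tree, so that every bit machine step takes boundedly
many instructions with small operands (`Op.leads`). -/

open EnumRAM Function

namespace EnumRAM

/-! ### Symbolic execution of random access machines -/

/-- From instruction `p` with registers `R` the machine comes, without output and within time
`k * W`, to instruction `p'` with registers `R'`. -/
def RAM.Leads (M : RAM) (x : Word) (W k p : ℕ) (R : ℕ → ℕ) (p' : ℕ) (R' : ℕ → ℕ) : Prop :=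
  ∀ c o, ∃ c', c' ≤ c + k * W ∧
    StateTransition.Reaches (M.step x) ⟨p, R, c, o⟩ ⟨p', R', c', o⟩

/-- The time limit for one instruction with operands at most `V`. -/
def timeLimit (V : ℕ) : ℕ := 1 + Nat.log 2 (2 * V)

theorem arithCost_le {V a b : ℕ} (ha : a ≤ V) (hb : b ≤ V) : arithCost a b ≤ timeLimit V :=
  Nat.add_le_add_left (Nat.log_mono_right (by omega)) 1

theorem one_le_timeLimit (V : ℕ) : 1 ≤ timeLimit V := Nat.le_add_right _ _

namespace RAM.Leads

variable {M : RAM} {x : Word} {V W p p' p'' k k' : ℕ} {R R' R'' : ℕ → ℕ}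

theorem trans (h : M.Leads x W k p R p' R') (h' : M.Leads x W k' p' R' p'' R'') :
    M.Leads x W (k + k') p R p'' R'' := by
  intro c o
  obtain ⟨c₁, hc₁, h₁⟩ := h c o
  obtain ⟨c₂, hc₂, h₂⟩ := h' c₁ o
  exact ⟨c₂, by rw [Nat.add_mul]; omega, h₁.trans h₂⟩

theorem mono (h : M.Leads x W k p R p' R') (hk : k ≤ k') : M.Leads x W k' p R p' R' := by
  intro c o
  obtain ⟨c₁, hc₁, h₁⟩ := h c o
  exact ⟨c₁, hc₁.trans (Nat.add_le_add_left (Nat.mul_le_mul_right _ hk) _), h₁⟩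

theorem of_step (t : ℕ) (ht : t ≤ W)
    (h : ∀ c o, M.step x ⟨p, R, c, o⟩ = some ⟨p', R', c + t, o⟩) : M.Leads x W 1 p R p' R' :=
  fun c o => ⟨c + t, by omega, Relation.ReflTransGen.single (h c o)⟩

theorem const {d v : ℕ} (h : M.program[p]? = some (.const d v)) :
    M.Leads x (timeLimit V) 1 p R (p + 1) (update R d v) :=
  of_step 1 (one_le_timeLimit V) fun c o => by simp [RAM.step, h, State.write]

theorem copy {d s : ℕ} (h : M.program[p]? = some (.copy d s)) :
    M.Leads x (timeLimit V) 1 p R (p + 1) (update R d (R s)) :=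
  of_step 1 (one_le_timeLimit V) fun c o => by simp [RAM.step, h, State.write]

theorem load {d s : ℕ} (h : M.program[p]? = some (.load d s)) :
    M.Leads x (timeLimit V) 1 p R (p + 1) (update R d (R (R s))) :=
  of_step 1 (one_le_timeLimit V) fun c o => by simp [RAM.step, h, State.write]

theorem store {d s : ℕ} (h : M.program[p]? = some (.store d s)) :
    M.Leads x (timeLimit V) 1 p R (p + 1) (update R (R d) (R s)) :=
  of_step 1 (one_le_timeLimit V) fun c o => by simp [RAM.step, h, State.write]

theorem read {d s : ℕ} (h : M.program[p]? = some (.read d s)) :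
    M.Leads x (timeLimit V) 1 p R (p + 1) (update R d (inputReg x (R s))) :=
  of_step 1 (one_le_timeLimit V) fun c o => by simp [RAM.step, h, State.write]

theorem jump {l : ℕ} (h : M.program[p]? = some (.jump l)) :
    M.Leads x (timeLimit V) 1 p R l R :=
  of_step 1 (one_le_timeLimit V) fun c o => by simp [RAM.step, h]

theorem add {d s t : ℕ} (h : M.program[p]? = some (.add d s t)) (hs : R s ≤ V) (ht : R t ≤ V) :
    M.Leads x (timeLimit V) 1 p R (p + 1) (update R d (R s + R t)) :=
  of_step _ (arithCost_le hs ht) fun c o => by simp [RAM.step, h, State.write]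

theorem mul {d s t : ℕ} (h : M.program[p]? = some (.mul d s t)) (hs : R s ≤ V) (ht : R t ≤ V) :
    M.Leads x (timeLimit V) 1 p R (p + 1) (update R d (R s * R t)) :=
  of_step _ (arithCost_le hs ht) fun c o => by simp [RAM.step, h, State.write]

theorem jumpLT_pos {s t l : ℕ} (h : M.program[p]? = some (.jumpLT s t l)) (hs : R s ≤ V)
    (ht : R t ≤ V) (hlt : R s < R t) : M.Leads x (timeLimit V) 1 p R l R :=
  of_step _ (arithCost_le hs ht) fun c o => by simp [RAM.step, h, hlt]

theorem jumpLT_neg {s t l : ℕ} (h : M.program[p]? = some (.jumpLT s t l)) (hs : R s ≤ V)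
    (ht : R t ≤ V) (hlt : ¬ R s < R t) : M.Leads x (timeLimit V) 1 p R (p + 1) R :=
  of_step _ (arithCost_le hs ht) fun c o => by simp [RAM.step, h, hlt]

end RAM.Leads

end EnumRAM

/-! ### Bit machines -/

namespace BitMachine

/-- The basic operations of bit machines, which have 32 variables and 4 arrays, with unbounded
natural numbers as contents and as indices. -/
inductive Op
  /-- `d := b` -/
  | const (d : Fin 32) (b : Bool)
  /-- `d := s` -/
  | copy (d s : Fin 32)
  /-- `d := 2 * s + b` -/
  | shl (b : Bool) (d s : Fin 32)
  /-- `d := s / 2` -/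
  | half (d s : Fin 32)
  /-- `d := s % 2` -/
  | parity (d s : Fin 32)
  /-- `d := f[s]` -/
  | get (d : Fin 32) (f : Fin 4) (s : Fin 32)
  /-- `f[s] := t` -/
  | put (f : Fin 4) (s t : Fin 32)
  /-- if there is a next input letter, store it in `e` and set `d := 1`; otherwise `d, e := 0` -/
  | next (d e : Fin 32)

/-- The instructions of bit machines: a basic operation, or a jump to instruction number `l` if
two variables are equal. -/
inductive Code
  | op (o : Op)
  | jeq (v w : Fin 32) (l : ℕ)

/-- The memory of a bit machine, and the number of input letters read so far. -/
structure Store where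
  var : Fin 32 → ℕ
  arr : Fin 4 → ℕ → ℕ
  pos : ℕ

def Store.init : Store := ⟨fun _ => 0, fun _ _ => 0, 0⟩

def Store.set (s : Store) (d : Fin 32) (v : ℕ) : Store := { s with var := update s.var d v }

def Op.eval (x : Word) : Op → Store → Store
  | const d b, s => s.set d b.toNat
  | copy d a, s => s.set d (s.var a)
  | shl b d a, s => s.set d (2 * s.var a + b.toNat)
  | half d a, s => s.set d (s.var a / 2)
  | parity d a, s => s.set d (s.var a % 2)
  | get d f a, s => s.set d (s.arr f (s.var a))
  | put f a t, s =>
      { s with arr := update s.arr f (update (s.arr f) (s.var a) (s.var t)) }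
  | next d e, s =>
      if s.pos < x.length then
        { (s.set e (x.getD s.pos false).toNat).set d 1 with pos := s.pos + 1 }
      else (s.set e 0).set d 0

/-- One step of the bit machine with program `P`; it stays where it is at the end of the program. -/
def step (x : Word) (P : List Code) (c : ℕ × Store) : ℕ × Store :=
  match P[c.1]? with
  | none => c
  | some (.op o) => (c.1 + 1, o.eval x c.2)
  | some (.jeq v w l) => (if c.2.var v = c.2.var w then min l P.length else c.1 + 1, c.2)

/-! ### Numbers as nodes of a binary tree

The enumerating random access machine represents the numbers in the memory of a bit machine by
the nodes of a binary tree: the children of the node for `y` are those for `2 * y` and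
`2 * y + 1`. Nodes have numbers `0, 1, …`, in the order of their creation. -/

/-- The address of the field `t` of the node `i`: fields `0` and `1` contain the nodes for the half
and the parity, fields `2` to `5` the contents of the arrays, fields `6` and `7` the children. -/
def cell (i t : ℕ) : ℕ := i * 64 + (64 + t)

/-- The registers `R` represent the memory `s`, with nodes `0, …, N - 1`, where the node `i`
represents the number `val i`. -/
structure Sim (x : Word) (K N : ℕ) (val : ℕ → ℕ) (R : ℕ → ℕ) (s : Store) : Prop where
  r0 : R 0 = x.length
  r1 : R 1 = K
  r4 : R 4 = 1
  r5 : R 5 = 64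
  r6 : R 6 = 0
  r7 : R 7 = 2
  r8 : R 8 = 4
  r9 : R 9 = 6
  r10 : R 10 = s.pos
  pos_le : s.pos ≤ x.length
  r11 : R 11 = N
  two_le : 2 ≤ N
  val0 : val 0 = 0
  val1 : val 1 = 1
  inj : ∀ i < N, ∀ j < N, val i = val j → i = j
  var : ∀ d : Fin 32, R (32 + d) < N ∧ val (R (32 + d)) = s.var d
  half : ∀ i < N, R (cell i 0) < N ∧ val (R (cell i 0)) = val i / 2
  parity : ∀ i < N, R (cell i 1) < N ∧ val (R (cell i 1)) = val i % 2
  arr : ∀ f : Fin 4, ∀ i < N, R (cell i (2 + f)) < N ∧ val (R (cell i (2 + f))) = s.arr f (val i)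
  arr_default : ∀ f y, (∀ i < N, val i ≠ y) → s.arr f y = 0
  child : ∀ i < N, 0 < i → ∀ b : Bool, R (cell i (6 + b.toNat)) < N ∧
    (R (cell i (6 + b.toNat)) ≠ 0 → val (R (cell i (6 + b.toNat))) = 2 * val i + b.toNat) ∧
    (R (cell i (6 + b.toNat)) = 0 → ∀ k < N, val k ≠ 2 * val i + b.toNat)
  fresh : ∀ a, cell N 0 ≤ a → R a = 0

namespace Sim

variable {x : Word} {K N : ℕ} {val : ℕ → ℕ} {R R' : ℕ → ℕ} {s : Store}

theorem val_eq_zero (h : Sim x K N val R s) {i : ℕ} (hi : i < N) : val i = 0 ↔ i = 0 :=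
  ⟨fun e => h.inj i hi 0 (by have := h.two_le; omega) (e.trans h.val0.symm),
    fun e => e ▸ h.val0⟩

/-- Registers `2`, `3`, `12`, …, `31` may be changed freely, and a variable may be given the value
of any node. -/
theorem set (h : Sim x K N val R s) {d : Fin 32} {i y : ℕ} (hi : i < N) (hy : val i = y)
    (hR : ∀ a, a ≠ 2 → a ≠ 3 → (a < 12 ∨ 32 ≤ a) → R' a = update R (32 + d) i a) :
    Sim x K N val R' (s.set d y) := by
  have h1 : ∀ a, a ≠ 2 → a ≠ 3 → a < 12 → R' a = R a := fun a h2 h3 h4 => by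
    rw [hR a h2 h3 (.inl h4), update_of_ne (by omega)]
  have h2 : ∀ a, 64 ≤ a → R' a = R a := fun a h2 => by
    rw [hR a (by omega) (by omega) (by omega), update_of_ne (by omega)]
  have h3 : ∀ i t, R' (cell i t) = R (cell i t) := fun i t => h2 _ (by unfold cell; omega)
  refine
    { r0 := (h1 0 (by simp) (by simp) (by simp)).trans h.r0
      r1 := (h1 1 (by simp) (by simp) (by simp)).trans h.r1
      r4 := (h1 4 (by simp) (by simp) (by simp)).trans h.r4
      r5 := (h1 5 (by simp) (by simp) (by simp)).trans h.r5
      r6 := (h1 6 (by simp) (by simp) (by simp)).trans h.r6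
      r7 := (h1 7 (by simp) (by simp) (by simp)).trans h.r7
      r8 := (h1 8 (by simp) (by simp) (by simp)).trans h.r8
      r9 := (h1 9 (by simp) (by simp) (by simp)).trans h.r9
      r10 := (h1 10 (by simp) (by simp) (by simp)).trans h.r10
      pos_le := h.pos_le
      r11 := (h1 11 (by simp) (by simp) (by simp)).trans h.r11
      two_le := h.two_le
      val0 := h.val0
      val1 := h.val1
      inj := h.inj
      var := ?_
      half := fun i hi => by rw [h3]; exact h.half i hi
      parity := fun i hi => by rw [h3]; exact h.parity i hi
      arr := fun f i hi => by rw [h3]; exact h.arr f i hi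
      arr_default := h.arr_default
      child := fun i hi h0 b => by rw [h3]; exact h.child i hi h0 b
      fresh := fun a ha => by rw [h2 a (by unfold cell at ha; omega)]; exact h.fresh a ha }
  intro e
  rw [hR _ (by omega) (by omega) (by omega)]
  by_cases hde : e = d
  · subst hde; simp [Store.set, hi, hy]
  · have : (32 + (e : ℕ)) ≠ 32 + d := by
      intro h; exact hde (Fin.ext (by omega))
    simpa [Store.set, update_of_ne this, update_of_ne hde] using h.var e

theorem congr (h : Sim x K N val R s)
    (hR : ∀ a, a ≠ 2 → a ≠ 3 → (a < 12 ∨ 32 ≤ a) → R' a = R a) : Sim x K N val R' s := by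
  have := h.set (d := 0) (h.var 0).1 (h.var 0).2 (R' := R') (fun a h1 h2 h3 => by
    rw [update_eq_self]; exact hR a h1 h2 h3)
  simpa [Store.set] using this

end Sim

end BitMachine

/-! ### Array writes and creation of nodes in the tree representation -/

namespace BitMachine

theorem cell_inj {i j t u : ℕ} (ht : t < 8) (hu : u < 8) : cell i t = cell j u ↔ i = j ∧ t = u := by
  unfold cell; omega

namespace Sim

variable {x : Word} {K N : ℕ} {val : ℕ → ℕ} {R R' : ℕ → ℕ} {s : Store}

/-- Distinct nodes represent distinct numbers, so overwriting one cell changes exactly one array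
entry. -/
theorem put (h : Sim x K N val R s) {f : Fin 4} {i j y z : ℕ} (hi : i < N) (hy : val i = y)
    (hj : j < N) (hz : val j = z)
    (hR : ∀ a, a ≠ 2 → a ≠ 3 → (a < 12 ∨ 32 ≤ a) → R' a = update R (cell i (2 + f)) j a) :
    Sim x K N val R' { s with arr := update s.arr f (update (s.arr f) y z) } := by
  have h1 : ∀ a, a ≠ 2 → a ≠ 3 → (a < 12 ∨ 32 ≤ a) → a ≠ cell i (2 + f) → R' a = R a :=
    fun a h2 h3 h4 h5 => by rw [hR a h2 h3 h4, update_of_ne h5]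
  have h2 : ∀ a < 64, a ≠ 2 → a ≠ 3 → (a < 12 ∨ 32 ≤ a) → R' a = R a := fun a h0 h2 h3 h4 =>
    h1 a h2 h3 h4 (by unfold cell; omega)
  have h3 : ∀ k t : ℕ, t < 8 → ¬ (k = i ∧ t = 2 + (f : ℕ)) → R' (cell k t) = R (cell k t) := fun k t ht hk =>
    h1 _ (by unfold cell; omega) (by unfold cell; omega) (by unfold cell; omega)
      (by rw [Ne, cell_inj ht (by omega)]; exact hk)
  refine
    { r0 := (h2 0 (by simp) (by simp) (by simp) (by simp)).trans h.r0
      r1 := (h2 1 (by simp) (by simp) (by simp) (by simp)).trans h.r1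
      r4 := (h2 4 (by simp) (by simp) (by simp) (by simp)).trans h.r4
      r5 := (h2 5 (by simp) (by simp) (by simp) (by simp)).trans h.r5
      r6 := (h2 6 (by simp) (by simp) (by simp) (by simp)).trans h.r6
      r7 := (h2 7 (by simp) (by simp) (by simp) (by simp)).trans h.r7
      r8 := (h2 8 (by simp) (by simp) (by simp) (by simp)).trans h.r8
      r9 := (h2 9 (by simp) (by simp) (by simp) (by simp)).trans h.r9
      r10 := (h2 10 (by simp) (by simp) (by simp) (by simp)).trans h.r10
      pos_le := h.pos_le
      r11 := (h2 11 (by simp) (by simp) (by simp) (by simp)).trans h.r11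
      two_le := h.two_le
      val0 := h.val0
      val1 := h.val1
      inj := h.inj
      var := fun d => by
        rw [h2 _ (by omega) (by omega) (by omega) (by omega)]; exact h.var d
      half := fun k hk => by rw [h3 k 0 (by simp) (by omega)]; exact h.half k hk
      parity := fun k hk => by rw [h3 k 1 (by simp) (by omega)]; exact h.parity k hk
      arr := ?_
      arr_default := ?_
      child := fun k hk h0 b => by
        rw [h3 k _ (by cases b <;> simp) (by cases b <;> simp <;> omega)]; exact h.child k hk h0 b
      fresh := fun a ha => by
        rw [h1 a (by unfold cell at ha; omega) (by unfold cell at ha; omega)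
          (by unfold cell at ha; omega) (by unfold cell at ha ⊢; omega)]
        exact h.fresh a ha }
  · intro g k hk
    by_cases hgk : k = i ∧ g = f
    · obtain ⟨rfl, rfl⟩ := hgk
      rw [hR _ (by unfold cell; omega) (by unfold cell; omega) (by unfold cell; omega), update_self]
      simp [hy, hj, hz]
    · rw [h3 k _ (by omega) (fun h' => hgk ⟨h'.1, Fin.ext (by omega)⟩)]
      refine ⟨(h.arr g k hk).1, (h.arr g k hk).2.trans ?_⟩
      by_cases hg : g = f
      · subst hg
        have : val k ≠ y := fun e => hgk ⟨h.inj k hk i hi (e.trans hy.symm), rfl⟩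
        simp [this]
      · simp [hg]
  · intro g w hw
    by_cases hg : g = f
    · subst hg
      have : w ≠ y := fun e => hw i hi (hy.trans e.symm)
      simp [this, h.arr_default g w hw]
    · simp [hg, h.arr_default g w hw]

/-- An empty child cell certifies that no node represents the new number, so `val` stays injective.
The new node needs only its half and its parity to be written: its array and child cells are fresh,
hence zero, and zero denotes both the node of the number `0` and the absence of a child. -/
theorem alloc (h : Sim x K N val R s) {i : ℕ} {b : Bool} (hi : i < N) (h0 : 0 < i)
    (hc : R (cell i (6 + b.toNat)) = 0) (h11 : R' 11 = N + 1)
    (hR : ∀ a, a ≠ 2 → a ≠ 3 → a ≠ 11 → (a < 12 ∨ 32 ≤ a) →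
      R' a = update (update (update R (cell i (6 + b.toNat)) N) (cell N 0) i) (cell N 1) b.toNat a) :
    Sim x K (N + 1) (update val N (2 * val i + b.toNat)) R' s := by
  have hb : b.toNat < 2 := by cases b <;> simp
  have hnew := (h.child i hi h0 b).2.2 hc
  set y := 2 * val i + b.toNat with hy
  have h1 : ∀ a, a ≠ 2 → a ≠ 3 → a ≠ 11 → (a < 12 ∨ 32 ≤ a) → a ≠ cell i (6 + b.toNat) →
      a ≠ cell N 0 → a ≠ cell N 1 → R' a = R a :=
    fun a h2 h3 h4 h5 h6 h7 h8 => by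
      rw [hR a h2 h3 h4 h5, update_of_ne h8, update_of_ne h7, update_of_ne h6]
  have h2 : ∀ a < 64, a ≠ 2 → a ≠ 3 → a ≠ 11 → (a < 12 ∨ 32 ≤ a) → R' a = R a :=
    fun a h0 h2 h3 h4 h5 => h1 a h2 h3 h4 h5 (by unfold cell; omega) (by unfold cell; omega)
      (by unfold cell; omega)
  have h3 : ∀ k t, t < 8 → ¬ (k = i ∧ t = 6 + b.toNat) → ¬ (k = N ∧ t = 0) → ¬ (k = N ∧ t = 1) →
      R' (cell k t) = R (cell k t) := fun k t ht hk hk' hk'' =>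
    h1 _ (by unfold cell; omega) (by unfold cell; omega) (by unfold cell; omega)
      (by unfold cell; omega)
      (by rw [Ne, cell_inj ht (by omega)]; exact hk)
      (by rw [Ne, cell_inj ht (by omega)]; exact hk')
      (by rw [Ne, cell_inj ht (by omega)]; exact hk'')
  have hN0 : R' (cell N 0) = i := by
    rw [hR _ (by unfold cell; omega) (by unfold cell; omega) (by unfold cell; omega)
      (by unfold cell; omega), update_of_ne (by unfold cell; omega), update_self]
  have hN1 : R' (cell N 1) = b.toNat := by
    rw [hR _ (by unfold cell; omega) (by unfold cell; omega) (by unfold cell; omega)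
      (by unfold cell; omega), update_self]
  have hic : R' (cell i (6 + b.toNat)) = N := by
    rw [hR _ (by unfold cell; omega) (by unfold cell; omega) (by unfold cell; omega)
      (by unfold cell; omega), update_of_ne (by unfold cell; omega),
      update_of_ne (by unfold cell; omega), update_self]
  have hv : ∀ k < N, update val N y k = val k := fun k hk => update_of_ne hk.ne _ _
  have hvN : update val N y N = y := update_self ..
  have h2N := h.two_le
  have lift : ∀ {k z}, k < N ∧ val k = z → k < N + 1 ∧ update val N y k = z := fun {k z} hk =>
    ⟨by omega, by rw [hv k hk.1, hk.2]⟩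
  refine
    { r0 := (h2 0 (by simp) (by simp) (by simp) (by simp) (by simp)).trans h.r0
      r1 := (h2 1 (by simp) (by simp) (by simp) (by simp) (by simp)).trans h.r1
      r4 := (h2 4 (by simp) (by simp) (by simp) (by simp) (by simp)).trans h.r4
      r5 := (h2 5 (by simp) (by simp) (by simp) (by simp) (by simp)).trans h.r5
      r6 := (h2 6 (by simp) (by simp) (by simp) (by simp) (by simp)).trans h.r6
      r7 := (h2 7 (by simp) (by simp) (by simp) (by simp) (by simp)).trans h.r7
      r8 := (h2 8 (by simp) (by simp) (by simp) (by simp) (by simp)).trans h.r8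
      r9 := (h2 9 (by simp) (by simp) (by simp) (by simp) (by simp)).trans h.r9
      r10 := (h2 10 (by simp) (by simp) (by simp) (by simp) (by simp)).trans h.r10
      pos_le := h.pos_le
      r11 := h11
      two_le := by omega
      val0 := (hv 0 (by omega)).trans h.val0
      val1 := (hv 1 (by omega)).trans h.val1
      inj := ?_
      var := fun d => by
        rw [h2 _ (by omega) (by omega) (by omega) (by omega) (by omega)]; exact lift (h.var d)
      half := ?_
      parity := ?_
      arr := ?_
      arr_default := ?_
      child := ?_
      fresh := fun a ha => by
        rw [h1 a (by unfold cell at ha; omega) (by unfold cell at ha; omega)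
          (by unfold cell at ha; omega) (by unfold cell at ha; omega)
          (by unfold cell at ha ⊢; omega) (by unfold cell at ha ⊢; omega)
          (by unfold cell at ha ⊢; omega)]
        exact h.fresh a (by unfold cell at ha ⊢; omega) }
  · intro k hk l hl e
    rcases Nat.lt_succ_iff_lt_or_eq.1 hk with hk | rfl <;>
      rcases Nat.lt_succ_iff_lt_or_eq.1 hl with hl | rfl
    · rw [hv k hk, hv l hl] at e; exact h.inj k hk l hl e
    · rw [hv k hk, hvN] at e; exact absurd e (hnew k hk)
    · rw [hv l hl, hvN] at e; exact absurd e.symm (hnew l hl)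
    · rfl
  · intro k hk
    rcases Nat.lt_succ_iff_lt_or_eq.1 hk with hk | rfl
    · rw [h3 k 0 (by simp) (by omega) (by omega) (by omega), hv k hk]; exact lift (h.half k hk)
    · rw [hN0, hvN, hv i hi]; omega
  · intro k hk
    rcases Nat.lt_succ_iff_lt_or_eq.1 hk with hk | rfl
    · rw [h3 k 1 (by simp) (by omega) (by omega) (by omega), hv k hk]; exact lift (h.parity k hk)
    · rw [hN1, hvN, hv _ (by omega)]
      refine ⟨by omega, ?_⟩
      cases b
      · simp [hy, h.val0]
      · simp [hy, h.val1]
  · intro f k hk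
    rcases Nat.lt_succ_iff_lt_or_eq.1 hk with hk | rfl
    · rw [h3 k _ (by omega) (by omega) (by omega) (by omega), hv k hk]; exact lift (h.arr f k hk)
    · rw [h3 k _ (by omega) (by omega) (by omega) (by omega), hvN,
        h.fresh _ (by unfold cell; omega), hv _ (by omega)]
      exact ⟨by omega, h.val0.trans (h.arr_default f y hnew).symm⟩
  · intro f w hw
    exact h.arr_default f w fun k hk => by rw [← hv k hk]; exact hw k (by omega)
  · intro k hk hk0 c
    have hc2 : c.toNat < 2 := by cases c <;> simp
    rcases Nat.lt_succ_iff_lt_or_eq.1 hk with hk | rfl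
    · by_cases hkc : k = i ∧ c = b
      · obtain ⟨rfl, rfl⟩ := hkc
        rw [hic, hvN, hv k hk]
        exact ⟨by omega, fun _ => rfl, fun h => by omega⟩
      · have hcb : ¬ (k = i ∧ 6 + c.toNat = 6 + b.toNat) := by
          rintro ⟨rfl, hcb⟩
          refine hkc ⟨rfl, ?_⟩
          cases b <;> cases c <;> simp_all
        rw [h3 k _ (by omega) hcb (by omega) (by omega), hv k hk]
        have hch := h.child k hk hk0 c
        refine ⟨by omega, fun hne => by rw [hv _ hch.1]; exact hch.2.1 hne, fun he l hl => ?_⟩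
        rcases Nat.lt_succ_iff_lt_or_eq.1 hl with hl | rfl
        · rw [hv l hl]; exact hch.2.2 he l hl
        · rw [hvN]
          intro e
          have : val k = val i ∧ c = b := by
            cases b <;> cases c <;> simp [hy] at e ⊢ <;> omega
          exact hkc ⟨h.inj k hk i hi this.1, this.2⟩
    · rw [h3 k _ (by omega) (by omega) (by omega) (by omega), h.fresh _ (by unfold cell; omega)]
      refine ⟨by omega, fun h => absurd rfl h, fun _ l hl => ?_⟩
      rw [hvN]
      have hyN : val i ≠ 0 := fun e => by have := (h.val_eq_zero hi).1 e; omega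
      rcases Nat.lt_succ_iff_lt_or_eq.1 hl with hl | rfl
      · rw [hv l hl]
        intro e
        -- The nodes are closed under halving: a node for a child of the new number would force an
        -- earlier node for the new number itself.
        have hh := h.half l hl
        exact hnew _ hh.1 (by rw [hh.2]; omega)
      · rw [hvN]; omega

end Sim

end BitMachine

/-! ### Bit machine operations as blocks of RAM instructions -/

namespace BitMachine

/-- Compute the address of the field `t` of the node in register `r`. -/
def cellInstrs (r t : ℕ) : List Instr := [.mul 12 r 5, .const 13 (64 + t), .add 12 12 13]

/-- The implementation of the basic operations on a random access machine, at address `a`,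
continuing at `nxt`. -/
def Op.instrs (a nxt : ℕ) : Op → List Instr
  | const d b => [.const (32 + d) b.toNat, .jump nxt]
  | copy d s => [.copy (32 + d) (32 + s), .jump nxt]
  | half d s => cellInstrs (32 + s) 0 ++ [.load (32 + d) 12, .jump nxt]
  | parity d s => cellInstrs (32 + s) 1 ++ [.load (32 + d) 12, .jump nxt]
  | get d f s => cellInstrs (32 + s) (2 + f) ++ [.load (32 + d) 12, .jump nxt]
  | put f s t => cellInstrs (32 + s) (2 + f) ++ [.store 12 (32 + t), .jump nxt]
  | shl b d s =>
      [.jumpLT 6 (32 + s) (a + 3), .const (32 + d) b.toNat, .jump nxt] ++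
      cellInstrs (32 + s) (6 + b.toNat) ++
      [.load 14 12, .jumpLT 6 14 (a + 18), .store 12 11, .copy 14 11] ++
      cellInstrs 11 0 ++
      [.store 12 (32 + s), .add 12 12 4, .const 13 b.toNat, .store 12 13, .add 11 11 4,
        .copy (32 + d) 14, .jump nxt]
  | next d e =>
      [.jumpLT 10 0 (a + 4), .const (32 + e) 0, .const (32 + d) 0, .jump nxt,
        .add 10 10 4, .read (32 + e) 10, .const (32 + d) 1, .jump nxt]

theorem Sim.advance {x : Word} {K N : ℕ} {val R : ℕ → ℕ} {s : Store} (h : Sim x K N val R s)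
    (hlt : s.pos < x.length) :
    Sim x K N val (update R 10 (s.pos + 1)) { s with pos := s.pos + 1 } := by
  have h1 : ∀ i, i ≠ 10 → update R 10 (s.pos + 1) i = R i := fun i hi => update_of_ne hi ..
  have h2 : ∀ i t, update R 10 (s.pos + 1) (cell i t) = R (cell i t) := fun i t =>
    h1 _ (by unfold cell; omega)
  exact
    { r0 := (h1 0 (by simp)).trans h.r0
      r1 := (h1 1 (by simp)).trans h.r1
      r4 := (h1 4 (by simp)).trans h.r4
      r5 := (h1 5 (by simp)).trans h.r5
      r6 := (h1 6 (by simp)).trans h.r6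
      r7 := (h1 7 (by simp)).trans h.r7
      r8 := (h1 8 (by simp)).trans h.r8
      r9 := (h1 9 (by simp)).trans h.r9
      r10 := update_self ..
      pos_le := hlt
      r11 := (h1 11 (by simp)).trans h.r11
      two_le := h.two_le
      val0 := h.val0
      val1 := h.val1
      inj := h.inj
      var := fun d => by rw [h1 _ (by omega)]; exact h.var d
      half := fun i hi => by rw [h2]; exact h.half i hi
      parity := fun i hi => by rw [h2]; exact h.parity i hi
      arr := fun f i hi => by rw [h2]; exact h.arr f i hi
      arr_default := h.arr_default
      child := fun i hi h0 b => by rw [h2]; exact h.child i hi h0 b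
      fresh := fun a ha => by rw [h1 a (by unfold cell at ha; omega)]; exact h.fresh a ha }

section

variable {M : RAM} {x : Word} {V K N a r t nxt : ℕ} {val R : ℕ → ℕ} {s : Store}

theorem leads_cellInstrs (hf : ∀ o < 3, M.program[a + o]? = some ((cellInstrs r t).getD o .halt))
    (h5 : R 5 = 64) (ht : t < 8) (hV : 64 * (R r + 3) ≤ V) :
    ∃ R', M.Leads x (timeLimit V) 3 a R (a + 3) R' ∧ R' 12 = cell (R r) t ∧
      ∀ i, i ≠ 12 → i ≠ 13 → R' i = R i := by
  refine ⟨_, ((RAM.Leads.mul (hf 0 (by simp)) (by omega) (by omega)).trans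
    (RAM.Leads.const (hf 1 (by simp)))).trans (RAM.Leads.add (hf 2 (by simp)) ?_ ?_), ?_, ?_⟩
  · simp [h5]; omega
  · simp; omega
  · simp [h5, cell]
  · intro i h12 h13
    simp [h12, h13]

/-- Halving, parity and array reading all amount to following one pointer stored in the cell of a
node. -/
theorem leads_fetch {d i : ℕ} (hd : 32 ≤ d)
    (hf : ∀ o < 5, M.program[a + o]? =
      some ((cellInstrs i t ++ [Instr.load d 12, Instr.jump nxt]).getD o .halt))
    (h5 : R 5 = 64) (ht : t < 8) (hV : 64 * (R i + 3) ≤ V) :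
    ∃ R', M.Leads x (timeLimit V) 5 a R nxt R' ∧
      ∀ j, (j < 12 ∨ 32 ≤ j) → R' j = update R d (R (cell (R i) t)) j := by
  obtain ⟨R₁, h₁, h12, hR₁⟩ := leads_cellInstrs (M := M) (x := x) (V := V)
    (r := i) (t := t) (R := R) (a := a)
    (fun o ho => by rw [hf o (by omega), List.getD_append _ _ _ _ (by simpa [cellInstrs] using ho)])
    h5 ht hV
  refine ⟨_, (h₁.trans (RAM.Leads.load (hf 3 (by simp)))).trans (RAM.Leads.jump (hf 4 (by simp))), ?_⟩
  intro j hj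
  rw [h12, hR₁ (cell _ _) (by unfold cell; omega) (by unfold cell; omega)]
  by_cases hjd : j = d
  · subst hjd; simp
  · simp [hjd, hR₁ j (by omega) (by omega)]

/-- The number of instructions does not depend on the sizes of the represented numbers, because only
node numbers are handled, and at most one node is added. Registers `2` and `3`, which hold the
counters of the enumeration, are preserved. -/
theorem Op.leads (op : Op)
    (hf : ∀ o < 20, M.program[a + o]? = some ((op.instrs a nxt).getD o .halt))
    (h : Sim x K N val R s) (hn : x.length ≤ V) (hV : 64 * (N + 3) ≤ V) :
    ∃ R' N' val', M.Leads x (timeLimit V) 20 a R nxt R' ∧ N' ≤ N + 1 ∧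
      Sim x K N' val' R' (op.eval x s) ∧ R' 2 = R 2 ∧ R' 3 = R 3 := by
  have hvar := fun d => h.var d
  cases op with
  | const d b =>
    refine ⟨_, N, val, ((RAM.Leads.const (hf 0 (by simp))).trans
      (RAM.Leads.jump (hf 1 (by simp)))).mono (by simp), by simp, ?_, ?_, ?_⟩
    · refine h.set (d := d) (i := b.toNat) ?_ ?_ fun _ _ _ _ => rfl
      · have := h.two_le; cases b <;> simp <;> omega
      · cases b
        · exact h.val0
        · exact h.val1
    · rw [update_of_ne (by omega)]
    · rw [update_of_ne (by omega)]
  | copy d e =>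
    refine ⟨_, N, val, ((RAM.Leads.copy (hf 0 (by simp))).trans
      (RAM.Leads.jump (hf 1 (by simp)))).mono (by simp), by simp,
      h.set (hvar e).1 (hvar e).2 fun _ _ _ _ => rfl, ?_, ?_⟩ <;> rw [update_of_ne (by omega)]
  | half d e =>
    obtain ⟨R', h₁, hR'⟩ := leads_fetch (M := M) (x := x) (V := V) (a := a) (nxt := nxt) (t := 0)
      (d := 32 + d) (i := 32 + e) (R := R) (by simp) (fun o ho => hf o (by omega)) h.r5
      (by simp) (by have := (hvar e).1; omega)
    refine ⟨R', N, val, h₁.mono (by simp), by simp, h.set (h.half _ (hvar e).1).1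
      ((h.half _ (hvar e).1).2.trans (by rw [(hvar e).2])) fun i _ _ hi => hR' i hi, ?_, ?_⟩
    · rw [hR' _ (by simp), update_of_ne (by omega)]
    · rw [hR' _ (by simp), update_of_ne (by omega)]
  | parity d e =>
    obtain ⟨R', h₁, hR'⟩ := leads_fetch (M := M) (x := x) (V := V) (a := a) (nxt := nxt) (t := 1)
      (d := 32 + d) (i := 32 + e) (R := R) (by simp) (fun o ho => hf o (by omega)) h.r5
      (by simp) (by have := (hvar e).1; omega)
    refine ⟨R', N, val, h₁.mono (by simp), by simp, h.set (h.parity _ (hvar e).1).1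
      ((h.parity _ (hvar e).1).2.trans (by rw [(hvar e).2])) fun i _ _ hi => hR' i hi, ?_, ?_⟩
    · rw [hR' _ (by simp), update_of_ne (by omega)]
    · rw [hR' _ (by simp), update_of_ne (by omega)]
  | get d f e =>
    obtain ⟨R', h₁, hR'⟩ := leads_fetch (M := M) (x := x) (V := V) (a := a) (nxt := nxt)
      (t := 2 + f) (d := 32 + d) (i := 32 + e) (R := R) (by simp)
      (fun o ho => hf o (by omega)) h.r5 (by omega) (by have := (hvar e).1; omega)
    refine ⟨R', N, val, h₁.mono (by simp), by simp, h.set (h.arr f _ (hvar e).1).1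
      ((h.arr f _ (hvar e).1).2.trans (by rw [(hvar e).2])) fun i _ _ hi => hR' i hi, ?_, ?_⟩
    · rw [hR' _ (by simp), update_of_ne (by omega)]
    · rw [hR' _ (by simp), update_of_ne (by omega)]
  | put f e g =>
    obtain ⟨R₁, h₁, h12, hR₁⟩ := leads_cellInstrs (M := M) (x := x) (V := V)
      (r := 32 + e) (t := 2 + f) (R := R) (a := a)
      (fun o ho => by
        rw [hf o (by omega), Op.instrs, List.getD_append _ _ _ _ (by simpa [cellInstrs] using ho)])
      h.r5 (by omega) (by have := (hvar e).1; omega)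
    refine ⟨_, N, val, ((h₁.trans (RAM.Leads.store (hf 3 (by simp)))).trans
      (RAM.Leads.jump (hf 4 (by simp)))).mono (by simp), by simp,
      h.put (f := f) (hvar e).1 (hvar e).2 (hvar g).1 (hvar g).2 fun i _ _ _ => ?_, ?_, ?_⟩
    · rw [h12, hR₁ (32 + g) (by omega) (by omega)]
      by_cases hic : i = cell (R (32 + e)) (2 + f)
      · subst hic; simp
      · rw [update_of_ne hic, update_of_ne hic, hR₁ i (by omega) (by omega)]
    · rw [h12, update_of_ne (by unfold cell; omega), hR₁ 2 (by simp) (by simp)]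
    · rw [h12, update_of_ne (by unfold cell; omega), hR₁ 3 (by simp) (by simp)]
  | next d e =>
    have h0 := h.r0
    have h10 := h.r10
    have hp := h.pos_le
    by_cases hlt : s.pos < x.length
    · have hb : (x.getD s.pos false).toNat < 2 := by cases x.getD s.pos false <;> simp
      have h2N := h.two_le
      refine ⟨_, N, val, (((((RAM.Leads.jumpLT_pos (hf 0 (by simp)) (by omega) (by omega)
        (by omega)).trans (RAM.Leads.add (hf 4 (by simp)) (by omega)
        (by rw [h.r4]; omega))).trans (RAM.Leads.read (hf 5 (by simp)))).trans
        (RAM.Leads.const (hf 6 (by simp)))).trans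
        (RAM.Leads.jump (hf 7 (by simp)))).mono (by simp), by simp, ?_, ?_, ?_⟩
      · have hbv : val (x.getD s.pos false).toNat = (x.getD s.pos false).toNat := by
          cases x.getD s.pos false
          · exact h.val0
          · exact h.val1
        have h1 := (h.set (d := e) (R' := update R (32 + e) (x.getD s.pos false).toNat) (by omega)
          hbv (fun _ _ _ _ => rfl)).set (d := d) (R' := update (update R (32 + e)
            (x.getD s.pos false).toNat) (32 + d) 1) (by omega) h.val1 (fun _ _ _ _ => rfl)
        simp only [Op.eval, hlt, if_true]
        rw [h.r4, h10]
        simp only [update_self, inputReg]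
        rw [update_comm (by omega : (10 : ℕ) ≠ 32 + e), update_comm (by omega : (10 : ℕ) ≠ 32 + d)]
        exact h1.advance hlt
      · rw [update_of_ne (by omega), update_of_ne (by omega), update_of_ne (by omega)]
      · rw [update_of_ne (by omega), update_of_ne (by omega), update_of_ne (by omega)]
    · refine ⟨_, N, val, ((((RAM.Leads.jumpLT_neg (hf 0 (by simp)) (by omega) (by omega)
        (by omega)).trans (RAM.Leads.const (hf 1 (by simp)))).trans
        (RAM.Leads.const (hf 2 (by simp)))).trans
        (RAM.Leads.jump (hf 3 (by simp)))).mono (by simp), by simp, ?_, ?_, ?_⟩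
      · simp only [Op.eval, hlt, if_false]
        have h2N := h.two_le
        exact (h.set (d := e) (R' := update R (32 + e) 0) (by omega) h.val0
          (fun _ _ _ _ => rfl)).set (by omega) h.val0 (fun _ _ _ _ => rfl)
      · rw [update_of_ne (by omega), update_of_ne (by omega)]
      · rw [update_of_ne (by omega), update_of_ne (by omega)]
  | shl b d e =>
    have hb : b.toNat < 2 := by cases b <;> simp
    have h2N := h.two_le
    have h6 := h.r6
    have he := hvar e
    -- The number `0` is its own even child, so node `0` has no child cells in use and is treated
    -- apart; its children are the nodes `0` and `1`.
    by_cases hlt : 0 < R (32 + e)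
    · obtain ⟨R₁, h₁, h12, hR₁⟩ := leads_cellInstrs (M := M) (x := x) (V := V)
        (r := 32 + e) (t := 6 + b.toNat) (R := R) (a := a + 3)
        (fun o ho => by
          rw [Nat.add_assoc, hf (3 + o) (by omega)]
          obtain rfl | rfl | rfl : o = 0 ∨ o = 1 ∨ o = 2 := by omega
          all_goals rfl)
        h.r5 (by omega) (by omega)
      have h₂ := ((RAM.Leads.jumpLT_pos (R := R) (hf 0 (by simp)) (by omega) (by omega : _ ≤ V)
        (by omega)).trans h₁).trans (RAM.Leads.load (V := V) (hf 6 (by simp)))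
      rw [h12, hR₁ (cell _ _) (by unfold cell; omega) (by unfold cell; omega)] at h₂
      have hch := h.child _ he.1 hlt b
      set c := R (cell (R (32 + e)) (6 + b.toNat)) with hc
      set R₂ := update R₁ 14 c with hR₂
      have hR₂' : ∀ i, i ≠ 12 → i ≠ 13 → i ≠ 14 → R₂ i = R i := fun i h h' h'' => by
        rw [hR₂, update_of_ne h'', hR₁ i h h']
      have e6 : R₂ 6 = 0 := by rw [hR₂' _ (by simp) (by simp) (by simp), h6]
      have e14 : R₂ 14 = c := by rw [hR₂, update_self]
      -- An existing child must be reused, since each number may have only one node.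
      by_cases hc0 : 0 < c
      · refine ⟨_, N, val, (((h₂.trans (RAM.Leads.jumpLT_pos (hf 7 (by simp)) (by omega) (by omega)
          (by omega))).trans (RAM.Leads.copy (hf 18 (by simp)))).trans
          (RAM.Leads.jump (hf 19 (by simp)))).mono (by simp), by simp, ?_, ?_, ?_⟩
        · refine h.set hch.1 ((hch.2.1 hc0.ne').trans (by rw [he.2])) fun i h2 h3 hi => ?_
          rw [e14]
          by_cases hid : i = 32 + d
          · subst hid; simp
          · rw [update_of_ne hid, update_of_ne hid, hR₂' i (by omega) (by omega) (by omega)]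
        · rw [update_of_ne (by omega), hR₂' _ (by simp) (by simp) (by simp)]
        · rw [update_of_ne (by omega), hR₂' _ (by simp) (by simp) (by simp)]
      · have hc0 : c = 0 := by omega
        have h₃ := ((h₂.trans (RAM.Leads.jumpLT_neg (hf 7 (by simp)) (by omega) (by omega)
          (by omega))).trans (RAM.Leads.store (hf 8 (by simp)))).trans
          (RAM.Leads.copy (hf 9 (by simp)))
        have e12 : R₂ 12 = cell (R (32 + e)) (6 + b.toNat) := by
          rw [hR₂, update_of_ne (by simp), h12]
        have e11 : R₂ 11 = N := by rw [hR₂' _ (by simp) (by simp) (by simp), h.r11]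
        rw [e12, e11, update_of_ne (by unfold cell; omega), e11] at h₃
        set R₃ := update (update R₂ (cell (R (32 + e)) (6 + b.toNat)) N) 14 N with hR₃
        have hR₃' : ∀ i, i ≠ 12 → i ≠ 13 → i ≠ 14 →
            R₃ i = update R (cell (R (32 + e)) (6 + b.toNat)) N i := fun i h h' h'' => by
          rw [hR₃, update_of_ne h'']
          by_cases hi : i = cell (R (32 + e)) (6 + b.toNat)
          · subst hi; simp
          · rw [update_of_ne hi, update_of_ne hi, hR₂' i h h' h'']
        have hR₃'' : ∀ i < 64, i ≠ 12 → i ≠ 13 → i ≠ 14 → R₃ i = R i := fun i h h' h'' h3 => by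
          rw [hR₃' i h' h'' h3, update_of_ne (by unfold cell; omega)]
        obtain ⟨R₄, h₄, hh12, hR₄⟩ := leads_cellInstrs (M := M) (x := x) (V := V)
          (r := 11) (t := 0) (R := R₃) (a := a + 10)
          (fun o ho => by
            rw [Nat.add_assoc, hf (10 + o) (by omega)]
            obtain rfl | rfl | rfl : o = 0 ∨ o = 1 ∨ o = 2 := by omega
            all_goals rfl)
          (by rw [hR₃'' _ (by simp) (by simp) (by simp) (by simp), h.r5]) (by omega)
          (by rw [hR₃'' _ (by simp) (by simp) (by simp) (by simp), h.r11]; omega)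
        have f11 : R₃ 11 = N := by
          rw [hR₃'' _ (by simp) (by simp) (by simp) (by simp), h.r11]
        rw [f11] at hh12
        have g4 : R₄ 4 = 1 := by
          rw [hR₄ _ (by simp) (by simp), hR₃'' _ (by simp) (by simp) (by simp) (by simp), h.r4]
        have g11 : R₄ 11 = N := by rw [hR₄ _ (by simp) (by simp), f11]
        have g14 : R₄ 14 = N := by rw [hR₄ _ (by simp) (by simp), hR₃, update_self]
        have ge : R₄ (32 + e) = R (32 + e) := by
          rw [hR₄ _ (by omega) (by omega), hR₃'' _ (by omega) (by omega) (by omega) (by omega)]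
        have h₅ := (h₃.trans h₄).trans (RAM.Leads.store (hf 13 (by simp)))
        rw [hh12, ge] at h₅
        set R₅ := update R₄ (cell N 0) (R (32 + e)) with hR₅
        have k5 : ∀ i < 64, R₅ i = R₄ i := fun i hi => by
          rw [hR₅, update_of_ne (by unfold cell; omega)]
        have h₆ := ((h₅.trans (RAM.Leads.add (V := V) (hf 14 (by simp))
          (by rw [k5 _ (by simp), hh12]; unfold cell; omega)
          (by rw [k5 _ (by simp), g4]; omega))).trans (RAM.Leads.const (hf 15 (by simp)))).trans
          (RAM.Leads.store (hf 16 (by simp)))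
        rw [k5 _ (by simp), k5 _ (by simp), hh12, g4, update_of_ne (by simp), update_self,
          update_self] at h₆
        set R₆ := update (update (update R₅ 12 (cell N 0 + 1)) 13 b.toNat) (cell N 0 + 1) b.toNat
          with hR₆
        have k6 : ∀ i < 64, i ≠ 12 → i ≠ 13 → R₆ i = R₄ i := fun i hi h1 h2 => by
          rw [hR₆, update_of_ne (by unfold cell; omega), update_of_ne h2, update_of_ne h1, k5 i hi]
        have l11 : R₆ 11 = N := by rw [k6 _ (by simp) (by simp) (by simp), g11]
        have l14 : R₆ 14 = N := by rw [k6 _ (by simp) (by simp) (by simp), g14]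
        have l4 : R₆ 4 = 1 := by rw [k6 _ (by simp) (by simp) (by simp), g4]
        have h₇ := h₆.trans (RAM.Leads.add (V := V) (hf 17 (by simp)) (by omega) (by omega))
        rw [l11, l4] at h₇
        have h₈ := (h₇.trans (RAM.Leads.copy (hf 18 (by simp)))).trans
          (RAM.Leads.jump (hf 19 (by simp)))
        rw [update_of_ne (by simp), l14] at h₈
        refine ⟨_, N + 1, _, h₈.mono (by simp), by simp,
          (h.alloc (R' := update R₆ 11 (N + 1)) (b := b) he.1 hlt hc0 (by simp) ?_).set
            (d := d) (i := N) (by omega) ?_ fun _ _ _ _ => rfl, ?_, ?_⟩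
        · intro i i2 i3 i11 hi
          rw [update_of_ne i11, hR₆, show cell N 0 + 1 = cell N 1 by unfold cell; omega]
          by_cases hi1 : i = cell N 1
          · subst hi1; simp
          · rw [update_of_ne hi1, update_of_ne hi1, update_of_ne (by omega), update_of_ne (by omega),
              hR₅]
            by_cases hi0 : i = cell N 0
            · subst hi0; simp
            · rw [update_of_ne hi0, update_of_ne hi0, hR₄ i (by omega) (by omega),
                hR₃' i (by omega) (by omega) (by omega)]
        · simp [he.2]
        · rw [update_of_ne (by omega), update_of_ne (by omega), k6 _ (by simp) (by simp) (by simp),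
            hR₄ _ (by simp) (by simp), hR₃'' _ (by simp) (by simp) (by simp) (by simp)]
        · rw [update_of_ne (by omega), update_of_ne (by omega), k6 _ (by simp) (by simp) (by simp),
            hR₄ _ (by simp) (by simp), hR₃'' _ (by simp) (by simp) (by simp) (by simp)]
    · have he0 : s.var e = 0 := by
        rw [← he.2, (by omega : R (32 + e) = 0), h.val0]
      refine ⟨_, N, val, (((RAM.Leads.jumpLT_neg (hf 0 (by simp)) (by omega) (by omega)
        (by omega)).trans (RAM.Leads.const (hf 1 (by simp)))).trans
        (RAM.Leads.jump (hf 2 (by simp)))).mono (by simp), by simp, ?_, ?_, ?_⟩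
      · refine h.set (d := d) (i := b.toNat) (by omega) ?_ fun _ _ _ _ => rfl
        rw [he0]
        cases b
        · exact h.val0
        · exact h.val1
      · rw [update_of_ne (by omega)]
      · rw [update_of_ne (by omega)]

end

end BitMachine

/-! ### The enumerating machine -/

namespace BitMachine

/-- The address of the implementation of the instruction number `p` of a bit machine. -/
def blockStart (p : ℕ) : ℕ := 16 + 32 * p

/-- The implementation, at address `a`, of the instruction number `p` of a bit machine; at the end
of the program there is an idle loop. -/
def actionInstrs (P : List Code) (p a : ℕ) : List Instr :=
  match P[p]? with
  | none => [.jump (blockStart p)]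
  | some (.op o) => o.instrs a (blockStart (p + 1))
  | some (.jeq v w l) =>
      [.jumpLT (32 + v) (32 + w) (blockStart (p + 1)), .jumpLT (32 + w) (32 + v) (blockStart (p + 1)),
        .jump (blockStart (min l P.length))]

/-- The simulation of an instruction of a bit machine is preceded by an increment of a counter,
which regularly leads to an output; after the last of these, there is a final output, which says
whether the bit machine has come to the end of its program. -/
def block (P : List Code) (p : ℕ) : List Instr :=
  [.add 3 3 4, .jumpLT 3 0 (blockStart p + 8), .const 3 0, .output 7 7, .add 2 2 4,
    .jumpLT 2 1 (blockStart p + 8),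
    .output (if p < P.length then 8 else 9) (if p < P.length then 8 else 9), .halt] ++
  actionInstrs P p (blockStart p + 8)

/-- The initialization of the constants, and the computation of the bound for the outputs. -/
def preamble : List Instr :=
  [.read 0 6, .const 4 1, .const 5 64, .const 7 2, .const 8 4, .const 9 6, .const 2 2, .const 11 2,
    .const 129 1, .const 15 1, .const 1 1, .jumpLT 15 0 13, .jump 16, .add 15 15 15, .mul 1 1 15,
    .jump 11]

/-- The machine which enumerates an interval of numbers while it simulates a bit machine. -/
def enumerator (P : List Code) : RAM where
  program := (List.range (blockStart (P.length + 1))).map fun a =>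
    if a < 16 then preamble.getD a .halt
    else (block P ((a - 16) / 32)).getD ((a - 16) % 32) .halt

theorem enumerator_preamble (P : List Code) {a : ℕ} (ha : a < 16) :
    (enumerator P).program[a]? = some (preamble.getD a .halt) := by
  simp only [enumerator, List.getElem?_map]
  rw [List.getElem?_range (by unfold blockStart; omega), Option.map_some, if_pos ha]

theorem enumerator_block (P : List Code) {p o : ℕ} (hp : p ≤ P.length) (ho : o < 32) :
    (enumerator P).program[blockStart p + o]? = some ((block P p).getD o .halt) := by
  simp only [enumerator, List.getElem?_map]
  rw [List.getElem?_range (by unfold blockStart; omega), Option.map_some,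
    if_neg (by unfold blockStart; omega),
    (by unfold blockStart; omega : (blockStart p + o - 16) / 32 = p),
    (by unfold blockStart; omega : (blockStart p + o - 16) % 32 = o)]

/-- Jump targets are truncated to the length of the program, so every instruction number reached has
a block in the enumerating machine. -/
theorem step_le {x : Word} {P : List Code} {c : ℕ × Store} (h : c.1 ≤ P.length) :
    (step x P c).1 ≤ P.length := by
  unfold step
  split
  · exact h
  · rename_i hc
    have := (List.getElem?_eq_some_iff.1 hc).1
    exact this
  · rename_i hc
    have := (List.getElem?_eq_some_iff.1 hc).1
    dsimp only
    split
    · exact min_le_right _ _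
    · exact this

theorem iterate_step_le {x : Word} {P : List Code} {c : ℕ × Store} (h : c.1 ≤ P.length) (t : ℕ) :
    ((step x P)^[t] c).1 ≤ P.length := by
  induction t with
  | zero => exact h
  | succ t ih => rw [iterate_succ_apply']; exact step_le ih

/-- By injectivity of `val`, the equality test on arbitrarily large numbers is a comparison of two
node numbers. -/
theorem leads_action {x : Word} {P : List Code} {V K N : ℕ} {val R : ℕ → ℕ} {c : ℕ × Store}
    (hp : c.1 ≤ P.length) (h : Sim x K N val R c.2) (hn : x.length ≤ V)
    (hV : 64 * (N + 3) ≤ V) :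
    ∃ R' N' val', (enumerator P).Leads x (timeLimit V) 20 (blockStart c.1 + 8) R
      (blockStart (step x P c).1) R' ∧ N' ≤ N + 1 ∧
      Sim x K N' val' R' (step x P c).2 ∧ R' 2 = R 2 ∧ R' 3 = R 3 := by
  have hf : ∀ o < 24, (enumerator P).program[blockStart c.1 + 8 + o]? =
      some ((actionInstrs P c.1 (blockStart c.1 + 8)).getD o .halt) := fun o ho => by
    rw [Nat.add_assoc, enumerator_block P hp (by omega), block, List.getD_append_right _ _ _ _
      (by simp)]
    simp
  unfold step
  split
  · rename_i hc
    simp only [actionInstrs, hc] at hf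
    exact ⟨R, N, val, (RAM.Leads.jump (hf 0 (by simp))).mono (by simp), by simp, h, rfl, rfl⟩
  · rename_i o hc
    simp only [actionInstrs, hc] at hf
    exact o.leads (fun o ho => hf o (by omega)) h hn hV
  · rename_i v w l hc
    simp only [actionInstrs, hc] at hf
    have hv := h.var v
    have hw := h.var w
    refine ⟨R, N, val, ?_, by simp, h, rfl, rfl⟩
    have heq : c.2.var v = c.2.var w ↔ R (32 + v) = R (32 + w) := by
      rw [← hv.2, ← hw.2]
      exact ⟨h.inj _ hv.1 _ hw.1, congrArg val⟩
    simp only [heq]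
    rcases lt_trichotomy (R (32 + v)) (R (32 + w)) with hlt | heq' | hlt
    · rw [if_neg hlt.ne]
      exact (RAM.Leads.jumpLT_pos (hf 0 (by simp)) (by omega) (by omega) hlt).mono (by simp)
    · rw [if_pos heq']
      exact (((RAM.Leads.jumpLT_neg (hf 0 (by simp)) (by omega) (by omega) (by omega)).trans
        (RAM.Leads.jumpLT_neg (hf 1 (by simp)) (by omega) (by omega) (by omega))).trans
        (RAM.Leads.jump (hf 2 (by simp)))).mono (by simp)
    · rw [if_neg hlt.ne']
      exact ((RAM.Leads.jumpLT_neg (hf 0 (by simp)) (by omega) (by omega) (by omega)).trans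
        (RAM.Leads.jumpLT_pos (hf 1 (by simp)) (by omega) (by omega) hlt)).mono (by simp)

/-- The bound for the numbers which are enumerated: `superpoly m = 2 ^ (1 + 2 + ⋯ + m)`. -/
def superpoly : ℕ → ℕ
  | 0 => 1
  | m + 1 => superpoly m * 2 ^ (m + 1)

theorem superpoly_mono : Monotone superpoly :=
  monotone_nat_of_le_succ fun _ => Nat.le_mul_of_pos_right _ (by positivity)

/-- The bound for the outputs for inputs of length `n`. -/
def bound (n : ℕ) : ℕ := superpoly (Nat.clog 2 n)

/-- Register `15` is doubled until it reaches `|x|`, and register `1` is multiplied by each new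
power of two, so it ends as `superpoly` of the number of rounds. The final power is at most `2 * |x|
+ 2`, which keeps the operands below `V`. -/
theorem leads_preamble (P : List Code) (x : Word) {V : ℕ} (hV : bound x.length ≤ V)
    (hn : 2 * x.length + 2 ≤ V) :
    ∃ R, (enumerator P).Leads x (timeLimit V) (14 + 4 * Nat.clog 2 x.length) 0 (fun _ => 0)
      (blockStart 0) R ∧ Sim x (bound x.length) 2 id R Store.init ∧ R 2 = 2 ∧ R 3 = 0 := by
  have hf : ∀ a < 16, (enumerator P).program[a]? = some (preamble.getD a .halt) :=
    fun a ha => enumerator_preamble P ha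
  have h₁ := ((((((((((RAM.Leads.read (x := x) (V := V) (R := fun _ => 0) (hf 0 (by simp))).trans
    (RAM.Leads.const (hf 1 (by simp)))).trans (RAM.Leads.const (hf 2 (by simp)))).trans
    (RAM.Leads.const (hf 3 (by simp)))).trans (RAM.Leads.const (hf 4 (by simp)))).trans
    (RAM.Leads.const (hf 5 (by simp)))).trans (RAM.Leads.const (hf 6 (by simp)))).trans
    (RAM.Leads.const (hf 7 (by simp)))).trans (RAM.Leads.const (hf 8 (by simp)))).trans
    (RAM.Leads.const (hf 9 (by simp)))).trans (RAM.Leads.const (hf 10 (by simp)))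
  simp only [inputReg] at h₁
  set R₀ : ℕ → ℕ := update (update (update (update (update (update (update (update (update (update
    (update (fun _ => 0) 0 x.length) 4 1) 5 64) 7 2) 8 4) 9 6) 2 2) 11 2) 129 1) 15 1) 1 1 with hR₀
  have hloop : ∀ i ≤ Nat.clog 2 x.length, ∃ R, (enumerator P).Leads x (timeLimit V) (11 + 4 * i) 0
      (fun _ => 0) 11 R ∧ R 15 = 2 ^ i ∧ R 1 = superpoly i ∧
      ∀ a, a ≠ 1 → a ≠ 15 → R a = R₀ a := by
    intro i
    induction i with
    | zero => exact fun _ => ⟨R₀, h₁, by simp [hR₀], by simp [hR₀, superpoly], fun _ _ _ => rfl⟩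
    | succ i ih =>
      intro hi
      obtain ⟨R, hR, h15, h1, hR'⟩ := ih (by omega)
      have hlt : 2 ^ i < x.length := Nat.lt_clog_iff_pow_lt (by simp) |>.1 hi
      have h0 : R 0 = x.length := by rw [hR' 0 (by simp) (by simp), hR₀]; simp
      have hs : superpoly i ≤ V := (superpoly_mono (by omega)).trans hV
      have hp : (2 : ℕ) ^ (i + 1) = 2 ^ i + 2 ^ i := by ring
      have h₂ := (hR.trans (RAM.Leads.jumpLT_pos (hf 11 (by simp)) (by omega) (by omega)
        (by omega))).trans (RAM.Leads.add (hf 13 (by simp)) (by omega) (by omega))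
      rw [h15, ← hp] at h₂
      have h₃ := (h₂.trans (RAM.Leads.mul (V := V) (hf 14 (by simp)) (by simpa [h1] using hs)
        (by simp; omega))).trans (RAM.Leads.jump (hf 15 (by simp)))
      refine ⟨_, h₃.mono (by omega), by simp, by simp [h1, superpoly], fun a ha ha' => ?_⟩
      rw [update_of_ne ha, update_of_ne ha', hR' a ha ha']
  obtain ⟨R, hR, h15, h1, hR'⟩ := hloop _ le_rfl
  have h0 : R 0 = x.length := by rw [hR' 0 (by simp) (by simp), hR₀]; simp
  have hle : x.length ≤ 2 ^ Nat.clog 2 x.length := Nat.le_pow_clog (by simp) _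
  have hle' : 2 ^ Nat.clog 2 x.length ≤ 2 * x.length + 2 := by
    rcases Nat.lt_or_ge 1 x.length with h | h
    · have := Nat.pow_pred_clog_lt_self (by simp : 1 < 2) h
      obtain ⟨k, hk⟩ : ∃ k, Nat.clog 2 x.length = k + 1 :=
        ⟨_, (Nat.succ_pred_eq_of_pos (Nat.clog_pos (by simp) h)).symm⟩
      rw [hk] at this ⊢
      simp only [Nat.pred_eq_sub_one, Nat.add_sub_cancel] at this
      rw [pow_succ]; omega
    · rw [Nat.clog_of_right_le_one h]; simp
  refine ⟨R, ((hR.trans (RAM.Leads.jumpLT_neg (hf 11 (by simp)) (by omega) (by omega)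
    (by omega))).trans (RAM.Leads.jump (hf 12 (by simp)))).mono (by omega), ?_, ?_, ?_⟩
  · have hz : ∀ a, 16 ≤ a → a ≠ 129 → R a = 0 := fun a ha ha' => by
      rw [hR' a (by omega) (by omega), hR₀]
      simp only [update_apply]
      iterate 11 rw [if_neg (by omega)]
    have h129 : R 129 = 1 := by rw [hR' _ (by simp) (by simp), hR₀]; simp
    have hc : ∀ i t : ℕ, t < 8 → ¬ (i = 1 ∧ t = 1) → R (cell i t) = 0 := fun i t ht h =>
      hz _ (by unfold cell; omega) (by unfold cell; omega)
    refine
      { r0 := h0, r1 := h1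
        r4 := by rw [hR' _ (by simp) (by simp), hR₀]; simp
        r5 := by rw [hR' _ (by simp) (by simp), hR₀]; simp
        r6 := by rw [hR' _ (by simp) (by simp), hR₀]; simp
        r7 := by rw [hR' _ (by simp) (by simp), hR₀]; simp
        r8 := by rw [hR' _ (by simp) (by simp), hR₀]; simp
        r9 := by rw [hR' _ (by simp) (by simp), hR₀]; simp
        r10 := by rw [hR' _ (by simp) (by simp), hR₀]; simp [Store.init]
        pos_le := Nat.zero_le _
        r11 := by rw [hR' _ (by simp) (by simp), hR₀]; simp
        two_le := le_rfl, val0 := rfl, val1 := rfl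
        inj := fun i _ j _ h => h
        var := fun d => by rw [hz _ (by omega) (by omega)]; simp [Store.init]
        half := fun i hi => by rw [hc i 0 (by simp) (by simp)]; simp; omega
        parity := fun i hi => ?_
        arr := fun f i hi => by rw [hc i _ (by omega) (by omega)]; simp [Store.init]
        arr_default := fun _ _ _ => rfl
        child := fun i hi h0 b => ?_
        fresh := fun a ha => hz a (by unfold cell at ha; omega) (by unfold cell at ha; omega) }
    · obtain rfl | rfl : i = 0 ∨ i = 1 := by omega
      · rw [hc 0 1 (by simp) (by simp)]; simp
      -- Register `129`, set in the preamble, is the parity cell of node `1`; it is the only nonzero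
      -- cell of the initial tree.
      · rw [show cell 1 1 = 129 from rfl, h129]; simp
    · rw [hc i _ (by cases b <;> simp) (by omega)]
      refine ⟨by simp, by simp, fun _ k hk => ?_⟩
      simp only [id]
      cases b <;> simp <;> omega
  · rw [hR' _ (by simp) (by simp), hR₀]; simp
  · rw [hR' _ (by simp) (by simp), hR₀]; simp

end BitMachine

/-! ### Delays of a list of outputs -/

namespace EnumRAM

/-- The time of the last output. -/
def lastTime (o : List (ℕ × Word)) : ℕ := (o.getLast?.map Prod.fst).getD 0

/-- Every output comes within time `D` after the one before, the first one within time `D`. -/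
inductive Timely (D : ℕ) : List (ℕ × Word) → Prop
  | nil : Timely D []
  | snoc {o : List (ℕ × Word)} {e : ℕ × Word} (h : Timely D o) (he : e.1 ≤ lastTime o + D) :
      Timely D (o ++ [e])

@[simp] theorem lastTime_snoc (o : List (ℕ × Word)) (e : ℕ × Word) : lastTime (o ++ [e]) = e.1 := by
  simp [lastTime]

theorem Timely.head {D : ℕ} {o : List (ℕ × Word)} (h : Timely D o) :
    ∀ e, o[0]? = some e → e.1 ≤ D := by
  induction h with
  | nil => simp
  | @snoc o e h he ih =>
    intro e' he'
    rcases o with _ | ⟨a, o⟩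
    · simp at he'; subst he'; simpa [lastTime] using he
    · exact ih e' (by simpa using he')

theorem Timely.delay {D : ℕ} {o : List (ℕ × Word)} (h : Timely D o) :
    ∀ k e e', o[k]? = some e → o[k + 1]? = some e' → e'.1 ≤ e.1 + D := by
  induction h with
  | nil => simp
  | @snoc o f h hf ih =>
    intro k e e' he he'
    have hk : k + 1 < (o ++ [f]).length := (List.getElem?_eq_some_iff.1 he').1
    simp only [List.length_append, List.length_singleton] at hk
    rw [List.getElem?_append_left (by omega)] at he
    rcases Nat.lt_or_ge (k + 1) o.length with hlt | hge
    · rw [List.getElem?_append_left hlt] at he'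
      exact ih k e e' he he'
    · have hk' : k + 1 = o.length := by omega
      rw [hk', List.getElem?_append_right le_rfl] at he'
      simp only [Nat.sub_self, List.getElem?_cons_zero, Option.some.injEq] at he'
      subst he'
      have : o.getLast? = some e := by rw [List.getLast?_eq_getElem?, ← hk']; simpa using he
      simpa [lastTime, this] using hf

theorem outputWord_self (R : ℕ → ℕ) (a : ℕ) : outputWord R a a = numeral (R a) := by
  simp [outputWord]

theorem RAM.step_output {M : RAM} {x : Word} {p a c : ℕ} {R : ℕ → ℕ} {o : List (ℕ × Word)}
    (h : M.program[p]? = some (.output a a)) : M.step x ⟨p, R, c, o⟩ =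
      some ⟨p + 1, R, c + 1, o ++ [(c + 1, numeral (R (R a)))]⟩ := by
  simp [RAM.step, h, outputWord_self]

end EnumRAM

/-! ### The run of the enumerating machine and its delays -/

namespace BitMachine

/-- The bit machine with program `P` comes to the end of its program while the enumerating machine
is running. -/
def HaltsInTime (P : List Code) (x : Word) : Prop :=
  ((step x P)^[max 1 x.length * (max 3 (bound x.length) - 2) - 1] (0, Store.init)).1 = P.length

open Classical in
/-- The words which are output by the enumerating machine. -/
noncomputable def outputs (P : List Code) (x : Word) : List Word :=
  (List.range' 2 (max 3 (bound x.length) - 2)).map numeral ++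
    [numeral (if HaltsInTime P x then 0 else 1)]

/-- A bound for the contents of the registers of the enumerating machine. -/
def maxContent (n : ℕ) : ℕ := 64 * ((n + 1) * (bound n + 3) + 10)

/-- A bound for the delays of the enumerating machine. -/
def maxDelay (n : ℕ) : ℕ := (14 + 4 * Nat.clog 2 n + (n + 2) * 30) * timeLimit (maxContent n)

/-- The state of the enumerating machine after the simulation of `t` steps. -/
structure Inv (P : List Code) (x : Word) (t : ℕ) (st : State) : Prop where
  pc : st.pc = blockStart ((step x P)^[t] (0, Store.init)).1
  sim : ∃ N val, N ≤ t + 2 ∧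
    Sim x (bound x.length) N val st.reg ((step x P)^[t] (0, Store.init)).2
  time : t = (st.reg 2 - 2) * max 1 x.length + st.reg 3
  counter : st.reg 3 < max 1 x.length
  two_le : 2 ≤ st.reg 2
  lt : st.reg 2 < max 3 (bound x.length)
  out : st.out.map Prod.snd = (List.range' 2 (st.reg 2 - 2)).map numeral
  timely : Timely (maxDelay x.length) st.out
  clock : st.clock ≤ lastTime st.out +
    (14 + 4 * Nat.clog 2 x.length + (st.reg 3 + 1) * 30) * timeLimit (maxContent x.length)

theorem exists_inv_zero (P : List Code) (x : Word) :
    ∃ st, StateTransition.Reaches ((enumerator P).step x) State.init st ∧ Inv P x 0 st := by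
  obtain ⟨R, h, hs, h2, h3⟩ := leads_preamble P x (V := maxContent x.length)
    (by unfold maxContent; nlinarith) (by unfold maxContent; nlinarith)
  obtain ⟨c, hc, hr⟩ := h 0 []
  refine ⟨_, hr, rfl, ⟨2, id, by simp, hs⟩, ?_, ?_, ?_, ?_, ?_, .nil, ?_⟩
  · simp [h2, h3]
  · simp [h3]
  · simp [h2]
  · simp [h2]
  · simp [h2]
  · simp only [h3, lastTime, List.getLast?_nil, Option.map_none, Option.getD_none]
    refine hc.trans ?_
    simp only [Nat.zero_add]
    exact Nat.mul_le_mul_right _ (by omega)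

/-- One pass through a block costs fewer than 30 instructions. It simulates one more step, unless
the numerals are exhausted; then it emits the final word and halts. -/
theorem Inv.next {P : List Code} {x : Word} {t : ℕ} {st : State} (h : Inv P x t st) :
    (∃ st', StateTransition.Reaches ((enumerator P).step x) st st' ∧ Inv P x (t + 1) st') ∨
    (t + 1 = max 1 x.length * (max 3 (bound x.length) - 2) ∧
      ∃ st' e o, StateTransition.Reaches ((enumerator P).step x) st st' ∧
        (enumerator P).step x st' = none ∧ st'.out = o ++ [e] ∧ st'.clock = e.1 ∧
        Timely (maxDelay x.length) st'.out ∧ st'.out.map Prod.snd = outputs P x) := by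
  obtain ⟨pc, R, c, o⟩ := st
  obtain ⟨hpc, ⟨N, val, hN, hs⟩, htime, hcounter, h2, hlt, hout, htimely, hclock⟩ := h
  dsimp only at *
  set n := x.length with hn
  set K := bound n with hK
  set cf := (step x P)^[t] (0, Store.init) with hcf
  subst hpc
  have hp : cf.1 ≤ P.length := iterate_step_le (Nat.zero_le _) t
  have hf := fun o ho => enumerator_block P hp (o := o) ho
  -- At most one node is created per simulated step, so this bound on `t` bounds the number of
  -- nodes, and with it all operands, by `maxContent n`.
  have htK : t < (n + 1) * (K + 3) := by
    have h1 : (R 2 - 2 + 1) * max 1 n ≤ (K + 3) * (n + 1) := Nat.mul_le_mul (by omega) (by omega)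
    rw [Nat.add_mul] at h1
    rw [Nat.mul_comm (n + 1)]
    omega
  have hKn : (n + 1) * (K + 3) = n * K + 3 * n + K + 3 := by ring
  set V := maxContent n with hV
  have hV' : V = 64 * ((n + 1) * (K + 3) + 10) := rfl
  have hVN : 64 * (N + 3) ≤ V := by omega
  have hnK : n ≤ V ∧ K ≤ V ∧ R 2 < V ∧ R 3 < V := by
    have : 0 ≤ n * K := Nat.zero_le _
    refine ⟨by omega, by omega, by omega, by omega⟩
  set W := timeLimit V with hW
  have hW1 : 1 ≤ W := one_le_timeLimit V
  have h4 : R 4 = 1 := hs.r4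
  have h0 : R 0 = n := hs.r0
  have h1 : R 1 = K := hs.r1
  have hadd := RAM.Leads.add (M := enumerator P) (x := x) (V := V) (R := R) (hf 0 (by simp))
    (by omega) (by omega)
  rw [h4] at hadd
  set R₁ := update R 3 (R 3 + 1) with hR₁
  have hsucc : (step x P)^[t + 1] (0, Store.init) = step x P cf := iterate_succ_apply' ..
  by_cases hj : R 3 + 1 < n
  · left
    have hs₁ : Sim x K N val R₁ cf.2 := hs.congr fun a _ ha _ => update_of_ne ha ..
    obtain ⟨R', N', val', hl, hN', hs', e2, e3⟩ := leads_action hp hs₁ (by omega) hVN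
    obtain ⟨c', hc', hr⟩ := ((hadd.trans (RAM.Leads.jumpLT_pos (hf 1 (by simp))
      (by simp [hR₁]; omega) (by simp [hR₁, h0, hnK.1]) (by simp [hR₁, h0, hj]))).trans hl) c o
    have e2' : R' 2 = R 2 := by rw [e2, hR₁, update_of_ne (by simp)]
    have e3' : R' 3 = R 3 + 1 := by rw [e3, hR₁, update_self]
    refine ⟨_, hr, ?_, ⟨N', val', by omega, ?_⟩, ?_, ?_, ?_, ?_, ?_, htimely, ?_⟩
    · rw [hsucc]
    · rw [hsucc]; exact hs'
    · simp only [e2', e3', ← hn]; omega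
    · simp only [e3', ← hn]; omega
    · simpa only [e2'] using h2
    · simpa only [e2'] using hlt
    · simpa only [e2'] using hout
    · simp only [e3', ← hn]
      change _ ≤ _ + _ * W at hc'
      change _ ≤ _ + _ * W
      have : 14 + 4 * Nat.clog 2 n + (R 3 + 1 + 1) * 30 =
        14 + 4 * Nat.clog 2 n + (R 3 + 1) * 30 + 30 := by ring
      rw [this, Nat.add_mul]
      omega
  -- For the empty input the counter wraps at every step, whence the maximum with `1`.
  · have hj' : R 3 + 1 = max 1 n := by omega
    obtain ⟨c₁, hc₁, hr₁⟩ := ((hadd.trans (RAM.Leads.jumpLT_neg (hf 1 (by simp))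
      (by simp [hR₁]; omega) (by simp [hR₁, h0, hnK.1]) (by simp [hR₁, h0]; omega))).trans
      (RAM.Leads.const (hf 2 (by simp)))) c o
    have hf3 : (enumerator P).program[blockStart cf.1 + 1 + 1 + 1]? = some (.output 7 7) :=
      hf 3 (by simp)
    set R₂ := update R₁ 3 0 with hR₂
    have hR₂' : ∀ a, a ≠ 3 → R₂ a = R a := fun a ha => by
      rw [hR₂, update_of_ne ha, hR₁, update_of_ne ha]
    set o₂ := o ++ [(c₁ + 1, numeral (R 2))] with ho₂
    have hr₂ : StateTransition.Reaches ((enumerator P).step x) ⟨blockStart cf.1, R, c, o⟩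
        ⟨blockStart cf.1 + 4, R₂, c₁ + 1, o₂⟩ := by
      refine hr₁.tail ((RAM.step_output hf3).trans ?_)
      rw [hR₂' 7 (by simp), hs.r7, hR₂' 2 (by simp)]
    -- `maxDelay` allows `n + 2` rounds where at most `n + 1` occur; the spare round pays for the
    -- output instructions.
    have hdelay : (14 + 4 * Nat.clog 2 n + (R 3 + 1) * 30) * W + 10 * W ≤ maxDelay n := by
      unfold maxDelay
      rw [← Nat.add_mul]
      exact Nat.mul_le_mul_right _ (by omega)
    have ht₂ : Timely (maxDelay n) o₂ := htimely.snoc (by dsimp only; omega)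
    have hl₂ : lastTime o₂ = c₁ + 1 := lastTime_snoc ..
    have hm₂ : o₂.map Prod.snd = (List.range' 2 (R 2 + 1 - 2)).map numeral := by
      rw [ho₂, List.map_append, hout, show R 2 + 1 - 2 = (R 2 - 2) + 1 by omega,
        List.range'_concat, List.map_append]
      rw [one_mul, Nat.add_sub_cancel' h2]
      rfl
    have hadd₂ := RAM.Leads.add (M := enumerator P) (x := x) (V := V) (R := R₂) (hf 4 (by simp))
      (by rw [hR₂' _ (by simp)]; omega) (by rw [hR₂' _ (by simp)]; omega)
    rw [hR₂' 2 (by simp), hR₂' 4 (by simp), h4] at hadd₂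
    set R₃ := update R₂ 2 (R 2 + 1) with hR₃
    have hR₃' : ∀ a, a ≠ 2 → a ≠ 3 → R₃ a = R a := fun a ha ha' => by
      rw [hR₃, update_of_ne ha, hR₂' a ha']
    have h32 : R₃ 2 = R 2 + 1 := update_self ..
    have h33 : R₃ 3 = 0 := by rw [hR₃, update_of_ne (by simp), hR₂, update_self]
    have h31 : R₃ 1 = K := by rw [hR₃' _ (by simp) (by simp), h1]
    by_cases hv : R 2 + 1 < K
    · left
      have hs₃ : Sim x K N val R₃ cf.2 := hs.congr fun a ha ha' _ => hR₃' a ha ha'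
      obtain ⟨R', N', val', hl, hN', hs', e2, e3⟩ := leads_action hp hs₃ (by omega) hVN
      obtain ⟨c', hc', hr⟩ := ((hadd₂.trans (RAM.Leads.jumpLT_pos (hf 5 (by simp))
        (by omega) (by omega) (by omega))).trans hl) (c₁ + 1) o₂
      rw [h32] at e2
      rw [h33] at e3
      refine ⟨_, hr₂.trans hr, ?_, ⟨N', val', by omega, ?_⟩, ?_, ?_, ?_, ?_, ?_, ht₂, ?_⟩
      · rw [hsucc]
      · rw [hsucc]; exact hs'
      · simp only [e2, e3, ← hn]
        rw [show R 2 + 1 - 2 = (R 2 - 2) + 1 by omega, Nat.add_mul, ← hj', one_mul]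
        rw [← hj'] at htime
        omega
      · simp only [e3, ← hn]; omega
      · simp only [e2]; omega
      · simp only [e2, ← hn, ← hK]; omega
      · simpa only [e2] using hm₂
      · simp only [e3, hl₂, ← hn]
        change _ ≤ _ + _ * W at hc'
        change _ ≤ _ + _ * W
        rw [Nat.add_mul]
        omega
    · right
      -- The numeral of `2` is output before the first comparison with `K`, so a `K` below `3` acts
      -- like `3`.
      have hv' : R 2 + 1 = max 3 K := by omega
      have htt : t + 1 = max 1 n * (max 3 K - 2) := by
        rw [← hv', show R 2 + 1 - 2 = (R 2 - 2) + 1 by omega, Nat.mul_add, ← hj', mul_one,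
          Nat.mul_comm (R 3 + 1)]
        rw [← hj'] at htime
        omega
      refine ⟨htt, ?_⟩
      obtain ⟨c', hc', hr⟩ := (hadd₂.trans (RAM.Leads.jumpLT_neg (hf 5 (by simp))
        (by omega) (by omega) (by omega))) (c₁ + 1) o₂
      -- Each instruction of the bit machine has its own block, so the final word can be fixed in
      -- the block: the current block tells whether the program has ended. The last block stops
      -- before simulating its instruction, so only `t` steps have been made, one fewer than the
      -- number of blocks entered.
      have hhalt : HaltsInTime P x ↔ ¬ cf.1 < P.length := by
        rw [HaltsInTime, ← hn, ← hK, ← htt, Nat.add_sub_cancel, ← hcf]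
        omega
      have hf6 : (enumerator P).program[blockStart cf.1 + 4 + 1 + 1]? = some (.output
          (if cf.1 < P.length then 8 else 9) (if cf.1 < P.length then 8 else 9)) :=
        hf 6 (by simp)
      have hf7 : (enumerator P).program[blockStart cf.1 + 7]? = some .halt := hf 7 (by simp)
      classical
      refine ⟨⟨blockStart cf.1 + 7, R₃, c' + 1,
        o₂ ++ [(c' + 1, numeral (if HaltsInTime P x then 0 else 1))]⟩, _, o₂,
        hr₂.trans (hr.tail ((RAM.step_output hf6).trans ?_)), by simp [RAM.step, hf7], rfl, rfl, ?_, ?_⟩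
      · have h8 : R₃ (R₃ 8) = 1 := by
          rw [hR₃' 8 (by simp) (by simp), hs.r8, hR₃' _ (by simp) (by simp), h4]
        have h9 : R₃ (R₃ 9) = 0 := by
          rw [hR₃' 9 (by simp) (by simp), hs.r9, hR₃' _ (by simp) (by simp), hs.r6]
        have hfin : R₃ (R₃ (if cf.1 < P.length then 8 else 9)) =
            if HaltsInTime P x then 0 else 1 := by
          by_cases hlt' : cf.1 < P.length
          · rw [if_pos hlt', if_neg (fun h => hhalt.1 h hlt'), h8]
          · rw [if_neg hlt', if_pos (hhalt.2 hlt'), h9]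
        rw [hfin]
      · exact ht₂.snoc (by rw [hl₂]; dsimp only; omega)
      · rw [List.map_append, hm₂, hv', outputs]
        congr

/-- The run of the enumerating machine. -/
theorem enumerator_run (P : List Code) (x : Word) :
    ∃ st ∈ (enumerator P).run x, ∃ e o, st.out = o ++ [e] ∧ st.clock = e.1 ∧
      Timely (maxDelay x.length) st.out ∧ st.out.map Prod.snd = outputs P x := by
  by_contra hcon
  have hend : ∀ t, ∃ st, StateTransition.Reaches ((enumerator P).step x) State.init st ∧
      Inv P x t st := by
    intro t
    induction t with
    | zero => exact exists_inv_zero P x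
    | succ t ih =>
      obtain ⟨st, hr, hi⟩ := ih
      rcases hi.next with ⟨st', hr', hi'⟩ | ⟨-, st', e, o, hr', hs, he, hc, ht, ho⟩
      · exact ⟨st', hr.trans hr', hi'⟩
      · exact absurd ⟨st', StateTransition.mem_eval.2 ⟨hr.trans hr', hs⟩, e, o, he, hc, ht, ho⟩ hcon
  -- If the final output never came, the invariant would hold for arbitrarily large `t`, whereas the
  -- two counters determine `t` and are bounded.
  obtain ⟨st, -, hi⟩ := hend ((max 3 (bound x.length)) * max 1 x.length)
  have h1 := hi.time
  have h2 := hi.counter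
  have h3 : (st.reg 2 - 2 + 1) * max 1 x.length ≤ max 3 (bound x.length) * max 1 x.length :=
    Nat.mul_le_mul_right _ (by have := hi.lt; omega)
  rw [Nat.add_mul] at h3
  omega

end BitMachine

/-! ### Binary numerals -/

namespace EnumRAM

theorem numeral_one : numeral 1 = [true] := by simp [numeral]

theorem numeral_injective : Injective numeral := by
  have h : LeftInverse (fun w : Word => w.foldl (fun n b => Nat.bit b n) 0) numeral := fun v => by
    have hb : ∀ v : ℕ, v.bits.foldr (fun b n => Nat.bit b n) 0 = v := fun v => by
      induction v using Nat.binaryRec' with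
      | zero => simp
      | bit b n h ih => rw [Nat.bits_append_bit _ _ h, List.foldr_cons, ih]
    unfold numeral
    split
    · subst v; rfl
    · simp only [List.foldl_reverse]; exact hb v
  exact h.injective

theorem length_numeral_le (v : ℕ) : (numeral v).length ≤ v.size + 1 := by
  unfold numeral
  split
  · simp
  · rw [List.length_reverse, ← Nat.size_eq_bits_len]; omega

end EnumRAM

/-! ### The problem, and the polynomial bounds for its enumerator -/

namespace BitMachine

theorem mem_outputs {P : List Code} {x y : Word} (h : y ∈ outputs P x) :
    ∃ v < max 3 (bound x.length), y = numeral v := by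
  simp only [outputs, List.mem_append, List.mem_map, List.mem_range'_1, List.mem_singleton] at h
  rcases h with ⟨v, hv, rfl⟩ | rfl
  · exact ⟨v, by omega, rfl⟩
  · refine ⟨_, ?_, rfl⟩
    split <;> simp

theorem nodup_outputs (P : List Code) (x : Word) : (outputs P x).Nodup := by
  refine List.Nodup.append (List.Nodup.map numeral_injective List.nodup_range') (List.nodup_singleton _) ?_
  rw [List.disjoint_singleton]
  simp only [List.mem_map, List.mem_range'_1, not_exists, not_and]
  intro v hv h
  have := numeral_injective h
  split at this <;> omega

/-- The enumerated numerals start with that of `2`, so `1` can only be the final word. -/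
theorem true_mem_outputs {P : List Code} {x : Word} : [true] ∈ outputs P x ↔ ¬ HaltsInTime P x := by
  simp only [outputs, ← numeral_one, List.mem_append, List.mem_map, List.mem_range'_1,
    List.mem_singleton, numeral_injective.eq_iff]
  constructor
  · rintro (⟨v, hv, rfl⟩ | h)
    · omega
    · split at h <;> simp_all
  · intro h
    simp [h]

/-- The problem solved by the enumerating machine. -/
def problem (P : List Code) : EnumProblem := fun x y => y ∈ outputs P x

theorem superpoly_le (m : ℕ) : superpoly m ≤ 2 ^ (m * (m + 1)) := by
  induction m with
  | zero => simp [superpoly]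
  | succ m ih =>
    calc superpoly (m + 1) ≤ 2 ^ (m * (m + 1)) * 2 ^ (m + 1) := Nat.mul_le_mul_right _ ih
      _ = 2 ^ (m * (m + 1) + (m + 1)) := (pow_add ..).symm
      _ ≤ _ := Nat.pow_le_pow_right (by simp) (by nlinarith)

theorem clog_two_le (n : ℕ) : Nat.clog 2 n ≤ n :=
  Nat.clog_le_of_le_pow Nat.lt_two_pow_self.le

/-- Only the logarithm of the register contents enters, so the crude estimates `clog 2 n ≤ n` and
`bound n ≤ 2 ^ (n * (n + 1))` suffice for a polynomial bound. -/
theorem timeLimit_maxContent_le (n : ℕ) : timeLimit (maxContent n) ≤ 12 + n + n * (n + 1) := by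
  have hb : bound n ≤ 2 ^ (n * (n + 1)) := (superpoly_mono (clog_two_le n)).trans (superpoly_le n)
  have hn : n + 1 ≤ 2 ^ n := Nat.lt_two_pow_self
  have h1 : 1 ≤ 2 ^ (n * (n + 1)) := Nat.one_le_two_pow
  have hlt : 2 * maxContent n < 2 ^ (11 + n + n * (n + 1)) := by
    have h2 : (n + 1) * (bound n + 3) ≤ 2 ^ n * (4 * 2 ^ (n * (n + 1))) :=
      Nat.mul_le_mul hn (by omega)
    have h3 : 1 ≤ 2 ^ n * 2 ^ (n * (n + 1)) := Nat.mul_pos (by positivity) (by positivity)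
    rw [pow_add, pow_add]
    unfold maxContent
    generalize (n + 1) * (bound n + 3) = a at *
    have h4 : 2 ^ n * (4 * 2 ^ (n * (n + 1))) = 4 * (2 ^ n * 2 ^ (n * (n + 1))) := by ring
    rw [mul_assoc]
    generalize 2 ^ n * 2 ^ (n * (n + 1)) = c at *
    omega
  have := Nat.log_lt_of_lt_pow (b := 2) (by unfold maxContent; omega) hlt
  unfold timeLimit
  omega

theorem maxDelay_le (n : ℕ) :
    maxDelay n ≤ (14 + 4 * n + (n + 2) * 30) * (12 + n + n * (n + 1)) :=
  Nat.mul_le_mul (by have := clog_two_le n; omega) (timeLimit_maxContent_le n)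

open Polynomial in
/-- A polynomial bound for the delays of the enumerating machine. -/
noncomputable def delayPoly : Polynomial ℕ :=
  (14 + 4 * X + (X + 2) * 30) * (12 + X + X * (X + 1))

theorem maxDelay_le_eval (n : ℕ) : maxDelay n ≤ delayPoly.eval n := by
  refine (maxDelay_le n).trans_eq ?_
  simp only [delayPoly, Polynomial.eval_mul, Polynomial.eval_add, Polynomial.eval_ofNat,
    Polynomial.eval_X, Polynomial.eval_one]

theorem enumerator_spec {P : List Code} {x : Word} {st : State}
    (h : st ∈ (enumerator P).run x) : ∃ e o, st.out = o ++ [e] ∧ st.clock = e.1 ∧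
      Timely (maxDelay x.length) st.out ∧ st.out.map Prod.snd = outputs P x := by
  obtain ⟨st', h', hst⟩ := enumerator_run P x
  rwa [Part.mem_unique h h']

theorem enumerator_solves (P : List Code) : (enumerator P).Solves (problem P) := fun x => by
  obtain ⟨st, h, -, -, -, -, -, ho⟩ := enumerator_run P x
  exact ⟨st, h, ho ▸ nodup_outputs P x, fun y => by rw [ho]; rfl⟩

theorem enumerator_polyPreprocessing (P : List Code) : (enumerator P).PolyPreprocessing := by
  refine ⟨delayPoly, fun x st h => ?_⟩
  obtain ⟨e, o, ho, -, ht, -⟩ := enumerator_spec h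
  refine le_trans ?_ (maxDelay_le_eval _)
  unfold State.firstTime
  split
  · simp_all
  · rename_i e' o' he
    exact ht.head e' (by rw [he]; rfl)

theorem enumerator_polyDelay (P : List Code) : (enumerator P).PolyDelay := by
  refine ⟨delayPoly, fun x st h k e e' he he' => ?_⟩
  obtain ⟨-, -, -, -, ht, -⟩ := enumerator_spec h
  exact (ht.delay k e e' he he').trans (Nat.add_le_add_left (maxDelay_le_eval _) _)

theorem enumerator_noPostprocessing (P : List Code) : (enumerator P).NoPostprocessing := by
  intro x st h e he
  obtain ⟨e', o, ho, hc, -, -⟩ := enumerator_spec h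
  rw [ho, List.getLast?_concat, Option.mem_def, Option.some.injEq] at he
  rw [hc, he]

end BitMachine

namespace BitMachine

/-! ### Structured programs -/

/-- Structured programs for bit machines. -/
inductive Cmd
  | skip
  | op (o : Op)
  | seq (c d : Cmd)
  /-- if `v = w` then `c` else `d` -/
  | ifeq (v w : Fin 32) (c d : Cmd)
  /-- while `v ≠ w` do `c` -/
  | whilene (v w : Fin 32) (c : Cmd)

infixr:60 " ;; " => Cmd.seq

namespace Cmd

def size : Cmd → ℕ
  | skip => 0
  | op _ => 1
  | seq c d => c.size + d.size
  | ifeq _ _ c d => c.size + d.size + 2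
  | whilene _ _ c => c.size + 2

/-- The code of a structured program, to be placed at address `a`. -/
def compile : Cmd → ℕ → List Code
  | skip, _ => []
  | op o, _ => [.op o]
  | seq c d, a => c.compile a ++ d.compile (a + c.size)
  | ifeq v w c d, a =>
      -- The code for `d` comes first, since the jump is taken on equality; `jeq v v` serves as an
      -- unconditional jump.
      .jeq v w (a + 1 + d.size + 1) :: (d.compile (a + 1) ++
        .jeq v v (a + (c.size + d.size + 2)) :: c.compile (a + 1 + d.size + 1))
  | whilene v w c, a => .jeq v w (a + (c.size + 2)) :: (c.compile (a + 1) ++ [.jeq v v a])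

@[simp] theorem length_compile (c : Cmd) (a : ℕ) : (c.compile a).length = c.size := by
  induction c generalizing a with
  | skip => rfl
  | op o => rfl
  | seq c d hc hd => simp [compile, size, hc, hd]
  | ifeq v w c d hc hd => simp [compile, size, hc, hd]; omega
  | whilene v w c hc => simp [compile, size, hc]

end Cmd

/-- The list `L` of instructions occurs at address `a` in the program `P`. -/
def CodeAt (P : List Code) (a : ℕ) (L : List Code) : Prop :=
  a + L.length ≤ P.length ∧ ∀ i < L.length, P[a + i]? = L[i]?

theorem CodeAt.left {P : List Code} {a : ℕ} {L L' : List Code} (h : CodeAt P a (L ++ L')) :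
    CodeAt P a L := by
  obtain ⟨h1, h2⟩ := h
  simp only [List.length_append] at h1 h2
  exact ⟨by omega, fun i hi => by rw [h2 i (by omega), List.getElem?_append_left hi]⟩

theorem CodeAt.right {P : List Code} {a : ℕ} {L L' : List Code} (h : CodeAt P a (L ++ L')) :
    CodeAt P (a + L.length) L' := by
  obtain ⟨h1, h2⟩ := h
  simp only [List.length_append] at h1 h2
  exact ⟨by omega, fun i hi => by
    rw [Nat.add_assoc, h2 _ (by omega), List.getElem?_append_right (by omega),
      Nat.add_sub_cancel_left]⟩

theorem CodeAt.head {P : List Code} {a : ℕ} {c : Code} {L : List Code} (h : CodeAt P a (c :: L)) :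
    P[a]? = some c := h.2 0 (by simp)

theorem CodeAt.tail {P : List Code} {a : ℕ} {c : Code} {L : List Code} (h : CodeAt P a (c :: L)) :
    CodeAt P (a + 1) L := CodeAt.right (L := [c]) h

theorem codeAt_self (P : List Code) : CodeAt P 0 P := ⟨by simp, fun i _ => by simp⟩

/-- The program `c`, started with memory `s`, ends with memory `s'` after at most `n` steps. -/
def Exec (x : Word) (c : Cmd) (s : Store) (n : ℕ) (s' : Store) : Prop :=
  ∀ P a, CodeAt P a (c.compile a) → ∃ k ≤ n, (step x P)^[k] (a, s) = (a + c.size, s')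

theorem step_jeq {x : Word} {P : List Code} {a l : ℕ} {v w : Fin 32} {s : Store}
    (h : P[a]? = some (.jeq v w l)) (hl : l ≤ P.length) :
    step x P (a, s) = (if s.var v = s.var w then l else a + 1, s) := by
  simp [step, h, min_eq_left hl]

theorem Store.var_set (s : Store) (d : Fin 32) (y : ℕ) (v : Fin 32) :
    (s.set d y).var v = if v = d then y else s.var v := update_apply ..

namespace Exec

variable {x : Word} {c d : Cmd} {s s' s'' : Store} {n n' : ℕ} {v w : Fin 32}

theorem mono (h : Exec x c s n s') (hn : n ≤ n') : Exec x c s n' s' := fun P a hP =>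
  let ⟨k, hk, e⟩ := h P a hP
  ⟨k, hk.trans hn, e⟩

theorem skip : Exec x .skip s 0 s := fun _ _ _ => ⟨0, le_rfl, rfl⟩

theorem op (o : Op) (s : Store) : Exec x (.op o) s 1 (o.eval x s) := fun P a hP =>
  ⟨1, le_rfl, by simp [step, hP.head, Cmd.size]⟩

theorem seq (h : Exec x c s n s') (h' : Exec x d s' n' s'') : Exec x (c ;; d) s (n + n') s'' := by
  intro P a hP
  obtain ⟨k, hk, e⟩ := h P a hP.left
  obtain ⟨k', hk', e'⟩ := h' P (a + c.size) (by simpa using hP.right)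
  exact ⟨k' + k, by omega, by rw [iterate_add_apply, e, e', Cmd.size, Nat.add_assoc]⟩

theorem ifeq_pos (hv : s.var v = s.var w) (h : Exec x c s n s') :
    Exec x (.ifeq v w c d) s (n + 1) s' := by
  intro P a hP
  have hlen := hP.1
  rw [Cmd.length_compile, Cmd.size] at hlen
  obtain ⟨k, hk, e⟩ := h P (a + 1 + d.size + 1) (by simpa using hP.tail.right.tail)
  refine ⟨k + 1, by omega, ?_⟩
  rw [iterate_add_apply, iterate_one, step_jeq hP.head (by omega), if_pos hv, e, Cmd.size]
  congr 1
  omega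

theorem ifeq_neg (hv : s.var v ≠ s.var w) (h : Exec x d s n s') :
    Exec x (.ifeq v w c d) s (n + 2) s' := by
  intro P a hP
  have hlen := hP.1
  rw [Cmd.length_compile, Cmd.size] at hlen
  obtain ⟨k, hk, e⟩ := h P (a + 1) hP.tail.left
  refine ⟨1 + (k + 1), by omega, ?_⟩
  rw [iterate_add_apply, iterate_add_apply, iterate_one, step_jeq hP.head (by omega),
    if_neg hv, e, step_jeq (by simpa using hP.tail.right.head) (by omega), if_pos rfl, Cmd.size]

/-- Besides the upper bound, a round is shown to take at least one step. This is what bounds the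
duration of an unfinished simulation from below. -/
theorem while_iter (hv : s.var v ≠ s.var w) (h : Exec x c s n s') {P : List Code} {a : ℕ}
    (hP : CodeAt P a ((Cmd.whilene v w c).compile a)) :
    ∃ k, 1 ≤ k ∧ k ≤ n + 2 ∧ (step x P)^[k] (a, s) = (a, s') := by
  have hlen := hP.1
  rw [Cmd.length_compile, Cmd.size] at hlen
  obtain ⟨k, hk, e⟩ := h P (a + 1) hP.tail.left
  refine ⟨1 + (k + 1), by omega, by omega, ?_⟩
  rw [iterate_add_apply, iterate_add_apply, iterate_one, step_jeq hP.head (by omega),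
    if_neg hv, e, step_jeq (by simpa using hP.tail.right.head) (by omega), if_pos rfl]

theorem while_done (hv : s.var v = s.var w) : Exec x (.whilene v w c) s 1 s := by
  intro P a hP
  have hlen := hP.1
  rw [Cmd.length_compile, Cmd.size] at hlen
  exact ⟨1, le_rfl, by rw [iterate_one, step_jeq hP.head (by omega), if_pos hv, Cmd.size]⟩

theorem while_step (hv : s.var v ≠ s.var w) (h : Exec x c s n s')
    (h' : Exec x (.whilene v w c) s' n' s'') : Exec x (.whilene v w c) s (n + 2 + n') s'' := by
  intro P a hP
  obtain ⟨k, -, hk, e⟩ := while_iter hv h hP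
  obtain ⟨k', hk', e'⟩ := h' P a hP
  exact ⟨k' + k, by omega, by rw [iterate_add_apply, e, e']⟩

/-- A loop with invariant `I`, indexed by the number of rounds to come. -/
theorem whilene (I : ℕ → Store → Prop) (h0 : ∀ s, I 0 s → s.var v = s.var w)
    (h : ∀ m s, I (m + 1) s → s.var v ≠ s.var w ∧ ∃ s', Exec x c s n s' ∧ I m s')
    (m : ℕ) (s : Store) (hs : I m s) :
    ∃ s', Exec x (.whilene v w c) s (m * (n + 2) + 1) s' ∧ I 0 s' := by
  induction m generalizing s with
  | zero => exact ⟨s, (while_done (h0 s hs)).mono (by omega), hs⟩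
  | succ m ih =>
    obtain ⟨hv, s', hs', hI⟩ := h m s hs
    obtain ⟨s'', hs'', hI'⟩ := ih s' hI
    exact ⟨s'', (while_step hv hs' hs'').mono (by rw [Nat.succ_mul]; omega), hI'⟩

end Exec

namespace Cmd

/-- The effect of a program without loops. -/
def run (x : Word) : Cmd → Store → Store
  | skip, s => s
  | op o, s => o.eval x s
  | seq c d, s => d.run x (c.run x s)
  | ifeq v w c d, s => if s.var v = s.var w then c.run x s else d.run x s
  | whilene _ _ _, s => s

def loopFree : Cmd → Bool
  | skip => true
  | op _ => true
  | seq c d => c.loopFree && d.loopFree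
  | ifeq _ _ c d => c.loopFree && d.loopFree
  | whilene _ _ _ => false

end Cmd

/-- Without loops no instruction is executed twice, so the size of the code bounds the time. -/
theorem exec_run {x : Word} {c : Cmd} (h : c.loopFree = true) (s : Store) :
    Exec x c s c.size (c.run x s) := by
  induction c generalizing s with
  | skip => exact .skip
  | op o => exact .op o s
  | seq c d hc hd =>
    simp only [Cmd.loopFree, Bool.and_eq_true] at h
    exact (hc h.1 s).seq (hd h.2 _)
  | ifeq v w c d hc hd =>
    simp only [Cmd.loopFree, Bool.and_eq_true] at h
    simp only [Cmd.run, Cmd.size]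
    split
    · exact (Exec.ifeq_pos ‹_› (hc h.1 s)).mono (by omega)
    · exact (Exec.ifeq_neg ‹_› (hd h.2 s)).mono (by omega)
  | whilene v w c hc => simp [Cmd.loopFree] at h

/-- The memories agree up to the variables from number `n` on. -/
structure Agree (n : ℕ) (s s' : Store) : Prop where
  var : ∀ v : Fin 32, v < n → s'.var v = s.var v
  arr : s'.arr = s.arr
  pos : s'.pos = s.pos

namespace Agree

theorem refl (n : ℕ) (s : Store) : Agree n s s := ⟨fun _ _ => rfl, rfl, rfl⟩

theorem trans {n : ℕ} {s s' s'' : Store} (h : Agree n s s') (h' : Agree n s' s'') :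
    Agree n s s'' :=
  ⟨fun v hv => (h'.var v hv).trans (h.var v hv), h'.arr.trans h.arr, h'.pos.trans h.pos⟩

theorem mono {n m : ℕ} {s s' : Store} (h : Agree n s s') (hm : m ≤ n) : Agree m s s' :=
  ⟨fun v hv => h.var v (by omega), h.arr, h.pos⟩

theorem set (n : ℕ) (s : Store) {d : Fin 32} (hd : n ≤ d) (y : ℕ) : Agree n s (s.set d y) :=
  ⟨fun v hv => by simp [Store.set, show v ≠ d by rintro rfl; omega], rfl, rfl⟩

end Agree

/-- The operation changes only variables from number `n` on. -/
def Op.writesFrom (n : ℕ) : Op → Bool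
  | const d _ => n ≤ d
  | copy d _ => n ≤ d
  | shl _ d _ => n ≤ d
  | half d _ => n ≤ d
  | parity d _ => n ≤ d
  | get d _ _ => n ≤ d
  | put _ _ _ => false
  | next _ _ => false

def Cmd.writesFrom (n : ℕ) : Cmd → Bool
  | skip => true
  | op o => o.writesFrom n
  | seq c d => c.writesFrom n && d.writesFrom n
  | ifeq _ _ c d => c.writesFrom n && d.writesFrom n
  | whilene _ _ c => c.writesFrom n

theorem agree_run {x : Word} {n : ℕ} {c : Cmd} (h : c.writesFrom n = true) (s : Store) :
    Agree n s (c.run x s) := by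
  induction c generalizing s with
  | skip => exact .refl _ _
  | op o =>
    cases o <;> simp only [Cmd.writesFrom, Op.writesFrom, decide_eq_true_eq, Bool.false_eq_true] at h
    all_goals exact .set _ _ h _
  | seq c d hc hd =>
    simp only [Cmd.writesFrom, Bool.and_eq_true] at h
    exact (hc h.1 s).trans (hd h.2 _)
  | ifeq v w c d hc hd =>
    simp only [Cmd.writesFrom, Bool.and_eq_true] at h
    simp only [Cmd.run]
    split
    · exact hc h.1 s
    · exact hd h.2 s
  | whilene v w c hc => exact .refl _ _

end BitMachine

namespace BitMachine

/-! ### Arithmetic on bit machines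

Variable `0` is `0` and variable `1` is `1`. The arguments are in the variables `25` and `26`, the
result is in variable `27`. -/

theorem size_half (n : ℕ) : (n / 2).size = n.size - 1 := by
  cases n using Nat.binaryRec with
  | zero => simp
  | bit b m =>
    by_cases h : Nat.bit b m = 0
    · rw [h]; simp
    · rw [Nat.size_bit h, Nat.bit_div_two]; simp

theorem size_shl (n : ℕ) {b : ℕ} (hb : b < 2) : (2 * n + b).size ≤ n.size + 1 := by
  rw [Nat.size_le, pow_succ]
  have := Nat.lt_size_self n
  omega

/-- The bits of `S`, except for the most significant one, are a stack of bits, which are moved to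
the number `z`. -/
def unstack (S z : ℕ) : ℕ := if h : S ≤ 1 then z else unstack (S / 2) (2 * z + S % 2)
decreasing_by omega

theorem unstack_one (z : ℕ) : unstack 1 z = z := by rw [unstack, dif_pos le_rfl]

theorem unstack_of_lt {S : ℕ} (hS : 1 < S) (z : ℕ) :
    unstack S z = unstack (S / 2) (2 * z + S % 2) := by rw [unstack, dif_neg (by omega)]

/-- A bit pushed on the stack becomes the last bit of the number onto which the stack is emptied.
Hence bits computed from the least significant end come out in the right order; the invariants of
addition and subtraction rest on this. -/
theorem unstack_shl {S b : ℕ} (hS : 0 < S) (hb : b < 2) (z : ℕ) :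
    unstack (2 * S + b) z = unstack S (2 * z + b) := by
  rw [unstack_of_lt (by omega), show (2 * S + b) / 2 = S by omega,
    show (2 * S + b) % 2 = b by omega]

/-- Move the stack `28` to the number `27`. -/
def unstackBody : Cmd :=
  .op (.parity 30 28) ;; .op (.half 28 28) ;;
  .ifeq 30 0 (.op (.shl false 27 27)) (.op (.shl true 27 27))

def unstackCmd : Cmd := .whilene 28 1 unstackBody

theorem run_unstackBody (x : Word) (s : Store) (h0 : s.var 0 = 0) :
    (unstackBody.run x s).var 28 = s.var 28 / 2 ∧
    (unstackBody.run x s).var 27 = 2 * s.var 27 + s.var 28 % 2 ∧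
    (unstackBody.run x s).var 29 = s.var 29 := by
  simp only [unstackBody, Cmd.run, Op.eval, apply_ite Store.var, ite_apply, Store.var_set, h0]
  simp (decide := true) only [if_true, if_false]
  split_ifs with h <;> simp [h]
  omega

theorem exec_unstackCmd (x : Word) (s : Store) (h0 : s.var 0 = 0) (h1 : s.var 1 = 1)
    (hS : 0 < s.var 28) : ∃ s', Exec x unstackCmd s ((s.var 28).size * 8 + 1) s' ∧
      s'.var 27 = unstack (s.var 28) (s.var 27) ∧ s'.var 29 = s.var 29 ∧ Agree 25 s s' := by
  refine Exists.elim (Exec.whilene (x := x) (v := 28) (w := 1) (c := unstackBody) (n := 6)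
    (fun m t => t.var 28 ≠ 0 ∧ (t.var 28).size = m + 1 ∧ t.var 29 = s.var 29 ∧
      unstack (t.var 28) (t.var 27) = unstack (s.var 28) (s.var 27) ∧ Agree 25 s t) ?_ ?_
    ((s.var 28).size - 1) s ⟨hS.ne', by have := Nat.size_pos.2 hS; omega, rfl, rfl, .refl _ _⟩) fun s' ⟨h, hI⟩ => ?_
  rotate_right 1
  · have h3 : s'.var 28 < 2 ^ 1 := Nat.size_le.1 hI.2.1.le
    have h4 : s'.var 28 = 1 := by have := hI.1; omega
    refine ⟨s', h.mono (by omega), ?_, hI.2.2.1, hI.2.2.2.2⟩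
    rw [← hI.2.2.2.1, h4, unstack_one]
  · intro t ht
    have h3 : t.var 28 < 2 ^ 1 := Nat.size_le.1 ht.2.1.le
    rw [ht.2.2.2.2.var 1 (by simp), h1]
    have := ht.1
    omega
  · intro m t ⟨ht0, ht, ht29, htu, hta⟩
    have e0 : t.var 0 = 0 := by rw [hta.var 0 (by simp), h0]
    have e1 : t.var 1 = 1 := by rw [hta.var 1 (by simp), h1]
    have h2 : 1 < t.var 28 := by
      by_contra hlt
      have : t.var 28 = 1 := by omega
      rw [this] at ht
      simp at ht
    obtain ⟨r1, r2, r3⟩ := run_unstackBody x t e0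
    refine ⟨by rw [e1]; omega, _, exec_run rfl t, ?_, ?_, ?_, ?_, hta.trans (agree_run rfl t)⟩
    · rw [r1]; omega
    · rw [r1, size_half, ht]; rfl
    · rw [r3, ht29]
    · rw [r1, r2, ← htu, unstack_of_lt h2]

/-- Move the last bits of `25` and `26` to `30` and `31`, and apply `c`. -/
def bitBody (c : Cmd) : Cmd :=
  .op (.parity 30 25) ;; .op (.half 25 25) ;; .op (.parity 31 26) ;; .op (.half 26 26) ;; c

/-- Apply `c` to the bits of `25` and `26`, with a stack `28` and a carry `29`. -/
def bitLoop (c : Cmd) : Cmd :=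
  .op (.const 28 true) ;; .op (.const 29 false) ;; .op (.const 24 true) ;;
  .whilene 24 0
    (.ifeq 25 0 (.ifeq 26 0 (.op (.const 24 false)) (bitBody c)) (bitBody c))

/-- Common frame of addition and subtraction. `I` relates the stack of result bits, the carry and
the unread upper parts of the operands, and `c` must push one bit per round. Variable `24` is a
flag, needed because a loop can test a single equality while the end requires both operands to be
`0`; its last round only clears the flag, so there is one round more than there are bits. -/
theorem exec_bitLoop {x : Word} {c : Cmd} (hc : c.loopFree = true) (hw : c.writesFrom 25 = true)
    (I : ℕ → ℕ → ℕ → ℕ → Prop)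
    (h : ∀ (s : Store) (X Y : ℕ), s.var 0 = 0 → s.var 25 = X / 2 → s.var 26 = Y / 2 →
      s.var 30 = X % 2 → s.var 31 = Y % 2 → 0 < s.var 28 → I (s.var 28) (s.var 29) X Y →
      I ((c.run x s).var 28) ((c.run x s).var 29) (X / 2) (Y / 2) ∧
      (c.run x s).var 25 = X / 2 ∧ (c.run x s).var 26 = Y / 2 ∧
      ∃ b < 2, (c.run x s).var 28 = 2 * s.var 28 + b)
    (s : Store) (h0 : s.var 0 = 0) (hI : I 1 0 (s.var 25) (s.var 26)) {L : ℕ}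
    (hX : (s.var 25).size ≤ L) (hY : (s.var 26).size ≤ L) :
    ∃ s', Exec x (bitLoop c) s ((L + 1) * (c.size + 11) + 4) s' ∧ I (s'.var 28) (s'.var 29) 0 0 ∧
      0 < s'.var 28 ∧ (s'.var 28).size ≤ L + 1 ∧ Agree 24 s s' := by
  unfold bitLoop
  set body := bitBody c with hbd
  have hbf : body.loopFree = true := by simp [hbd, bitBody, Cmd.loopFree, hc]
  have hbw : body.writesFrom 25 = true := by simp [hbd, bitBody, Cmd.writesFrom, hw, Op.writesFrom]
  have hbs : body.size = c.size + 4 := by simp [hbd, bitBody, Cmd.size]; omega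
  have hbody : ∀ t : Store, t.var 0 = 0 → 0 < t.var 28 →
      I (t.var 28) (t.var 29) (t.var 25) (t.var 26) →
      I ((body.run x t).var 28) ((body.run x t).var 29) (t.var 25 / 2) (t.var 26 / 2) ∧
      (body.run x t).var 25 = t.var 25 / 2 ∧ (body.run x t).var 26 = t.var 26 / 2 ∧
      ∃ b < 2, (body.run x t).var 28 = 2 * t.var 28 + b := by
    intro t ht0 ht28 htI
    simp only [hbd, bitBody, Cmd.run, Op.eval]
    have := h ((((t.set 30 (t.var 25 % 2)).set 25 (t.var 25 / 2)).set 31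
      (t.var 26 % 2)).set 26 (t.var 26 / 2)) (t.var 25) (t.var 26)
      (by simpa [Store.var_set] using ht0) (by simp [Store.var_set]) (by simp [Store.var_set])
      (by simp [Store.var_set]) (by simp [Store.var_set]) (by simpa [Store.var_set] using ht28)
      (by simpa [Store.var_set] using htI)
    simpa [Store.var_set] using this
  set loopBody : Cmd := .ifeq 25 0 (.ifeq 26 0 (.op (.const 24 false)) body) body with hlb
  have hlf : loopBody.loopFree = true := by simp [hlb, Cmd.loopFree, hbf]
  have hls : loopBody.size = 2 * (c.size + 4) + 5 := by simp [hlb, Cmd.size, hbs]; omega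
  set s₁ := ((s.set 28 1).set 29 0).set 24 1 with hs₁
  have hexec : ∀ t : Store, t.var 0 = 0 → t.var 24 = 1 →
      (∃ k ≤ c.size + 8, Exec x loopBody t k (loopBody.run x t)) := by
    intro t ht0 ht24
    simp only [hlb, Cmd.run]
    split
    · split
      · exact ⟨_, by omega, ((Exec.op _ t).ifeq_pos ‹_›).ifeq_pos ‹_›⟩
      · exact ⟨_, by omega, ((exec_run hbf t).ifeq_neg ‹_›).ifeq_pos ‹_›⟩
    · exact ⟨_, by omega, (exec_run hbf t).ifeq_neg ‹_›⟩
  refine Exists.elim (Exec.whilene (x := x) (v := 24) (w := 0) (c := loopBody)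
    (n := c.size + 8)
    (fun m t => I (t.var 28) (t.var 29) (t.var 25) (t.var 26) ∧ 0 < t.var 28 ∧ Agree 24 s t ∧
      ((m = 0 ∧ t.var 24 = 0 ∧ t.var 25 = 0 ∧ t.var 26 = 0 ∧ (t.var 28).size ≤ L + 1) ∨
      (0 < m ∧ t.var 24 = 1 ∧ max (t.var 25).size (t.var 26).size + 1 = m ∧
        (t.var 28).size + m ≤ L + 2)))
    ?_ ?_ (max (s.var 25).size (s.var 26).size + 1) s₁ ?_) fun s' ⟨hs', hI'⟩ => ?_
  rotate_right 1
  · obtain ⟨h1, h2, h3, h4 | h4⟩ := hI'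
    · refine ⟨s', ?_, by simpa only [h4.2.2.1, h4.2.2.2.1] using h1, h2, h4.2.2.2.2, h3⟩
      refine ((((Exec.op (x := x) (.const 28 true) s).seq ((Exec.op (x := x) (.const 29 false) _).seq
        ((Exec.op (x := x) (.const 24 true) _).seq hs'))))).mono ?_
      have : (max (s.var 25).size (s.var 26).size + 1) * (c.size + 8 + 2) ≤
        (L + 1) * (c.size + 11) := Nat.mul_le_mul (by omega) (by omega)
      omega
    · omega
  · rintro t ⟨-, -, ha, h4 | h4⟩
    · rw [h4.2.1, ha.var 0 (by simp), h0]
    · omega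
  · rintro m t ⟨hI, h28, ha, h4 | h4⟩
    · omega
    have e0 : t.var 0 = 0 := by rw [ha.var 0 (by simp), h0]
    obtain ⟨k, hk, hex⟩ := hexec t e0 h4.2.1
    refine ⟨by omega, _, hex.mono hk, ?_⟩
    by_cases h00 : t.var 25 = 0 ∧ t.var 26 = 0
    · have hrun : loopBody.run x t = t.set 24 0 := by
        simp [hlb, Cmd.run, h00, e0, Op.eval]
      rw [hrun]
      have hm : m = 0 := by have := h4.2.2.1; rw [h00.1, h00.2] at this; simpa using this.symm
      refine ⟨by simpa [Store.var_set] using hI, by simpa [Store.var_set] using h28,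
        ha.trans (.set _ _ (by simp) _), .inl ⟨hm, by simp [Store.var_set], ?_, ?_, ?_⟩⟩
      · simpa [Store.var_set] using h00.1
      · simpa [Store.var_set] using h00.2
      · simp [Store.var_set]; omega
    · have hrun : loopBody.run x t = body.run x t := by
        simp only [hlb, Cmd.run, e0]
        split
        · split
          · exact absurd ⟨‹_›, ‹_›⟩ h00
          · rfl
        · rfl
      rw [hrun]
      obtain ⟨b1, b2, b3, b, hb, b4⟩ := hbody t e0 h28 hI
      have b24 : (body.run x t).var 24 = t.var 24 := (agree_run hbw t).var 24 (by simp)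
      have hsz := size_shl (t.var 28) hb
      have hpos : 0 < (t.var 25).size ∨ 0 < (t.var 26).size := by
        rw [Nat.size_pos, Nat.size_pos]; omega
      refine ⟨by rwa [b2, b3], by omega, ha.trans ((agree_run hbw t).mono (by simp)),
        .inr ⟨by omega, by omega, ?_, ?_⟩⟩
      · rw [b2, b3, size_half, size_half]; omega
      · rw [b4]; omega
  · refine ⟨by simpa [hs₁, Store.var_set] using hI, by simp [hs₁, Store.var_set],
      ((Agree.set 24 s (by simp) 1).trans (.set 24 _ (by simp) 0)).trans (.set 24 _ (by simp) 1),
      .inr ⟨by simp, by simp [hs₁, Store.var_set], ?_, ?_⟩⟩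
    · simp [hs₁, Store.var_set]
    · simp [hs₁, Store.var_set]; omega

/-- `27 := 25 + 26` -/
def addCmd : Cmd :=
  bitLoop (.ifeq 30 31 (.ifeq 29 0 (.op (.shl false 28 28)) (.op (.shl true 28 28)) ;;
      .op (.copy 29 30))
    (.ifeq 29 0 (.op (.shl true 28 28)) (.op (.shl false 28 28)))) ;;
  .op (.copy 27 29) ;; unstackCmd

theorem exec_addCmd (x : Word) (s : Store) (h0 : s.var 0 = 0) (h1 : s.var 1 = 1) {L : ℕ}
    (hX : (s.var 25).size ≤ L) (hY : (s.var 26).size ≤ L) :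
    ∃ s', Exec x addCmd s ((L + 1) * 40) s' ∧ s'.var 27 = s.var 25 + s.var 26 ∧ Agree 24 s s' := by
  obtain ⟨s₁, h₁, hI, hpos, hsz, ha⟩ := exec_bitLoop (x := x)
    (c := .ifeq 30 31 (.ifeq 29 0 (.op (.shl false 28 28)) (.op (.shl true 28 28)) ;;
      .op (.copy 29 30)) (.ifeq 29 0 (.op (.shl true 28 28)) (.op (.shl false 28 28)))) rfl rfl
    -- Putting the stacked bits below the sum of the unread parts and the carry always gives the
    -- total.
    (fun S c X Y => c < 2 ∧ unstack S (X + Y + c) = s.var 25 + s.var 26) (by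
      intro t X Y t0 t25 t26 t30 t31 hpos ⟨hc, hu⟩
      simp only [Cmd.run, Op.eval, apply_ite Store.var, ite_apply, Store.var_set]
      simp (decide := true) only [if_true, if_false, t0, t25, t26, t30, t31, Bool.toNat_true,
        Bool.toNat_false]
      split_ifs with e1 e2 e2
      · refine ⟨⟨by omega, ?_⟩, rfl, rfl, 0, by simp, rfl⟩
        rw [unstack_shl hpos (by simp), ← hu]; congr 1; omega
      · refine ⟨⟨by omega, ?_⟩, rfl, rfl, 1, by simp, rfl⟩
        rw [unstack_shl hpos (by simp), ← hu]; congr 1; omega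
      · refine ⟨⟨by omega, ?_⟩, rfl, rfl, 1, by simp, rfl⟩
        rw [unstack_shl hpos (by simp), ← hu]; congr 1; omega
      · refine ⟨⟨by omega, ?_⟩, rfl, rfl, 0, by simp, rfl⟩
        rw [unstack_shl hpos (by simp), ← hu]; congr 1; omega)
    s h0 ⟨by simp, by rw [unstack_one]; rfl⟩ hX hY
  set s₂ := s₁.set 27 (s₁.var 29) with hs₂
  have ha₂ : Agree 24 s s₂ := ha.trans (.set _ _ (by simp) _)
  have e28 : s₂.var 28 = s₁.var 28 := by simp [hs₂, Store.var_set]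
  obtain ⟨s₃, h₃, hz, -, ha₃⟩ := exec_unstackCmd x s₂ (by rw [ha₂.var 0 (by simp), h0])
    (by rw [ha₂.var 1 (by simp), h1]) (by rw [e28]; exact hpos)
  refine ⟨s₃, (h₁.seq ((Exec.op (.copy 27 29) s₁).seq h₃)).mono ?_, ?_,
    ha₂.trans (ha₃.mono (by simp))⟩
  · rw [e28]
    simp only [Cmd.size]
    omega
  · rw [hz, e28, ← hI.2]
    simp [hs₂, Store.var_set]

/-- `27 := 25 - 26`, and `29 := 1` if `25 < 26`, otherwise `29 := 0` -/
def subCmd : Cmd :=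
  bitLoop (.ifeq 30 31 (.ifeq 29 0 (.op (.shl false 28 28)) (.op (.shl true 28 28)))
    (.ifeq 29 0 (.op (.shl true 28 28)) (.op (.shl false 28 28)) ;; .op (.copy 29 31))) ;;
  .op (.const 27 false) ;; unstackCmd ;; .ifeq 29 0 .skip (.op (.const 27 false))

theorem exec_subCmd (x : Word) (s : Store) (h0 : s.var 0 = 0) (h1 : s.var 1 = 1) {L : ℕ}
    (hX : (s.var 25).size ≤ L) (hY : (s.var 26).size ≤ L) :
    ∃ s', Exec x subCmd s ((L + 1) * 40) s' ∧ s'.var 27 = s.var 25 - s.var 26 ∧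
      s'.var 29 = (if s.var 25 < s.var 26 then 1 else 0) ∧ Agree 24 s s' := by
  obtain ⟨s₁, h₁, hI, hpos, hsz, ha⟩ := exec_bitLoop (x := x)
    (c := .ifeq 30 31 (.ifeq 29 0 (.op (.shl false 28 28)) (.op (.shl true 28 28)))
    (.ifeq 29 0 (.op (.shl true 28 28)) (.op (.shl false 28 28)) ;; .op (.copy 29 31))) rfl rfl
    -- Here `c` is a borrow. Comparing the unread parts, with the borrow, gives the comparison of
    -- the full operands; the stack is meaningful only when the difference is not negative.
    (fun S c X Y => c < 2 ∧ (Y + c ≤ X → unstack S (X - (Y + c)) = s.var 25 - s.var 26 ∧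
      s.var 26 ≤ s.var 25) ∧ (X < Y + c → s.var 25 < s.var 26)) (by
      intro t X Y t0 t25 t26 t30 t31 hpos ⟨hc, hu, hu'⟩
      simp only [Cmd.run, Op.eval, apply_ite Store.var, ite_apply, Store.var_set]
      simp (decide := true) only [if_true, if_false, t0, t25, t26, t30, t31, Bool.toNat_true,
        Bool.toNat_false]
      split_ifs with e1 e2 e2
      · refine ⟨⟨by omega, fun h => ?_, fun h => hu' (by omega)⟩, rfl, rfl, 0, by simp, rfl⟩
        obtain ⟨hu1, hu2⟩ := hu (by omega)
        refine ⟨?_, hu2⟩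
        rw [unstack_shl hpos (by simp), ← hu1]; congr 1; omega
      · refine ⟨⟨by omega, fun h => ?_, fun h => hu' (by omega)⟩, rfl, rfl, 1, by simp, rfl⟩
        obtain ⟨hu1, hu2⟩ := hu (by omega)
        refine ⟨?_, hu2⟩
        rw [unstack_shl hpos (by simp), ← hu1]; congr 1; omega
      · refine ⟨⟨by omega, fun h => ?_, fun h => hu' (by omega)⟩, rfl, rfl, 1, by simp, rfl⟩
        obtain ⟨hu1, hu2⟩ := hu (by omega)
        refine ⟨?_, hu2⟩
        rw [unstack_shl hpos (by simp), ← hu1]; congr 1; omega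
      · refine ⟨⟨by omega, fun h => ?_, fun h => hu' (by omega)⟩, rfl, rfl, 0, by simp, rfl⟩
        obtain ⟨hu1, hu2⟩ := hu (by omega)
        refine ⟨?_, hu2⟩
        rw [unstack_shl hpos (by simp), ← hu1]; congr 1; omega)
    s h0 ⟨by simp, fun h => ⟨by rw [unstack_one]; rfl, h⟩, fun h => h⟩ hX hY
  set s₂ := s₁.set 27 0 with hs₂
  have ha₂ : Agree 24 s s₂ := ha.trans (.set _ _ (by simp) _)
  have e28 : s₂.var 28 = s₁.var 28 := by simp [hs₂, Store.var_set]
  have e29 : s₂.var 29 = s₁.var 29 := by simp [hs₂, Store.var_set]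
  have e27 : s₂.var 27 = 0 := by simp [hs₂, Store.var_set]
  obtain ⟨s₃, h₃, hz, h29, ha₃⟩ := exec_unstackCmd x s₂ (by rw [ha₂.var 0 (by simp), h0])
    (by rw [ha₂.var 1 (by simp), h1]) (by rw [e28]; exact hpos)
  have ha₃' : Agree 24 s s₃ := ha₂.trans (ha₃.mono (by simp))
  have h30 : s₃.var 0 = 0 := by rw [ha₃'.var 0 (by simp), h0]
  refine ⟨_, (h₁.seq ((Exec.op (.const 27 false) s₁).seq (h₃.seq
    (exec_run (c := .ifeq 29 0 .skip (.op (.const 27 false))) rfl s₃)))).mono ?_, ?_, ?_,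
    ha₃'.trans (agree_run rfl s₃)⟩
  · rw [e28]
    simp only [Cmd.size]
    omega
  · obtain ⟨hc, hle, hlt⟩ := hI
    simp only [Cmd.run, h30, h29, e29, Op.eval, apply_ite Store.var, ite_apply, Store.var_set]
    -- A borrow left at the end means a negative difference, and the result is truncated to `0`.
    split_ifs with hc0
    · rw [hz, e28, e27, ← (hle (by omega)).1, hc0]
    · have := hlt (by omega)
      simp
      omega
  · obtain ⟨hc, hle, hlt⟩ := hI
    simp only [Cmd.run, h30, h29, e29, Op.eval, apply_ite Store.var, ite_apply, Store.var_set]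
    simp (decide := true) only [if_false]
    split_ifs with hc0 hlt' hlt'
    · have := (hle (by omega)).2; omega
    · exact hc0
    · omega
    · have := hlt (by omega); omega

/-- One round of the multiplication of `21` and `22`, with accumulator `23`. -/
def mulBody : Cmd :=
  .op (.parity 25 21) ;;
  .ifeq 25 0 .skip (.op (.copy 25 23) ;; .op (.copy 26 22) ;; addCmd ;; .op (.copy 23 27)) ;;
  .op (.half 21 21) ;; .op (.shl false 22 22)

/-- `27 := 25 * 26` -/
def mulCmd : Cmd :=
  .op (.copy 21 25) ;; .op (.copy 22 26) ;; .op (.const 23 false) ;; .whilene 21 0 mulBody ;;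
  .op (.copy 27 23)

theorem size_mul_le (a b : ℕ) : (a * b).size ≤ a.size + b.size := by
  rw [Nat.size_le, pow_add]
  exact Nat.mul_lt_mul'' (Nat.lt_size_self a) (Nat.lt_size_self b)

/-- School multiplication: variable `23` plus the product of `21` and `22` is invariant, while `21`
is halved and `22` doubled. One addition per bit makes the time quadratic in the length. -/
theorem exec_mulCmd (x : Word) (s : Store) (h0 : s.var 0 = 0) (h1 : s.var 1 = 1) {L : ℕ}
    (hX : (s.var 25).size ≤ L) (hY : (s.var 26).size ≤ L) :
    ∃ s', Exec x mulCmd s ((L + 1) * (L + 1) * 100) s' ∧ s'.var 27 = s.var 25 * s.var 26 ∧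
      Agree 21 s s' := by
  set s₁ := ((s.set 21 (s.var 25)).set 22 (s.var 26)).set 23 0 with hs₁
  have ha₁ : Agree 21 s s₁ := ((Agree.set 21 s (by simp) _).trans
    (.set _ _ (by simp) _)).trans (.set _ _ (by simp) _)
  set X := s.var 25 with hXdef
  set Y := s.var 26 with hYdef
  refine Exists.elim (Exec.whilene (x := x) (v := 21) (w := 0) (c := mulBody) (n := (2 * L + 1) * 40 + 8)
    (fun m t => Agree 21 s t ∧ (t.var 21).size = m ∧ t.var 23 + t.var 21 * t.var 22 = X * Y ∧
      (t.var 22).size + m ≤ L + L) ?_ ?_ X.size s₁ ?_) fun s₂ ⟨h₂, hI⟩ => ?_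
  rotate_right 1
  · have e21 : s₂.var 21 = 0 := Nat.size_eq_zero.1 hI.2.1
    refine ⟨s₂.set 27 (s₂.var 23), ((Exec.op (.copy 21 25) s).seq ((Exec.op (.copy 22 26) _).seq
      ((Exec.op (.const 23 false) _).seq (h₂.seq (Exec.op (.copy 27 23) _))))).mono ?_, ?_,
      hI.1.trans (.set _ _ (by simp) _)⟩
    · have : X.size * ((2 * L + 1) * 40 + 8 + 2) ≤ L * ((2 * L + 1) * 40 + 8 + 2) :=
        Nat.mul_le_mul_right _ hX
      nlinarith
    · have := hI.2.2.1
      rw [e21] at this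
      simp [Store.var_set]
      omega
  · rintro t ⟨ha, hs, -, -⟩
    rw [Nat.size_eq_zero.1 hs, ha.var 0 (by simp), h0]
  · rintro m t ⟨ha, hs, heq, hle⟩
    have e0 : t.var 0 = 0 := by rw [ha.var 0 (by simp), h0]
    have e1 : t.var 1 = 1 := by rw [ha.var 1 (by simp), h1]
    have hpos : 0 < t.var 21 := Nat.size_pos.1 (by omega)
    refine ⟨by omega, ?_⟩
    set t₁ := t.set 25 (t.var 21 % 2) with ht₁
    obtain ⟨t₂, hex, ha₂, h21, h22, h23⟩ : ∃ t₂, Exec x (.ifeq 25 0 .skip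
        (.op (.copy 25 23) ;; .op (.copy 26 22) ;; addCmd ;; .op (.copy 23 27))) t₁
        ((2 * L + 1) * 40 + 5) t₂ ∧ Agree 21 t t₂ ∧ t₂.var 21 = t.var 21 ∧
        t₂.var 22 = t.var 22 ∧ t₂.var 23 = t.var 23 + t.var 21 % 2 * t.var 22 := by
      by_cases hodd : t.var 21 % 2 = 0
      · refine ⟨t₁, (Exec.skip.ifeq_pos (by simp [ht₁, Store.var_set, hodd, e0])).mono (by omega),
          .set _ _ (by simp) _, ?_, ?_, ?_⟩ <;> simp [ht₁, Store.var_set, hodd]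
      · have hodd' : t.var 21 % 2 = 1 := by omega
        set t₂ := (t₁.set 25 (t.var 23)).set 26 (t.var 22) with ht₂
        have hat : Agree 24 t t₂ := ((Agree.set 24 t (by simp) _).trans
          (.set _ _ (by simp) _)).trans (.set _ _ (by simp) _)
        -- By the invariant the accumulator never exceeds the product.
        have hsz : (t.var 23).size ≤ 2 * L := by
          refine (Nat.size_le_size (Nat.le.intro heq)).trans ((size_mul_le _ _).trans ?_)
          omega
        obtain ⟨t₃, hex, h27, ha₃⟩ := exec_addCmd x t₂ (by rw [hat.var 0 (by simp), e0])
          (by rw [hat.var 1 (by simp), e1]) (L := 2 * L) (by simpa [ht₂, Store.var_set] using hsz)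
          (by simp [ht₂, Store.var_set]; omega)
        have ha' := hat.trans ha₃
        refine ⟨t₃.set 23 (t₃.var 27), ?_, (ha'.mono (by simp)).trans (.set _ _ (by simp) _),
          ?_, ?_, ?_⟩
        · refine (Exec.ifeq_neg (by simp [ht₁, Store.var_set, hodd, e0])
            ((Exec.op (.copy 25 23) t₁).seq ((Exec.op (.copy 26 22) _).seq
            (Exec.seq (s' := t₃) ?_ (Exec.op (.copy 23 27) _))))).mono
              (n := 1 + (1 + ((2 * L + 1) * 40 + 1)) + 2) (by omega)
          exact hex
        · simp only [Store.set]; rw [update_of_ne (by simp), ha'.var 21 (by simp)]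
        · simp only [Store.set]; rw [update_of_ne (by simp), ha'.var 22 (by simp)]
        · simp [Store.var_set, h27, ht₂, hodd']
    refine ⟨(t₂.set 21 (t.var 21 / 2)).set 22 (2 * t.var 22), ?_,
      ha.trans (ha₂.trans ((Agree.set _ _ (by simp) _).trans (.set _ _ (by simp) _))), ?_, ?_, ?_⟩
    · rw [← h21, ← h22]
      exact ((Exec.op (.parity 25 21) t).seq (hex.seq ((Exec.op (.half 21 21) _).seq
        (Exec.op (.shl false 22 22) _)))).mono (by omega)
    · simp only [Store.set]
      rw [update_of_ne (by simp), update_self, size_half, hs, Nat.add_sub_cancel]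
    · simp only [Store.set]
      simp only [update_apply]
      simp (decide := true) only [if_true, if_false]
      rw [h23, ← heq, Nat.add_assoc]
      congr 1
      have : t.var 21 = 2 * (t.var 21 / 2) + t.var 21 % 2 := by omega
      conv_rhs => rw [this]
      ring
    · have := size_shl (t.var 22) (b := 0) (by simp)
      simp only [Store.set, update_self]
      simp only [Nat.add_zero] at this
      omega
  · refine ⟨ha₁, by simp [hs₁, Store.var_set], ?_, ?_⟩
    · simp [hs₁, Store.var_set]
    · simp [hs₁, Store.var_set]; omega

end BitMachine

/-! ### Coding the programs of random access machines -/

namespace EnumRAM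

/-- The instructions of random access machines are coded by four numbers. -/
def Instr.fields : Instr → List ℕ
  | .halt => [0, 0, 0, 0]
  | .const d c => [1, d, c, 0]
  | .copy d s => [2, d, s, 0]
  | .load d s => [3, d, s, 0]
  | .store d s => [4, d, s, 0]
  | .read d s => [5, d, s, 0]
  | .add d s t => [6, d, s, t]
  | .sub d s t => [7, d, s, t]
  | .mul d s t => [8, d, s, t]
  | .jump l => [9, l, 0, 0]
  | .jumpLT s t l => [10, s, t, l]
  | .output s t => [11, s, t, 0]

theorem Instr.length_fields (i : Instr) : i.fields.length = 4 := by cases i <;> rfl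

/-- The code of the program of a machine. -/
def RAM.fields (M : RAM) : List ℕ := M.program.flatMap Instr.fields

/-- The default `0` outside of the code matches the fields of `halt`, so leaving the program looks
like halting. -/
theorem getD_fields (L : List Instr) (p : ℕ) {j : ℕ} (hj : j < 4) :
    (L.flatMap Instr.fields).getD (4 * p + j) 0 = ((L[p]?.getD .halt).fields).getD j 0 := by
  induction L generalizing p with
  | nil =>
    simp only [List.flatMap_nil, List.getElem?_nil, Option.getD_none, Instr.fields]
    obtain rfl | rfl | rfl | rfl : j = 0 ∨ j = 1 ∨ j = 2 ∨ j = 3 := by omega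
    all_goals rfl
  | cons i L ih =>
    rw [List.flatMap_cons]
    cases p with
    | zero =>
      rw [List.getD_append _ _ _ _ (by rw [i.length_fields]; omega)]
      simp
    | succ p =>
      rw [List.getD_append_right _ _ _ _ (by rw [i.length_fields]; omega), i.length_fields,
        show 4 * (p + 1) + j - 4 = 4 * p + j by omega, ih p]
      simp

/-- Every numeral is nonempty, so a one-letter output comes from a single register. The simulator
can thus recognize the word `1` by two comparisons, without forming the output. -/
theorem outputWord_eq_true {R : ℕ → ℕ} {a b : ℕ} :
    outputWord R a b = [true] ↔ a = b ∧ R a = 1 := by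
  have hlen : ∀ L : List ℕ, L.length ≤ (L.flatMap fun i => numeral (R i)).length := fun L => by
    induction L with
    | nil => simp
    | cons i L ih =>
      have : 0 < (numeral (R i)).length := by
        unfold numeral
        split
        · simp
        · rename_i h
          rw [List.length_reverse, Nat.size_eq_bits_len, Nat.size_pos]; omega
      simp only [List.flatMap_cons, List.length_append, List.length_cons]
      omega
  constructor
  · intro h
    have h1 := hlen (List.range' a (b + 1 - a))
    rw [← outputWord, h] at h1
    simp only [List.length_range', List.length_singleton] at h1
    have h2 : b + 1 - a ≠ 0 := fun h0 => by simp [outputWord, h0] at h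
    have hab : a = b := by omega
    subst hab
    rw [outputWord_self, ← numeral_one] at h
    exact ⟨rfl, numeral_injective h⟩
  · rintro ⟨rfl, h⟩
    rw [outputWord_self, h, numeral_one]

/-- Links the two cost models: the time charged for an arithmetic instruction bounds the lengths of
its operands, and so the time of their bitwise treatment. -/
theorem size_le_arithCost (a b : ℕ) : a.size ≤ arithCost a b ∧ b.size ≤ arithCost a b := by
  have h := Nat.lt_pow_succ_log_self (b := 2) (by simp) (a + b)
  rw [Nat.size_le, Nat.size_le]
  unfold arithCost
  rw [Nat.add_comm 1]
  simp only [Nat.succ_eq_add_one] at h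
  omega

end EnumRAM

namespace BitMachine

/-! ### Simulation of random access machines by bit machines -/

/-- `v := v + 1` -/
def succCmd (v : Fin 32) : Cmd :=
  .op (.copy 25 v) ;; .op (.copy 26 1) ;; addCmd ;; .op (.copy v 27)

theorem exec_succCmd (x : Word) (v : Fin 32) (s : Store) (h0 : s.var 0 = 0)
    (h1 : s.var 1 = 1) {L : ℕ} (hL : (s.var v).size ≤ L) (hL1 : 1 ≤ L) :
    ∃ s', Exec x (succCmd v) s ((L + 1) * 40 + 3) s' ∧ Agree 24 (s.set v (s.var v + 1)) s' := by
  set s₁ := (s.set 25 (s.var v)).set 26 1 with hs₁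
  have ha : Agree 24 s s₁ := (Agree.set 24 s (by simp) _).trans (.set _ _ (by simp) _)
  obtain ⟨s₂, h₂, hz, ha₂⟩ := exec_addCmd x s₁ (by rw [ha.var 0 (by simp), h0])
    (by rw [ha.var 1 (by simp), h1]) (L := L) (by simpa [hs₁, Store.var_set] using hL)
    (by simpa [hs₁, Store.var_set] using hL1)
  have ha' := ha.trans ha₂
  refine ⟨s₂.set v (s₂.var 27), ?_, ⟨fun w hw => ?_, ha'.arr, ha'.pos⟩⟩
  · refine ((Exec.op (.copy 25 v) s).seq (Exec.seq (s' := s₁) (n := 1) ?_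
      (h₂.seq (Exec.op (.copy v 27) s₂)))).mono (by omega)
    have e : (s.set 25 (s.var v)).var 1 = 1 := by simp [Store.var_set, h1]
    have h' := Exec.op (x := x) (.copy 26 1) (s.set 25 (s.var v))
    simp only [Op.eval, e] at h'
    exact h'
  · rw [Store.var_set, Store.var_set]
    split
    · rw [hz]; simp [hs₁, Store.var_set]
    · exact ha'.var w hw

/-- The memory `s` represents a random access machine with program code `F`, on input `x`, at
instruction `pc`, with registers `reg`; the variable `2` says whether to go on. -/
structure Rep (F : ℕ → ℕ) (x : Word) (pc : ℕ) (reg : ℕ → ℕ) (go : ℕ) (s : Store) : Prop where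
  zero : s.var 0 = 0
  one : s.var 1 = 1
  go : s.var 2 = go
  pc : s.var 3 = 4 * pc
  reg : s.arr 0 = reg
  inp : s.arr 1 = inputReg x
  prog : s.arr 2 = F

theorem Rep.agree {F : ℕ → ℕ} {x : Word} {pc go n : ℕ} {reg : ℕ → ℕ} {s s' : Store}
    (h : Rep F x pc reg go s) (ha : Agree n s s') (hn : 4 ≤ n) : Rep F x pc reg go s' where
  zero := by rw [ha.var 0 (by simp; omega), h.zero]
  one := by rw [ha.var 1 (by simp; omega), h.one]
  go := by rw [ha.var 2 (by simp; omega), h.go]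
  pc := by rw [ha.var 3 (by simp; omega), h.pc]
  reg := by rw [ha.arr, h.reg]
  inp := by rw [ha.arr, h.inp]
  prog := by rw [ha.arr, h.prog]

/-- Fetch the fields of an instruction. -/
def fetchCmd : Cmd :=
  .op (.copy 8 3) ;; .op (.get 4 2 8) ;; succCmd 8 ;; .op (.get 5 2 8) ;; succCmd 8 ;;
  .op (.get 6 2 8) ;; succCmd 8 ;; .op (.get 7 2 8) ;; succCmd 8 ;; .op (.copy 15 4)

/-- The instruction number is kept multiplied by four, as an address in the array of fields. Four
increments pass over the fields and leave the address of the next instruction in variable `8`. -/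
theorem exec_fetchCmd {F : ℕ → ℕ} {x : Word} {pc go : ℕ} {reg : ℕ → ℕ} {s : Store}
    (h : Rep F x pc reg go s) {L : ℕ} (hL : (4 * pc + 4).size ≤ L) :
    ∃ s', Exec x fetchCmd s (4 * ((L + 1) * 40 + 3) + 6) s' ∧ Rep F x pc reg go s' ∧
      s'.var 4 = F (4 * pc) ∧ s'.var 5 = F (4 * pc + 1) ∧ s'.var 6 = F (4 * pc + 2) ∧
      s'.var 7 = F (4 * pc + 3) ∧ s'.var 8 = 4 * (pc + 1) ∧ s'.var 15 = F (4 * pc) := by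
  have hL' : ∀ j ≤ 4, (4 * pc + j).size ≤ L := fun j hj =>
    (Nat.size_le_size (by omega)).trans hL
  have hL1 : 1 ≤ L := le_trans (Nat.size_pos.2 (by omega)) hL
  obtain ⟨h0, h1, h2, h3, hr, hi, hp⟩ := h
  set t₀ := (s.set 8 (4 * pc)).set 4 (F (4 * pc)) with ht₀
  obtain ⟨s₁, e₁, a₁⟩ := exec_succCmd x 8 t₀ (by simpa [ht₀, Store.var_set] using h0)
    (by simpa [ht₀, Store.var_set] using h1) (L := L)
    (by simpa [ht₀, Store.var_set] using hL' 0 (by simp)) hL1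
  have a8 := a₁.var 8 (by simp)
  have a0 := a₁.var 0 (by simp)
  have a1 := a₁.var 1 (by simp)
  have aa := a₁.arr
  simp [Store.var_set, ht₀] at a8 a0 a1
  set t₁ := s₁.set 5 (F (4 * pc + 1)) with ht₁
  obtain ⟨s₂, e₂, a₂⟩ := exec_succCmd x 8 t₁ (by simp [ht₁, Store.var_set, a0, h0])
    (by simp [ht₁, Store.var_set, a1, h1]) (L := L)
    (by simpa [ht₁, Store.var_set, a8] using hL' 1 (by simp)) hL1
  have b8 := a₂.var 8 (by simp)
  have b0 := a₂.var 0 (by simp)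
  have b1 := a₂.var 1 (by simp)
  have ba := a₂.arr
  simp [Store.var_set, ht₁, a8, a0, a1] at b8 b0 b1
  set t₂ := s₂.set 6 (F (4 * pc + 2)) with ht₂
  obtain ⟨s₃, e₃, a₃⟩ := exec_succCmd x 8 t₂ (by simp [ht₂, Store.var_set, b0, h0])
    (by simp [ht₂, Store.var_set, b1, h1]) (L := L)
    (by simpa [ht₂, Store.var_set, b8] using hL' 2 (by simp)) hL1
  have c8 := a₃.var 8 (by simp)
  have c0 := a₃.var 0 (by simp)
  have c1 := a₃.var 1 (by simp)
  have ca := a₃.arr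
  simp [Store.var_set, ht₂, b8, b0, b1] at c8 c0 c1
  set t₃ := s₃.set 7 (F (4 * pc + 3)) with ht₃
  obtain ⟨s₄, e₄, a₄⟩ := exec_succCmd x 8 t₃ (by simp [ht₃, Store.var_set, c0, h0])
    (by simp [ht₃, Store.var_set, c1, h1]) (L := L)
    (by simpa [ht₃, Store.var_set, c8] using hL' 3 (by simp)) hL1
  have arr₁ : s₁.arr = s.arr := aa
  have arr₂ : s₂.arr = s.arr := ba.trans arr₁
  have arr₃ : s₃.arr = s.arr := ca.trans arr₂
  have arr₄ : s₄.arr = s.arr := a₄.arr.trans arr₃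
  have g₀ : Exec x (.op (.copy 8 3)) s 1 (s.set 8 (4 * pc)) := by
    rw [← h3]; exact Exec.op (.copy 8 3) s
  have g₁ : Exec x (.op (.get 4 2 8)) (s.set 8 (4 * pc)) 1 t₀ := by
    convert Exec.op (x := x) (.get 4 2 8) (s.set 8 (4 * pc)) using 1
    rw [ht₀, ← hp]; rfl
  have g₂ : Exec x (.op (.get 5 2 8)) s₁ 1 t₁ := by
    convert Exec.op (x := x) (.get 5 2 8) s₁ using 1
    rw [ht₁, ← hp, ← arr₁, ← a8]; rfl
  have g₃ : Exec x (.op (.get 6 2 8)) s₂ 1 t₂ := by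
    convert Exec.op (x := x) (.get 6 2 8) s₂ using 1
    rw [ht₂, ← hp, ← arr₂, ← b8]; rfl
  have g₄ : Exec x (.op (.get 7 2 8)) s₃ 1 t₃ := by
    convert Exec.op (x := x) (.get 7 2 8) s₃ using 1
    rw [ht₃, ← hp, ← arr₃, ← c8]; rfl
  have var₁ : ∀ v : Fin 32, (v : ℕ) < 24 → v ≠ 8 → s₁.var v = t₀.var v := fun v hv h8 => by
    rw [a₁.var v hv, Store.var_set, if_neg h8]
  have var₂ : ∀ v : Fin 32, (v : ℕ) < 24 → v ≠ 8 → s₂.var v = t₁.var v := fun v hv h8 => by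
    rw [a₂.var v hv, Store.var_set, if_neg h8]
  have var₃ : ∀ v : Fin 32, (v : ℕ) < 24 → v ≠ 8 → s₃.var v = t₂.var v := fun v hv h8 => by
    rw [a₃.var v hv, Store.var_set, if_neg h8]
  have var₄ : ∀ v : Fin 32, (v : ℕ) < 24 → v ≠ 8 → s₄.var v = t₃.var v := fun v hv h8 => by
    rw [a₄.var v hv, Store.var_set, if_neg h8]
  have d8 : s₄.var 8 = 4 * (pc + 1) := by
    rw [a₄.var 8 (by simp)]; simp [Store.var_set, ht₃, c8]; omega
  have d : ∀ v : Fin 32, (v : ℕ) < 24 → v ≠ 8 → s₄.var v = if v = 7 then F (4 * pc + 3) else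
      if v = 6 then F (4 * pc + 2) else if v = 5 then F (4 * pc + 1) else
      if v = 4 then F (4 * pc) else s.var v := fun v hv h8 => by
    rw [var₄ v hv h8, ht₃, Store.var_set, var₃ v hv h8, ht₂, Store.var_set, var₂ v hv h8, ht₁,
      Store.var_set, var₁ v hv h8, ht₀, Store.var_set, Store.var_set, if_neg h8]
  have d4 : s₄.var 4 = F (4 * pc) := (d 4 (by simp) (by simp)).trans (by simp)
  refine ⟨s₄.set 15 (F (4 * pc)), (g₀.seq (g₁.seq (e₁.seq (g₂.seq (e₂.seq (g₃.seq (e₃.seq (g₄.seq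
    (e₄.seq (n' := 1) ?_))))))))).mono (by omega), ⟨?_, ?_, ?_, ?_, ?_, ?_, ?_⟩, ?_, ?_, ?_, ?_,
    ?_, ?_⟩
  · rw [← d4]; exact Exec.op (.copy 15 4) s₄
  · rw [Store.var_set, if_neg (by simp), d _ (by simp) (by simp), ← h0]; simp
  · rw [Store.var_set, if_neg (by simp), d _ (by simp) (by simp), ← h1]; simp
  · rw [Store.var_set, if_neg (by simp), d _ (by simp) (by simp), ← h2]; simp
  · rw [Store.var_set, if_neg (by simp), d _ (by simp) (by simp), ← h3]; simp
  · exact (congrFun arr₄ 0).trans hr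
  · exact (congrFun arr₄ 1).trans hi
  · exact (congrFun arr₄ 2).trans hp
  · rw [Store.var_set, if_neg (by simp), d4]
  · rw [Store.var_set, if_neg (by simp), d _ (by simp) (by simp)]; simp
  · rw [Store.var_set, if_neg (by simp), d _ (by simp) (by simp)]; simp
  · rw [Store.var_set, if_neg (by simp), d _ (by simp) (by simp)]; simp
  · rw [Store.var_set, if_neg (by simp), d8]
  · rw [Store.var_set, if_pos rfl]

/-- Branching according to the last `k` bits of variable `15`. -/
def switchCmd : ℕ → (ℕ → Cmd) → Cmd
  | 0, f => f 0
  | k + 1, f =>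
    .op (.parity 16 15) ;; .op (.half 15 15) ;;
    .ifeq 16 0 (switchCmd k fun i => f (2 * i)) (switchCmd k fun i => f (2 * i + 1))

/-- The code is a complete binary decision tree whose leaves are the programs `f i`. The path
depends on the memory only, so the memory at the leaf can be chosen before the run of the leaf is
known. -/
theorem exec_switchCmd (x : Word) (k : ℕ) (f : ℕ → Cmd) (s : Store) (h0 : s.var 0 = 0)
    (h : s.var 15 < 2 ^ k) : ∃ s', Agree 15 s s' ∧ ∀ n s'', Exec x (f (s.var 15)) s' n s'' →
      Exec x (switchCmd k f) s (n + 4 * k) s'' := by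
  induction k generalizing f s with
  | zero =>
    refine ⟨s, .refl _ _, fun n s'' h' => ?_⟩
    rw [pow_zero, Nat.lt_one_iff] at h
    rw [h] at h'
    exact h'
  | succ k ih =>
    set s₁ := (s.set 16 (s.var 15 % 2)).set 15 (s.var 15 / 2) with hs₁
    have ha : Agree 15 s s₁ := (Agree.set _ _ (by simp) _).trans (.set _ _ (by simp) _)
    have e0 : s₁.var 0 = 0 := by rw [ha.var 0 (by simp), h0]
    have e15 : s₁.var 15 = s.var 15 / 2 := by simp [hs₁, Store.var_set]
    have e16 : s₁.var 16 = s.var 15 % 2 := by simp [hs₁, Store.var_set]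
    have hlt : s₁.var 15 < 2 ^ k := by rw [e15]; rw [pow_succ] at h; omega
    have hpre : ∀ c n s'', Exec x c s₁ n s'' →
        Exec x (.op (.parity 16 15) ;; .op (.half 15 15) ;; c) s (n + 2) s'' := fun c n s'' h' =>
      ((Exec.op (.parity 16 15) s).seq ((Exec.op (.half 15 15) _).seq h')).mono (by omega)
    rcases Nat.mod_two_eq_zero_or_one (s.var 15) with hm | hm
    · obtain ⟨s', ha', he⟩ := ih (fun i => f (2 * i)) s₁ e0 hlt
      refine ⟨s', ha.trans ha', fun n s'' h' => (hpre _ _ _ ((he n s'' ?_).ifeq_pos ?_)).mono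
        (by omega)⟩
      · rw [e15, show 2 * (s.var 15 / 2) = s.var 15 by omega]; exact h'
      · rw [e16, e0, hm]
    · obtain ⟨s', ha', he⟩ := ih (fun i => f (2 * i + 1)) s₁ e0 hlt
      refine ⟨s', ha.trans ha', fun n s'' h' => (hpre _ _ _ ((he n s'' ?_).ifeq_neg ?_)).mono
        (by omega)⟩
      · rw [e15, show 2 * (s.var 15 / 2) + 1 = s.var 15 by omega]; exact h'
      · rw [e16, e0, hm]; simp

end BitMachine

/-! ### Simulation of each RAM instruction -/

namespace BitMachine

/-- Put variable `27` into the register with the address in variable `17`, and go to the next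
instruction. -/
def writeCmd : Cmd := .op (.copy 3 8) ;; .op (.put 0 17 27)

def goToCmd (v : Fin 32) : Cmd := .op (.shl false 3 v) ;; .op (.shl false 3 3)

/-- The programs for the instructions of random access machines. -/
def instrCmd : ℕ → Cmd
  | 1 => .op (.copy 17 5) ;; .op (.copy 27 6) ;; writeCmd
  | 2 => .op (.copy 17 5) ;; .op (.get 27 0 6) ;; writeCmd
  | 3 => .op (.copy 17 5) ;; .op (.get 27 0 6) ;; .op (.get 27 0 27) ;; writeCmd
  | 4 => .op (.get 17 0 5) ;; .op (.get 27 0 6) ;; writeCmd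
  | 5 => .op (.copy 17 5) ;; .op (.get 27 0 6) ;; .op (.get 27 1 27) ;; writeCmd
  | 6 => .op (.copy 17 5) ;; .op (.get 25 0 6) ;; .op (.get 26 0 7) ;; addCmd ;; writeCmd
  | 7 => .op (.copy 17 5) ;; .op (.get 25 0 6) ;; .op (.get 26 0 7) ;; subCmd ;; writeCmd
  | 8 => .op (.copy 17 5) ;; .op (.get 25 0 6) ;; .op (.get 26 0 7) ;; mulCmd ;; writeCmd
  | 9 => goToCmd 5
  | 10 => .op (.get 25 0 5) ;; .op (.get 26 0 6) ;; subCmd ;;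
      .ifeq 29 1 (goToCmd 7) (.op (.copy 3 8))
  | 11 => .op (.copy 3 8) ;; .op (.get 25 0 5) ;; .op (.get 26 0 6) ;;
      .ifeq 25 26 (.op (.get 25 0 25) ;; .ifeq 25 1 (.op (.const 2 false)) .skip) .skip
  | _ => .skip

/-- The memory `s` represents a machine which is going to execute an instruction with operands
`a, b, c`. -/
structure Fetched (F : ℕ → ℕ) (x : Word) (p : ℕ) (R : ℕ → ℕ) (a b c : ℕ) (s : Store) : Prop
    extends Rep F x p R 1 s where
  v5 : s.var 5 = a
  v6 : s.var 6 = b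
  v7 : s.var 7 = c
  v8 : s.var 8 = 4 * (p + 1)

section

variable {F : ℕ → ℕ} {x : Word} {pc go a b c : ℕ} {reg : ℕ → ℕ} {s s' : Store}

theorem Fetched.agree (h : Fetched F x pc reg a b c s) {n : ℕ} (ha : Agree n s s') (hn : 9 ≤ n) :
    Fetched F x pc reg a b c s' where
  toRep := h.toRep.agree ha (by omega)
  v5 := by rw [ha.var 5 (by simp; omega), h.v5]
  v6 := by rw [ha.var 6 (by simp; omega), h.v6]
  v7 := by rw [ha.var 7 (by simp; omega), h.v7]
  v8 := by rw [ha.var 8 (by simp; omega), h.v8]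

theorem Fetched.write (h : Fetched F x pc reg a b c s) :
    ∃ s', Exec x writeCmd s 2 s' ∧
      Rep F x (pc + 1) (update reg (s.var 17) (s.var 27)) 1 s' := by
  refine ⟨_, exec_run rfl s, ?_⟩
  obtain ⟨⟨h0, h1, h2, h3, hr, hi, hp⟩, h5, h6, h7, h8⟩ := h
  constructor <;>
    simp [writeCmd, Cmd.run, Op.eval, Store.var_set, h0, h1, h2, h8]
  · rw [← hr]; rfl
  · exact hi
  · exact hp

theorem Fetched.run_write (h : Fetched F x pc reg a b c s) {e : Cmd} (he : e.loopFree = true)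
    (hw : e.writesFrom 9 = true) :
    ∃ s', Exec x (e ;; writeCmd) s (e.size + 2) s' ∧
      Rep F x (pc + 1) (update reg ((e.run x s).var 17) ((e.run x s).var 27)) 1 s' := by
  obtain ⟨s', h', hR⟩ := (h.agree (agree_run hw s) le_rfl).write
  exact ⟨s', (exec_run he s).seq h', hR⟩

/-- Both ways of bracketing compile to the same code. -/
theorem Exec.assoc {c d e : Cmd} {n : ℕ} (h : Exec x ((c ;; d) ;; e) s n s') :
    Exec x (c ;; d ;; e) s n s' := by
  intro P a hP
  have := h P a (by simpa [Cmd.compile, Cmd.size, Nat.add_assoc] using hP)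
  simpa [Cmd.size, Nat.add_assoc] using this

theorem Fetched.const (h : Fetched F x pc reg a b c s) :
    ∃ s', Exec x (instrCmd 1) s 4 s' ∧ Rep F x (pc + 1) (update reg a b) 1 s' := by
  obtain ⟨s', e, hR⟩ := h.run_write (e := .op (.copy 17 5) ;; .op (.copy 27 6)) rfl rfl
  refine ⟨s', e.assoc, ?_⟩
  simpa [Cmd.run, Op.eval, Store.var_set, h.v5, h.v6] using hR

theorem Fetched.copy (h : Fetched F x pc reg a b c s) :
    ∃ s', Exec x (instrCmd 2) s 4 s' ∧ Rep F x (pc + 1) (update reg a (reg b)) 1 s' := by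
  obtain ⟨s', e, hR⟩ := h.run_write (e := .op (.copy 17 5) ;; .op (.get 27 0 6)) rfl rfl
  refine ⟨s', e.assoc, ?_⟩
  simpa [Cmd.run, Op.eval, Store.var_set, Store.set, h.v5, h.v6, h.reg] using hR

theorem Fetched.load (h : Fetched F x pc reg a b c s) :
    ∃ s', Exec x (instrCmd 3) s 5 s' ∧ Rep F x (pc + 1) (update reg a (reg (reg b))) 1 s' := by
  obtain ⟨s', e, hR⟩ := h.run_write
    (e := (.op (.copy 17 5) ;; .op (.get 27 0 6)) ;; .op (.get 27 0 27)) rfl rfl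
  refine ⟨s', e.assoc.assoc, ?_⟩
  simpa [Cmd.run, Op.eval, Store.var_set, Store.set, h.v5, h.v6, h.reg] using hR

theorem Fetched.store (h : Fetched F x pc reg a b c s) :
    ∃ s', Exec x (instrCmd 4) s 4 s' ∧ Rep F x (pc + 1) (update reg (reg a) (reg b)) 1 s' := by
  obtain ⟨s', e, hR⟩ := h.run_write (e := .op (.get 17 0 5) ;; .op (.get 27 0 6)) rfl rfl
  refine ⟨s', e.assoc, ?_⟩
  simpa [Cmd.run, Op.eval, Store.var_set, Store.set, h.v5, h.v6, h.reg] using hR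

theorem Fetched.read (h : Fetched F x pc reg a b c s) :
    ∃ s', Exec x (instrCmd 5) s 5 s' ∧
      Rep F x (pc + 1) (update reg a (inputReg x (reg b))) 1 s' := by
  obtain ⟨s', e, hR⟩ := h.run_write
    (e := (.op (.copy 17 5) ;; .op (.get 27 0 6)) ;; .op (.get 27 1 27)) rfl rfl
  refine ⟨s', e.assoc.assoc, ?_⟩
  simpa [Cmd.run, Op.eval, Store.var_set, Store.set, h.v5, h.v6, h.reg, h.inp] using hR

/-- Arithmetic instructions. -/
theorem Fetched.arith (h : Fetched F x pc reg a b c s) {d : Cmd} {n y : ℕ}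
    (hd : ∀ s₁ : Store, s₁.var 0 = 0 → s₁.var 1 = 1 → s₁.var 25 = reg b → s₁.var 26 = reg c →
      ∃ s₂, Exec x d s₁ n s₂ ∧ s₂.var 27 = y ∧ Agree 21 s₁ s₂) :
    ∃ s', Exec x (.op (.copy 17 5) ;; .op (.get 25 0 6) ;; .op (.get 26 0 7) ;; d ;; writeCmd) s
      (n + 5) s' ∧ Rep F x (pc + 1) (update reg a y) 1 s' := by
  set e : Cmd := .op (.copy 17 5) ;; .op (.get 25 0 6) ;; .op (.get 26 0 7) with he
  have h₁ := h.agree (agree_run (x := x) (c := e) (n := 9) rfl s) le_rfl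
  have e₁ : Exec x e s 3 (e.run x s) := exec_run rfl s
  obtain ⟨s₂, e₂, hy, ha⟩ := hd (e.run x s) h₁.zero h₁.one
    (by simp [he, Cmd.run, Op.eval, Store.set, h.v6, h.reg])
    (by simp [he, Cmd.run, Op.eval, Store.set, h.v7, h.reg])
  obtain ⟨s', e', hR⟩ := (h₁.agree ha (by simp)).write
  refine ⟨s', ?_, ?_⟩
  · intro P p hP
    have := ((e₁.seq (e₂.seq e')).mono (n' := n + 5) (by omega)) P p (by simpa [he, Cmd.compile, Cmd.size, Nat.add_assoc] using hP)
    simpa only [he, Cmd.size, Nat.add_assoc] using this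
  · rw [hy, ha.var 17 (by simp)] at hR
    simpa [he, Cmd.run, Op.eval, Store.var_set, Store.set, h.v5] using hR

theorem Fetched.add (h : Fetched F x pc reg a b c s) {L : ℕ} (hb : (reg b).size ≤ L)
    (hc : (reg c).size ≤ L) : ∃ s', Exec x (instrCmd 6) s ((L + 1) * 40 + 5) s' ∧
      Rep F x (pc + 1) (update reg a (reg b + reg c)) 1 s' :=
  h.arith fun s₁ h0 h1 hx hy => by
    obtain ⟨s₂, e, hz, ha⟩ := exec_addCmd x s₁ h0 h1 (L := L) (by rwa [hx]) (by rwa [hy])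
    exact ⟨s₂, e, by rw [hz, hx, hy], ha.mono (by simp)⟩

theorem Fetched.sub (h : Fetched F x pc reg a b c s) {L : ℕ} (hb : (reg b).size ≤ L)
    (hc : (reg c).size ≤ L) : ∃ s', Exec x (instrCmd 7) s ((L + 1) * 40 + 5) s' ∧
      Rep F x (pc + 1) (update reg a (reg b - reg c)) 1 s' :=
  h.arith fun s₁ h0 h1 hx hy => by
    obtain ⟨s₂, e, hz, -, ha⟩ := exec_subCmd x s₁ h0 h1 (L := L) (by rwa [hx]) (by rwa [hy])
    exact ⟨s₂, e, by rw [hz, hx, hy], ha.mono (by simp)⟩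

theorem Fetched.mul (h : Fetched F x pc reg a b c s) {L : ℕ} (hb : (reg b).size ≤ L)
    (hc : (reg c).size ≤ L) : ∃ s', Exec x (instrCmd 8) s ((L + 1) * (L + 1) * 100 + 5) s' ∧
      Rep F x (pc + 1) (update reg a (reg b * reg c)) 1 s' :=
  h.arith fun s₁ h0 h1 hx hy => by
    obtain ⟨s₂, e, hz, ha⟩ := exec_mulCmd x s₁ h0 h1 (L := L) (by rwa [hx]) (by rwa [hy])
    exact ⟨s₂, e, by rw [hz, hx, hy], ha⟩

theorem Fetched.goTo (h : Fetched F x pc reg a b c s) (v : Fin 32) :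
    ∃ s', Exec x (goToCmd v) s 2 s' ∧ Rep F x (s.var v) reg 1 s' := by
  refine ⟨_, exec_run rfl s, ?_⟩
  obtain ⟨⟨h0, h1, h2, h3, hr, hi, hp⟩, h5, h6, h7, h8⟩ := h
  constructor <;> simp [goToCmd, Cmd.run, Op.eval, Store.var_set, h0, h1, h2]
  · omega
  · exact hr
  · exact hi
  · exact hp

theorem Fetched.skip (h : Fetched F x pc reg a b c s) :
    ∃ s', Exec x (.op (.copy 3 8)) s 1 s' ∧ Rep F x (pc + 1) reg 1 s' := by
  refine ⟨_, Exec.op (.copy 3 8) s, ?_⟩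
  obtain ⟨⟨h0, h1, h2, h3, hr, hi, hp⟩, h5, h6, h7, h8⟩ := h
  constructor <;> simp [Op.eval, Store.var_set, h0, h1, h2, h8]
  · exact hr
  · exact hi
  · exact hp

theorem Fetched.jump (h : Fetched F x pc reg a b c s) :
    ∃ s', Exec x (instrCmd 9) s 2 s' ∧ Rep F x a reg 1 s' := by
  have := h.goTo 5
  rwa [h.v5] at this

theorem Fetched.jumpLT (h : Fetched F x pc reg a b c s) {L : ℕ} (hb : (reg a).size ≤ L)
    (hc : (reg b).size ≤ L) : ∃ s', Exec x (instrCmd 10) s ((L + 1) * 40 + 6) s' ∧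
      Rep F x (if reg a < reg b then c else pc + 1) reg 1 s' := by
  set e : Cmd := .op (.get 25 0 5) ;; .op (.get 26 0 6) with he
  have h₁ := h.agree (agree_run (x := x) (c := e) (n := 9) rfl s) le_rfl
  have e₁ : Exec x e s 2 (e.run x s) := exec_run rfl s
  have hx : (e.run x s).var 25 = reg a := by
    simp [he, Cmd.run, Op.eval, Store.set, h.v5, h.reg]
  have hy : (e.run x s).var 26 = reg b := by
    simp [he, Cmd.run, Op.eval, Store.set, h.v6, h.reg]
  obtain ⟨s₂, e₂, -, hlt, ha⟩ := exec_subCmd x (e.run x s) h₁.zero h₁.one (L := L)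
    (by rwa [hx]) (by rwa [hy])
  have h₂ := h₁.agree ha (by simp)
  rw [hx, hy] at hlt
  have key : ∃ s', Exec x (.ifeq 29 1 (goToCmd 7) (.op (.copy 3 8))) s₂ 4 s' ∧
      Rep F x (if reg a < reg b then c else pc + 1) reg 1 s' := by
    split
    · obtain ⟨s', e', hR⟩ := h₂.goTo 7
      rw [h₂.v7] at hR
      exact ⟨s', (e'.ifeq_pos (by rw [hlt, h₂.one, if_pos ‹_›])).mono (by simp), hR⟩
    · obtain ⟨s', e', hR⟩ := h₂.skip
      exact ⟨s', (e'.ifeq_neg (by rw [hlt, h₂.one, if_neg ‹_›]; simp)).mono (by simp), hR⟩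
  obtain ⟨s', e', hR⟩ := key
  exact ⟨s', (e₁.seq (e₂.seq e')).assoc.mono (by omega), hR⟩

theorem Fetched.output (h : Fetched F x pc reg a b c s) :
    ∃ s', Exec x (instrCmd 11) s 9 s' ∧
      Rep F x (pc + 1) reg (if outputWord reg (reg a) (reg b) = [true] then 0 else 1) s' := by
  refine ⟨_, exec_run rfl s, ?_⟩
  obtain ⟨⟨h0, h1, h2, h3, hr, hi, hp⟩, h5, h6, h7, h8⟩ := h
  simp only [outputWord_eq_true]
  rw [instrCmd]
  simp only [Cmd.run, Op.eval, Store.set, update_apply, h5, h6, hr]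
  by_cases hab : reg a = reg b
  · by_cases hr1 : reg (reg a) = 1
    · constructor <;> simp [h0, h1, h8, hab, hab ▸ hr1, hr, hi, hp]
    · constructor <;> simp [h0, h1, h2, h8, hab, hab ▸ hr1, hr, hi, hp]
  · constructor <;> simp [h0, h1, h2, h8, hab, hr, hi, hp]

end

end BitMachine

namespace EnumRAM

def State.words (st : State) : List Word := st.out.map Prod.snd

/-- The next state, or the same if the machine stops. -/
def RAM.next (M : RAM) (x : Word) (st : State) : State := (M.step x st).getD st

end EnumRAM

/-! ### Simulation of one RAM step -/

namespace BitMachine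

/-- Simulate one step of a random access machine. -/
def bodyCmd : Cmd := fetchCmd ;; switchCmd 4 instrCmd

/-- The code of a program as an array. -/
def code (M : RAM) (i : ℕ) : ℕ := M.fields.getD i 0

/-- The memory `s` represents the state `st` of `M`; the simulation is to go on until the word `1`
has been output. -/
def Represents (M : RAM) (x : Word) (st : State) (s : Store) : Prop :=
  Rep (code M) x st.pc st.reg (if [true] ∈ st.words then 0 else 1) s

/-- Instructions of time `1` take boundedly many steps, however large the numbers are; arithmetic
takes at most quadratically many steps in the operand lengths, hence in the time of the instruction.
Only fetching depends on the instruction number, through `L`. -/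
theorem exec_bodyCmd {M : RAM} {x : Word} {st : State} {s : Store} (h : Represents M x st s)
    (hout : [true] ∉ st.words) {L : ℕ} (hL : (4 * st.pc + 4).size ≤ L) :
    ∃ s', Exec x bodyCmd s (160 * L + 250 + ((M.next x st).clock - st.clock + 1) ^ 2 * 100) s' ∧
      Represents M x (M.next x st) s' := by
  rw [Represents, if_neg hout] at h
  obtain ⟨s₁, e₁, h₁, h4, h5, h6, h7, h8, h15⟩ := exec_fetchCmd h hL
  obtain ⟨i, hi⟩ : ∃ i, M.program[st.pc]?.getD .halt = i := ⟨_, rfl⟩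
  have hF : ∀ j < 4, code M (4 * st.pc + j) = i.fields.getD j 0 := fun j hj => by
    rw [code, RAM.fields, getD_fields _ _ hj, hi]
  have f0 := hF 0 (by simp)
  rw [hF 1 (by simp)] at h5
  rw [hF 2 (by simp)] at h6
  rw [hF 3 (by simp)] at h7
  rw [Nat.add_zero] at f0
  rw [f0] at h15
  obtain ⟨s₂, ha, e₂⟩ := exec_switchCmd x 4 instrCmd s₁ h₁.zero
    (by rw [h15]; cases i <;> simp [Instr.fields])
  rw [h15] at e₂
  have g : Fetched (code M) x st.pc st.reg (i.fields.getD 1 0) (i.fields.getD 2 0)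
      (i.fields.getD 3 0) s₂ := Fetched.agree ⟨h₁, h5, h6, h7, h8⟩ ha (by simp)
  suffices H : ∃ s', Exec x (instrCmd (i.fields.getD 0 0)) s₂
      (((M.next x st).clock - st.clock + 1) ^ 2 * 100 + 9) s' ∧ Represents M x (M.next x st) s' by
    obtain ⟨s', e', hR⟩ := H
    exact ⟨s', (e₁.seq (e₂ _ _ e')).mono (by omega), hR⟩
  have fin : ∀ {st' : State} {n d : ℕ} {c : Cmd}, M.next x st = st' → n ≤ 9 →
      (∃ s', Exec x c s₂ n s' ∧ Represents M x st' s') → ∃ s', Exec x c s₂ (d + 9) s' ∧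
        Represents M x (M.next x st) s' := by
    rintro st' n d c rfl hn ⟨s', e', hR⟩
    exact ⟨s', e'.mono (by omega), hR⟩
  have same : ∀ {st' : State} {s' : Store}, st'.out = st.out →
      Rep (code M) x st'.pc st'.reg 1 s' → Represents M x st' s' := by
    intro st' s' ho hR
    rw [Represents, State.words, ho, ← State.words, if_neg hout]
    exact hR
  have lin : ∀ n, (n + 1) * 40 + 6 ≤ (n + 1) ^ 2 * 100 + 9 := fun n => by nlinarith
  cases hp : M.program[st.pc]? with
  | none =>
    rw [hp] at hi
    subst hi
    -- The operation code is then `0`, which does nothing: the simulator of a stopped machine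
    -- repeats this round forever.
    have hn : M.next x st = st := by simp [RAM.next, RAM.step, hp]
    exact fin hn (Nat.zero_le _) ⟨s₂, .skip, by rw [Represents, if_neg hout]; exact g.toRep⟩
  | some i' =>
    rw [hp] at hi
    obtain rfl : i' = i := hi
    cases i' with
    | halt =>
      have hn : M.next x st = st := by simp [RAM.next, RAM.step, hp]
      exact fin hn (Nat.zero_le _) ⟨s₂, .skip, by rw [Represents, if_neg hout]; exact g.toRep⟩
    | const d c =>
      have hn : M.next x st = st.write d c 1 := by simp [RAM.next, RAM.step, hp]
      refine fin hn (n := 4) (by simp) ?_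
      obtain ⟨s', e', hR⟩ := g.const
      exact ⟨s', e', same rfl hR⟩
    | copy d a =>
      have hn : M.next x st = st.write d (st.reg a) 1 := by simp [RAM.next, RAM.step, hp]
      refine fin hn (n := 4) (by simp) ?_
      obtain ⟨s', e', hR⟩ := g.copy
      exact ⟨s', e', same rfl hR⟩
    | load d a =>
      have hn : M.next x st = st.write d (st.reg (st.reg a)) 1 := by
        simp [RAM.next, RAM.step, hp]
      refine fin hn (n := 5) (by simp) ?_
      obtain ⟨s', e', hR⟩ := g.load
      exact ⟨s', e', same rfl hR⟩
    | store d a =>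
      have hn : M.next x st = st.write (st.reg d) (st.reg a) 1 := by
        simp [RAM.next, RAM.step, hp]
      refine fin hn (n := 4) (by simp) ?_
      obtain ⟨s', e', hR⟩ := g.store
      exact ⟨s', e', same rfl hR⟩
    | read d a =>
      have hn : M.next x st = st.write d (inputReg x (st.reg a)) 1 := by
        simp [RAM.next, RAM.step, hp]
      refine fin hn (n := 5) (by simp) ?_
      obtain ⟨s', e', hR⟩ := g.read
      exact ⟨s', e', same rfl hR⟩
    | add d a b =>
      obtain ⟨ha, hb⟩ := size_le_arithCost (st.reg a) (st.reg b)
      have hn : M.next x st = st.write d (st.reg a + st.reg b)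
        (arithCost (st.reg a) (st.reg b)) := by simp [RAM.next, RAM.step, hp]
      obtain ⟨s', e', hR⟩ := g.add ha hb
      have := lin (arithCost (st.reg a) (st.reg b))
      rw [hn]
      exact ⟨s', e'.mono (by simp only [State.write, Nat.add_sub_cancel_left]; omega), same rfl hR⟩
    | sub d a b =>
      obtain ⟨ha, hb⟩ := size_le_arithCost (st.reg a) (st.reg b)
      have hn : M.next x st = st.write d (st.reg a - st.reg b)
        (arithCost (st.reg a) (st.reg b)) := by simp [RAM.next, RAM.step, hp]
      obtain ⟨s', e', hR⟩ := g.sub ha hb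
      have := lin (arithCost (st.reg a) (st.reg b))
      rw [hn]
      exact ⟨s', e'.mono (by simp only [State.write, Nat.add_sub_cancel_left]; omega), same rfl hR⟩
    | mul d a b =>
      obtain ⟨ha, hb⟩ := size_le_arithCost (st.reg a) (st.reg b)
      have hn : M.next x st = st.write d (st.reg a * st.reg b)
        (arithCost (st.reg a) (st.reg b)) := by simp [RAM.next, RAM.step, hp]
      obtain ⟨s', e', hR⟩ := g.mul ha hb
      rw [hn]
      exact ⟨s', e'.mono (by
        simp only [State.write, Nat.add_sub_cancel_left, pow_two]; omega), same rfl hR⟩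
    | jump l =>
      have hn : M.next x st = { st with pc := l, clock := st.clock + 1 } := by
        simp [RAM.next, RAM.step, hp]
      refine fin hn (n := 2) (by simp) ?_
      obtain ⟨s', e', hR⟩ := g.jump
      exact ⟨s', e', same rfl hR⟩
    | jumpLT a b l =>
      obtain ⟨ha, hb⟩ := size_le_arithCost (st.reg a) (st.reg b)
      have hn : M.next x st = { st with
          pc := if st.reg a < st.reg b then l else st.pc + 1
          clock := st.clock + arithCost (st.reg a) (st.reg b) } := by
        simp [RAM.next, RAM.step, hp]
      obtain ⟨s', e', hR⟩ := g.jumpLT ha hb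
      have := lin (arithCost (st.reg a) (st.reg b))
      rw [hn]
      exact ⟨s', e'.mono (by simp only [Nat.add_sub_cancel_left]; omega), same rfl hR⟩
    | output a b =>
      have hn : M.next x st = { st with
          pc := st.pc + 1
          clock := st.clock + 1
          out := st.out ++ [(st.clock + 1, outputWord st.reg (st.reg a) (st.reg b))] } := by
        simp [RAM.next, RAM.step, hp]
      refine fin hn (n := 9) (by simp) ?_
      obtain ⟨s', e', hR⟩ := g.output
      refine ⟨s', e', ?_⟩
      rw [Represents]
      convert hR using 2
      have : [true] ∉ st.out.map Prod.snd := hout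
      simp only [State.words, List.map_append, List.mem_append, this, false_or]
      simp [eq_comm, Instr.fields]

end BitMachine

namespace BitMachine

/-! ### Reading the program and the input -/

/-- The state of the parser: the number of fields read, the part read of the current field, and
the fields as an array. -/
abbrev ParseState := ℕ × ℕ × (ℕ → ℕ)

/-- The input is read in pairs of letters; a pair `1 b` adds the bit `b` to the current field, a
pair `0 b` finishes the current field. -/
def parseStep (t : ParseState) (p : Bool × Bool) : ParseState :=
  if p.1 then (t.1, 2 * t.2.1 + p.2.toNat, t.2.2) else (t.1 + 1, 0, update t.2.2 t.1 t.2.1)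

def parse (l : List (Bool × Bool)) : ParseState := l.foldl parseStep (0, 0, fun _ => 0)

theorem parse_snoc (l : List (Bool × Bool)) (p : Bool × Bool) :
    parse (l ++ [p]) = parseStep (parse l) p := by simp [parse]

theorem parse_fst_le (l : List (Bool × Bool)) : (parse l).1 ≤ l.length := by
  induction l using List.reverseRecOn with
  | nil => simp [parse]
  | append_singleton l p ih =>
    rw [parse_snoc, parseStep, List.length_append, List.length_singleton]
    split <;> simp only <;> omega

/-- The binary digits of `k` are fed in from the most significant one, by recursion on `k / 2`. -/
theorem exists_foldl_parseStep (k j : ℕ) (F : ℕ → ℕ) :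
    ∃ l : List (Bool × Bool), l.foldl parseStep (j, 0, F) = (j, k, F) := by
  induction k using Nat.strong_induction_on with
  | _ k ih =>
    rcases Nat.eq_zero_or_pos k with rfl | hk
    · exact ⟨[], rfl⟩
    · obtain ⟨l, hl⟩ := ih (k / 2) (by omega)
      refine ⟨l ++ [(true, decide (k % 2 = 1))], ?_⟩
      rw [List.foldl_append, hl]
      rcases Nat.mod_two_eq_zero_or_one k with h | h <;> simp [parseStep, h] <;> omega

theorem exists_parse (L : List ℕ) : ∃ l, parse l = (L.length, 0, fun i => L.getD i 0) := by
  induction L using List.reverseRecOn with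
  | nil => exact ⟨[], by simp [parse]⟩
  | append_singleton L k ih =>
    obtain ⟨l, hl⟩ := ih
    obtain ⟨l', hl'⟩ := exists_foldl_parseStep k L.length (fun i => L.getD i 0)
    refine ⟨l ++ l' ++ [(false, false)], ?_⟩
    rw [parse_snoc, parse, List.foldl_append, ← parse, hl, hl', parseStep, if_neg (by simp)]
    refine Prod.ext (by simp) (Prod.ext rfl (funext fun i => ?_))
    change update (fun i => L.getD i 0) L.length k i = (L ++ [k]).getD i 0
    rw [update_apply]
    split
    · rename_i h; subst h; simp
    · rename_i h
      rcases Nat.lt_or_gt_of_ne h with h | h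
      · rw [List.getD_append _ _ _ _ h]
      · rw [List.getD_eq_default _ _ (by omega), List.getD_eq_default _ _ (by simp; omega)]

/-- Pairs `1 1` only extend an unfinished field, so they can serve as padding of any length. -/
theorem parse_append_replicate (l : List (Bool × Bool)) (r : ℕ) :
    (parse (l ++ List.replicate r (true, true))).2.2 = (parse l).2.2 := by
  induction r with
  | zero => simp
  | succ r ih =>
    rw [List.replicate_succ', ← List.append_assoc, parse_snoc, parseStep, if_pos rfl]
    exact ih

/-- Store a letter of the input. -/
def letterCmd : Cmd := succCmd 9 ;; .op (.put 1 9 13)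

/-- Process a pair of letters. -/
def pairCmd : Cmd :=
  .ifeq 14 0 (.op (.put 2 10 11) ;; succCmd 10 ;; .op (.copy 11 0))
    (.ifeq 13 0 (.op (.shl false 11 11)) (.op (.shl true 11 11)))

def parseBody : Cmd :=
  letterCmd ;; .op (.copy 14 13) ;; .op (.next 12 13) ;; letterCmd ;; pairCmd ;; .op (.next 12 13)

def setupCmd : Cmd :=
  .op (.const 1 true) ;; .op (.const 2 true) ;; .op (.next 12 13) ;; .whilene 12 0 parseBody ;;
  .op (.put 1 0 9)

/-- The memory when `i` letters have been stored and `q` letters have been read. -/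
structure Parsing (x : Word) (i : ℕ) (t : ParseState) (q : ℕ) (s : Store) : Prop where
  zero : s.var 0 = 0
  one : s.var 1 = 1
  go : s.var 2 = 1
  pc : s.var 3 = 0
  v9 : s.var 9 = i
  v10 : s.var 10 = t.1
  v11 : s.var 11 = t.2.1
  reg : s.arr 0 = fun _ => 0
  inp : s.arr 1 = fun k => if k = 0 ∨ i < k then 0 else inputReg x k
  prog : s.arr 2 = t.2.2
  pos : s.pos = q

section

variable {x : Word} {i q : ℕ} {t : ParseState} {s : Store}

theorem Parsing.letter (h : Parsing x i t q s) (hl : s.var 13 = inputReg x (i + 1)) {L : ℕ}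
    (hi : i < L) : ∃ s', Exec x letterCmd s ((L + 1) * 40 + 4) s' ∧ Parsing x (i + 1) t q s' ∧
      s'.var 13 = s.var 13 ∧ s'.var 14 = s.var 14 := by
  obtain ⟨s₁, e₁, a₁⟩ := exec_succCmd x 9 s h.zero h.one (L := L)
    (by rw [h.v9, Nat.size_le]; exact hi.trans Nat.lt_two_pow_self) (by omega)
  have hv : ∀ v : Fin 32, (v : ℕ) < 24 → v ≠ 9 → s₁.var v = s.var v := fun v hv h9 => by
    rw [a₁.var v hv, Store.var_set, if_neg h9]
  have h9 : s₁.var 9 = i + 1 := by rw [a₁.var 9 (by simp), Store.var_set, if_pos rfl, h.v9]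
  have ha : s₁.arr = s.arr := a₁.arr
  refine ⟨_, e₁.seq (Exec.op (.put 1 9 13) s₁), ?_, hv 13 (by simp) (by simp),
    hv 14 (by simp) (by simp)⟩
  exact
    { zero := (hv 0 (by simp) (by simp)).trans h.zero
      one := (hv 1 (by simp) (by simp)).trans h.one
      go := (hv 2 (by simp) (by simp)).trans h.go
      pc := (hv 3 (by simp) (by simp)).trans h.pc
      v9 := h9
      v10 := (hv 10 (by simp) (by simp)).trans h.v10
      v11 := (hv 11 (by simp) (by simp)).trans h.v11
      reg := (congrFun ha 0).trans h.reg
      inp := by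
        simp only [Op.eval, update_self, h9, hv 13 (by simp) (by simp), hl, ha, h.inp]
        funext k
        rw [update_apply]
        by_cases hk : k = i + 1
        · simp [hk]
        · rw [if_neg hk]
          congr 1
          exact propext (by omega)
      prog := (congrFun ha 2).trans h.prog
      pos := a₁.pos.trans h.pos }

theorem Parsing.next (h : Parsing x i t i s) (hi : i < x.length) :
    Parsing x i t (i + 1) (Op.eval x (.next 12 13) s) ∧
      (Op.eval x (.next 12 13) s).var 12 = 1 ∧
      (Op.eval x (.next 12 13) s).var 13 = inputReg x (i + 1) ∧
      (Op.eval x (.next 12 13) s).var 14 = s.var 14 := by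
  have e : Op.eval x (.next 12 13) s =
      { (s.set 13 (inputReg x (i + 1))).set 12 1 with pos := i + 1 } := by
    simp only [Op.eval, h.pos, if_pos hi, inputReg]
  rw [e]
  refine ⟨⟨h.zero, h.one, h.go, h.pc, h.v9, h.v10, h.v11, h.reg, h.inp, h.prog, rfl⟩, rfl, rfl, rfl⟩

theorem Parsing.pair (h : Parsing x i t q s) {p : Bool × Bool} (h13 : s.var 13 = p.2.toNat)
    (h14 : s.var 14 = p.1.toNat) {L : ℕ} (hL : t.1 < L) :
    ∃ s', Exec x pairCmd s ((L + 1) * 40 + 8) s' ∧ Parsing x i (parseStep t p) q s' := by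
  obtain ⟨g, b⟩ := p
  obtain ⟨h0, h1, h2, h3, h9, h10, h11, hr, hi, hp, hq⟩ := h
  simp only at h13 h14
  cases g with
  | false =>
    set s₁ : Store := Op.eval x (.put 2 10 11) s with hs₁
    obtain ⟨s₂, e₂, a₂⟩ := exec_succCmd x 10 s₁ h0 h1 (L := L)
      (by rw [show s₁.var 10 = t.1 from h10, Nat.size_le]; exact hL.trans Nat.lt_two_pow_self)
      (by omega)
    have hv : ∀ v : Fin 32, (v : ℕ) < 24 → v ≠ 10 → s₂.var v = s.var v := fun v hv hne => by
      rw [a₂.var v hv, Store.var_set, if_neg hne]; rfl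
    refine ⟨_, (Exec.ifeq_pos (by rw [h14, h0]; rfl)
      ((Exec.op (.put 2 10 11) s).seq (e₂.seq (Exec.op (.copy 11 0) s₂)))).mono (by omega), ?_⟩
    have hv' : ∀ v : Fin 32, (v : ℕ) < 24 → v ≠ 10 → v ≠ 11 →
        (Op.eval x (.copy 11 0) s₂).var v = s.var v := fun v hlt hne hne' => by
      rw [Op.eval, Store.var_set, if_neg hne', hv v hlt hne]
    exact
      { zero := (hv' 0 (by simp) (by simp) (by simp)).trans h0
        one := (hv' 1 (by simp) (by simp) (by simp)).trans h1
        go := (hv' 2 (by simp) (by simp) (by simp)).trans h2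
        pc := (hv' 3 (by simp) (by simp) (by simp)).trans h3
        v9 := (hv' 9 (by simp) (by simp) (by simp)).trans h9
        v10 := by
          rw [Op.eval, Store.var_set, if_neg (by simp), a₂.var 10 (by simp), Store.var_set,
            if_pos rfl, show s₁.var 10 = t.1 from h10]
          rfl
        v11 := by
          rw [Op.eval, Store.var_set, if_pos rfl, hv 0 (by simp) (by simp), h0]
          rfl
        reg := (congrFun a₂.arr 0).trans hr
        inp := (congrFun a₂.arr 1).trans hi
        prog := by
          refine (congrFun a₂.arr 2).trans ?_
          change _ = update t.2.2 t.1 t.2.1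
          rw [← h10, ← h11, ← hp]
          rfl
        pos := a₂.pos.trans hq }
  | true =>
    set s' := s.set 11 (2 * t.2.1 + b.toNat) with hs'
    refine ⟨s', (Exec.ifeq_neg (n := 3) (by rw [h14, h0]; simp) ?_).mono (by omega), ?_⟩
    · cases b
      · refine (Exec.ifeq_pos (n := 1) (by rw [h13, h0]; rfl) ?_).mono (by simp)
        rw [hs', ← h11]
        exact Exec.op (.shl false 11 11) s
      · refine (Exec.ifeq_neg (n := 1) (by rw [h13, h0]; simp) ?_)
        rw [hs', ← h11]
        exact Exec.op (.shl true 11 11) s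
    · exact ⟨h0, h1, h2, h3, h9, h10, rfl, hr, hi, hp, hq⟩

end

/-- The word consisting of some pairs of letters. -/
def flatten (l : List (Bool × Bool)) : Word := l.flatMap fun p => [p.1, p.2]

theorem length_flatten (l : List (Bool × Bool)) : (flatten l).length = 2 * l.length := by
  induction l with
  | nil => rfl
  | cons p l ih =>
    simp only [flatten, List.flatMap_cons, List.length_append, List.length_cons] at ih ⊢
    simp only [List.length_nil]
    omega

theorem inputReg_flatten (l r : List (Bool × Bool)) (p : Bool × Bool) :
    inputReg (flatten (l ++ p :: r)) (2 * l.length + 1) = p.1.toNat ∧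
      inputReg (flatten (l ++ p :: r)) (2 * l.length + 1 + 1) = p.2.toNat := by
  have e : flatten (l ++ p :: r) = flatten l ++ (p.1 :: p.2 :: flatten r) := by simp [flatten]
  have hl := length_flatten l
  constructor
  · rw [inputReg, e, List.getD_append_right _ _ _ _ (by omega), hl, Nat.sub_self]; rfl
  · rw [inputReg, e, List.getD_append_right _ _ _ _ (by omega), hl, Nat.add_sub_cancel_left]; rfl

/-- The body of the loop ends by reading the letter which the next round starts with, so both
memories are described as they are just before this pending read. -/
theorem Parsing.step {l r : List (Bool × Bool)} {p : Bool × Bool} {s : Store}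
    (h : Parsing (flatten (l ++ p :: r)) (2 * l.length) (parse l) (2 * l.length) s) {L : ℕ}
    (hL : 2 * l.length + 1 < L) :
    ∃ s', Exec (flatten (l ++ p :: r)) parseBody (Op.eval (flatten (l ++ p :: r)) (.next 12 13) s)
        (((L + 1) * 40 + 8) * 3 + 3) (Op.eval (flatten (l ++ p :: r)) (.next 12 13) s') ∧
      Parsing (flatten (l ++ p :: r)) (2 * (l ++ [p]).length) (parse (l ++ [p]))
        (2 * (l ++ [p]).length) s' := by
  obtain ⟨i1, i2⟩ := inputReg_flatten l r p
  have hlen := length_flatten (l ++ p :: r)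
  set x := flatten (l ++ p :: r)
  rw [List.length_append, List.length_cons] at hlen
  obtain ⟨h₁, -, b₁, -⟩ := h.next (by omega)
  obtain ⟨s₂, e₂, h₂, b₂, -⟩ := h₁.letter b₁ (L := L) (by omega)
  rw [b₁, i1] at b₂
  have h₃ : Parsing x (2 * l.length + 1) (parse l) (2 * l.length + 1) (s₂.set 14 (s₂.var 13)) :=
    ⟨h₂.zero, h₂.one, h₂.go, h₂.pc, h₂.v9, h₂.v10, h₂.v11, h₂.reg, h₂.inp, h₂.prog, h₂.pos⟩
  obtain ⟨h₄, -, b₄, c₄⟩ := h₃.next (by omega)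
  obtain ⟨s₅, e₅, h₅, b₅, c₅⟩ := h₄.letter b₄ (L := L) (by omega)
  rw [b₄, i2] at b₅
  rw [c₄, Store.var_set, if_pos rfl, b₂] at c₅
  have := parse_fst_le l
  obtain ⟨s₆, e₆, h₆⟩ := h₅.pair b₅ c₅ (L := L) (by omega)
  refine ⟨s₆, (e₂.seq ((Exec.op (.copy 14 13) s₂).seq ((Exec.op (.next 12 13) _).seq (e₅.seq
    (e₆.seq (Exec.op (.next 12 13) s₆)))))).mono (by omega), ?_⟩
  rw [parse_snoc, List.length_append, List.length_singleton]
  exact h₆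

theorem exec_setupCmd (l : List (Bool × Bool)) :
    ∃ s, Exec (flatten l) setupCmd Store.init (l.length * ((2 * l.length + 3) * 120 + 29) + 5) s ∧
      Rep (parse l).2.2 (flatten l) 0 (fun _ => 0) 1 s := by
  set x := flatten l with hx
  set s₀ : Store := (Store.init.set 1 1).set 2 1 with hs₀
  have h₀ : Parsing x 0 (parse []) 0 s₀ :=
    ⟨rfl, rfl, rfl, rfl, rfl, rfl, rfl, rfl, by
      funext k
      split
      · rfl
      · omega, rfl, rfl⟩
  -- The index of the invariant is the number of pairs still to be read, and the invariant is stated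
  -- through the memory before the pending read.
  obtain ⟨s₁, e₁, s₂, h₂, rfl⟩ := Exec.whilene (x := x) (v := 12) (w := 0) (c := parseBody)
    (n := (2 * l.length + 3) * 120 + 27)
    (fun m s => ∃ s', (∃ p r, l = p ++ r ∧ r.length = m ∧
      Parsing x (2 * p.length) (parse p) (2 * p.length) s') ∧ s = Op.eval x (.next 12 13) s')
    (by
      rintro _ ⟨s, ⟨p, r, hl, hr, hp⟩, rfl⟩
      rw [List.length_eq_zero_iff] at hr
      subst hr
      rw [List.append_nil] at hl
      subst hl
      rw [Op.eval, if_neg (by rw [hp.pos, hx, length_flatten]; omega)]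
      simp [Store.var_set, hp.zero])
    (by
      rintro m _ ⟨s, ⟨p, r, hl, hr, hp⟩, rfl⟩
      obtain ⟨a, r, rfl⟩ := List.exists_cons_of_length_eq_add_one hr
      have hlen := congrArg List.length hl
      rw [List.length_append, List.length_cons] at hlen
      have hn := hp.next (by rw [hx, length_flatten]; omega)
      refine ⟨by rw [hn.2.1, hn.1.zero]; simp, ?_⟩
      rw [hx, hl] at hp
      obtain ⟨s', e', h'⟩ := hp.step (L := 2 * l.length + 2) (by omega)
      rw [← hl, ← hx] at e' h'
      exact ⟨_, e'.mono (by omega), s', ⟨p ++ [a], r, by simp [hl], by simpa using hr, h'⟩, rfl⟩)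
    l.length _ ⟨s₀, ⟨[], l, rfl, rfl, h₀⟩, rfl⟩
  obtain ⟨p, r, hl, hr, hp⟩ := h₂
  rw [List.length_eq_zero_iff] at hr
  subst hr
  rw [List.append_nil] at hl
  subst hl
  have hn : Op.eval x (.next 12 13) s₂ = (s₂.set 13 0).set 12 0 := by
    rw [Op.eval, if_neg (by rw [hp.pos, hx, length_flatten]; omega)]
  rw [hn] at e₁
  refine ⟨_, ((Exec.op (.const 1 true) _).seq ((Exec.op (.const 2 true) _).seq
    ((Exec.op (.next 12 13) s₀).seq (e₁.seq (Exec.op (.put 1 0 9) _))))).mono (by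
      rw [show (2 * l.length + 3) * 120 + 27 + 2 = (2 * l.length + 3) * 120 + 29 by omega]
      omega), ?_⟩
  refine ⟨hp.zero, hp.one, hp.go, hp.pc, hp.reg, ?_, hp.prog⟩
  -- The final instruction stores the number of letters as entry `0`, which completes the copy of
  -- the input registers.
  change update (s₂.arr 1) (s₂.var 0) (s₂.var 9) = _
  rw [hp.zero, hp.v9, hp.inp]
  funext k
  have hlen := length_flatten l
  rw [← hx] at hlen
  cases k with
  | zero => rw [update_self, inputReg, hlen]
  | succ k =>
    rw [update_of_ne (by simp)]
    split
    · rw [inputReg, List.getD_eq_default _ _ (by omega)]; rfl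
    · rfl

end BitMachine

namespace EnumRAM

/-! ### The course of a computation -/

/-- `st'` may occur in a computation after `st`. -/
def State.Before (st st' : State) : Prop :=
  st.clock ≤ st'.clock ∧
    ∃ o, st'.out = st.out ++ o ∧ ∀ e ∈ o, st.clock < e.1 ∧ e.1 ≤ st'.clock

theorem State.Before.refl (st : State) : st.Before st := ⟨le_rfl, [], by simp, by simp⟩

theorem State.Before.trans {s s' s'' : State} (h : s.Before s') (h' : s'.Before s'') :
    s.Before s'' := by
  obtain ⟨hc, o, ho, hb⟩ := h
  obtain ⟨hc', o', ho', hb'⟩ := h'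
  refine ⟨hc.trans hc', o ++ o', by rw [ho', ho, List.append_assoc], fun e he => ?_⟩
  rcases List.mem_append.1 he with he | he
  · have := hb e he; omega
  · have := hb' e he; omega

theorem State.Before.words_subset {s s' : State} (h : s.Before s') : s.words ⊆ s'.words := by
  obtain ⟨-, o, ho, -⟩ := h
  rw [State.words, State.words, ho, List.map_append]
  exact List.subset_append_left _ _

/-- Every actual step takes positive time, so the clock bounds the number of steps; an output takes
exactly one unit. -/
theorem RAM.next_eq_or (M : RAM) (x : Word) (st : State) :
    M.next x st = st ∨ (st.clock < (M.next x st).clock ∧ ((M.next x st).out = st.out ∨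
      ((M.next x st).clock = st.clock + 1 ∧
        ∃ w, (M.next x st).out = st.out ++ [(st.clock + 1, w)]))) := by
  unfold RAM.next RAM.step
  cases hp : M.program[st.pc]? with
  | none => exact .inl rfl
  | some i =>
    cases i <;> simp [State.write, arithCost]

theorem RAM.before_next (M : RAM) (x : Word) (st : State) : st.Before (M.next x st) := by
  rcases M.next_eq_or x st with h | ⟨hc, h | ⟨hc', w, h⟩⟩
  · rw [h]; exact .refl _
  · exact ⟨hc.le, [], by simp [h], by simp⟩
  · exact ⟨hc.le, _, h, by simp [hc']⟩

/-- The state after `i` steps. -/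
def RAM.stateAt (M : RAM) (x : Word) (i : ℕ) : State := (M.next x)^[i] State.init

theorem RAM.stateAt_succ (M : RAM) (x : Word) (i : ℕ) :
    M.stateAt x (i + 1) = M.next x (M.stateAt x i) := iterate_succ_apply' _ _ _

theorem RAM.before_stateAt (M : RAM) (x : Word) {i j : ℕ} (h : i ≤ j) :
    (M.stateAt x i).Before (M.stateAt x j) := by
  induction j, h using Nat.le_induction with
  | base => exact .refl _
  | succ j _ ih => rw [M.stateAt_succ]; exact ih.trans (M.before_next x _)

theorem RAM.stateAt_eq_of_next_eq (M : RAM) (x : Word) {i j : ℕ} (h : i ≤ j)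
    (hi : M.next x (M.stateAt x i) = M.stateAt x i) : M.stateAt x j = M.stateAt x i := by
  induction j, h using Nat.le_induction with
  | base => rfl
  | succ j _ ih => rw [M.stateAt_succ, ih, hi]

theorem RAM.exists_stateAt {M : RAM} {x : Word} {st : State} (h : st ∈ M.run x) :
    ∃ N, M.stateAt x N = st ∧ M.next x st = st := by
  obtain ⟨hr, hs⟩ := StateTransition.mem_eval.1 h
  refine Exists.elim (?_ : ∃ N, M.stateAt x N = st) fun N hN => ⟨N, hN, by rw [RAM.next, hs]; rfl⟩
  clear h hs
  induction hr with
  | refl => exact ⟨0, rfl⟩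
  | tail _ hstep ih =>
    obtain ⟨N, rfl⟩ := ih
    exact ⟨N + 1, by rw [M.stateAt_succ, RAM.next, Option.mem_def.1 hstep]; rfl⟩

/-- A bound for the instruction numbers. -/
def RAM.pcBound (M : RAM) : ℕ := M.program.length + M.fields.sum

/-- Jump targets are constants of the program, so instruction numbers are bounded independently of
the input. This makes the cost of fetching a constant of `M`. -/
theorem RAM.pc_le (M : RAM) (x : Word) (i : ℕ) : (M.stateAt x i).pc ≤ M.pcBound := by
  induction i with
  | zero => exact Nat.zero_le _
  | succ i ih =>
    rw [M.stateAt_succ]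
    generalize M.stateAt x i = st at ih
    unfold RAM.next RAM.step
    cases hp : M.program[st.pc]? with
    | none => exact ih
    | some i =>
      have h1 : st.pc + 1 ≤ M.pcBound := by
        have := (List.getElem?_eq_some_iff.1 hp).1
        unfold RAM.pcBound
        omega
      have h2 : ∀ l ∈ i.fields, l ≤ M.pcBound := fun l hl =>
        (List.le_sum_of_mem (List.mem_flatMap.2 ⟨i, List.mem_of_getElem? hp, hl⟩)).trans
          (Nat.le_add_left _ _)
      cases i <;> simp only [Option.getD_some, Option.getD_none, State.write]
      case jump l => exact h2 l (by simp [Instr.fields])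
      case jumpLT a b l =>
        split
        · exact h2 l (by simp [Instr.fields])
        · exact h1
      all_goals first | exact h1 | exact ih

/-- Before the output of a word, the times of the steps are bounded by the times of outputs. -/
theorem RAM.exists_output_ge {M : RAM} {x : Word} {w : Word} {i j N : ℕ} (hj : j < i) (hi : i ≤ N)
    (h : w ∉ (M.stateAt x j).words) (h' : w ∈ (M.stateAt x i).words) :
    (M.stateAt x j).clock < (M.stateAt x (j + 1)).clock ∧
    ∃ k e, (M.stateAt x N).out[k]? = some e ∧ (M.stateAt x (j + 1)).clock ≤ e.1 ∧
      ∀ k', k = k' + 1 → ∃ e', (M.stateAt x N).out[k']? = some e' ∧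
        e'.1 ≤ (M.stateAt x j).clock := by
  have hne : M.next x (M.stateAt x j) ≠ M.stateAt x j := fun hn => by
    rw [M.stateAt_eq_of_next_eq x hj.le hn] at h'
    exact h h'
  obtain ⟨hc, hout⟩ := (M.next_eq_or x (M.stateAt x j)).resolve_left hne
  rw [← M.stateAt_succ] at hc hout
  -- The step from `j` to `j + 1` lies between the last output made before it and the next one,
  -- whose index is the number of outputs so far. The next one exists because `w` is still to come.
  refine ⟨hc, (M.stateAt x j).out.length, ?_⟩
  obtain ⟨-, o, ho, -⟩ := M.before_stateAt x (hj.le.trans hi)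
  obtain ⟨-, o', ho', hb'⟩ := M.before_stateAt x (Nat.zero_le j)
  have key : ∃ e, (M.stateAt x N).out[(M.stateAt x j).out.length]? = some e ∧
      (M.stateAt x (j + 1)).clock ≤ e.1 := by
    rcases hout with hout | ⟨hc', v, hout⟩
    · obtain ⟨-, o₁, ho₁, hb₁⟩ := M.before_stateAt x (Nat.succ_le_of_lt hj)
      obtain ⟨-, o₂, ho₂, -⟩ := M.before_stateAt x hi
      rw [hout] at ho₁
      cases o₁ with
      | nil =>
        rw [State.words, ho₁, List.append_nil, ← State.words] at h'
        exact absurd h' h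
      | cons e o₁ =>
        refine ⟨e, ?_, (hb₁ e (by simp)).1.le⟩
        rw [ho₂, ho₁]
        simp
    · obtain ⟨-, o₂, ho₂, -⟩ := M.before_stateAt x (Nat.succ_le_of_lt hj |>.trans hi)
      exact ⟨((M.stateAt x j).clock + 1, v), by rw [ho₂, hout]; simp, hc'.le⟩
  obtain ⟨e, he, hle⟩ := key
  refine ⟨e, he, hle, fun k' hk' => ?_⟩
  have hk : k' < (M.stateAt x j).out.length := by omega
  refine ⟨(M.stateAt x j).out[k'], ?_, ?_⟩
  · rw [ho, List.getElem?_append_left hk, List.getElem?_eq_getElem hk]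
  · refine (hb' _ ?_).2
    have : (M.stateAt x j).out = o' := ho'
    rw [← this]
    exact List.getElem_mem hk

/-- A bound for the sum of the squares of the times of the steps, where the first output comes
within time `p`, and the following ones with delay `d`. -/
theorem RAM.sum_sq_le {M : RAM} {x : Word} {w : Word} {i N p d : ℕ} (hi : i ≤ N)
    (h : ∀ j < i, w ∉ (M.stateAt x j).words) (h' : w ∈ (M.stateAt x i).words)
    (hp : ∀ e, (M.stateAt x N).out[0]? = some e → e.1 ≤ p)
    (hd : ∀ k e e', (M.stateAt x N).out[k]? = some e → (M.stateAt x N).out[k + 1]? = some e' →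
      e'.1 ≤ e.1 + d) :
    i ≤ (M.stateAt x i).clock ∧ (M.stateAt x i).clock ≤ p + (M.stateAt x N).out.length * d ∧
    ∑ j ∈ Finset.range i, ((M.stateAt x (j + 1)).clock - (M.stateAt x j).clock) ^ 2 ≤
      p * p + d * (M.stateAt x i).clock := by
  have hk : ∀ k e, (M.stateAt x N).out[k]? = some e → e.1 ≤ p + k * d := by
    intro k
    induction k with
    | zero => intro e he; simpa using hp e he
    | succ k ih =>
      intro e he
      have hlt := (List.getElem?_eq_some_iff.1 he).1
      have he' := List.getElem?_eq_getElem (l := (M.stateAt x N).out) (i := k) (by omega)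
      have h1 := hd k _ e he' he
      have h2 := ih _ he'
      rw [Nat.succ_mul]
      omega
  have main : ∀ i' ≤ i, i' ≤ (M.stateAt x i').clock ∧
      (M.stateAt x i').clock ≤ p + (M.stateAt x N).out.length * d ∧
      ∑ j ∈ Finset.range i', ((M.stateAt x (j + 1)).clock - (M.stateAt x j).clock) ^ 2 ≤
        p * min p (M.stateAt x i').clock + d * (M.stateAt x i').clock := by
    intro i' hi'
    induction i' with
    | zero => simp [RAM.stateAt, State.init]
    | succ j ih =>
      obtain ⟨ih1, -, ih2⟩ := ih (by omega)
      obtain ⟨hc, k, e, he, hce, hpre⟩ := M.exists_output_ge hi' hi (h j hi') h'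
      have hlt := (List.getElem?_eq_some_iff.1 he).1
      refine ⟨by omega, ?_, ?_⟩
      · have h1 := hk k e he
        have h2 := Nat.mul_le_mul_right d hlt.le
        omega
      · rw [Finset.sum_range_succ]
        obtain ⟨δ, hδ⟩ := Nat.exists_eq_add_of_lt hc
        set c := (M.stateAt x j).clock
        rw [hδ] at hce ⊢
        rw [show c + δ + 1 - c = δ + 1 by omega]
        -- Before the first output a step takes time at most `p`, and these steps together take at
        -- most `p`; later a step lies within one delay and takes at most `d`.
        cases k with
        | zero =>
          have h1 := hp e he
          rw [min_eq_right (by omega)] at ih2 ⊢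
          nlinarith
        | succ k =>
          obtain ⟨e', he', hle'⟩ := hpre k rfl
          have h1 := hd k e' e he' he
          have h2 : p * min p c ≤ p * min p (c + δ + 1) :=
            Nat.mul_le_mul_left _ (min_le_min_left _ (by omega))
          have h3 : δ + 1 ≤ d := by omega
          nlinarith
  obtain ⟨h1, h2, h3⟩ := main i le_rfl
  exact ⟨h1, h2, h3.trans (Nat.add_le_add_right (Nat.mul_le_mul_left _ (min_le_left _ _)) _)⟩

end EnumRAM

/-! ### Duration of the self-simulation -/

namespace BitMachine

/-- Read the code of a random access machine, and simulate it until it outputs the word `1`. -/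
def simulator : Cmd := setupCmd ;; .whilene 2 0 bodyCmd

def simulatorCode : List Code := simulator.compile 0

/-- The time for reading `l` pairs of letters. -/
def setupTime (l : ℕ) : ℕ := l * ((2 * l + 3) * 120 + 29) + 5

def stepFactor (M : RAM) : ℕ := 160 * (4 * M.pcBound + 4).size + 652

/-- One round of the loop per step of `M`. The upper bound on `t` serves when `M` outputs `1`, the
lower bound `i ≤ t` when it never does. -/
theorem exec_loop {M : RAM} {l : List (Bool × Bool)} (hl : (parse l).2.2 = code M) (i : ℕ)
    (h : ∀ j < i, [true] ∉ (M.stateAt (flatten l) j).words) :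
    ∃ t s, i ≤ t ∧ (step (flatten l) simulatorCode)^[t] (0, Store.init) = (setupCmd.size, s) ∧
      Represents M (flatten l) (M.stateAt (flatten l) i) s ∧
      t ≤ setupTime l.length + stepFactor M * (i + ∑ j ∈ Finset.range i,
        ((M.stateAt (flatten l) (j + 1)).clock - (M.stateAt (flatten l) j).clock) ^ 2) := by
  have hcode : CodeAt simulatorCode 0 (simulator.compile 0) := codeAt_self _
  induction i with
  | zero =>
    obtain ⟨s, e, hR⟩ := exec_setupCmd l
    obtain ⟨t, ht, e⟩ := e _ 0 hcode.left
    refine ⟨t, s, Nat.zero_le _, by rw [e, Nat.zero_add], ?_, ?_⟩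
    · rw [hl] at hR
      exact hR
    · simpa [setupTime] using ht
  | succ i ih =>
    obtain ⟨t, s, hit, hs, hR, ht⟩ := ih fun j hj => h j (by omega)
    have hout := h i (by omega)
    obtain ⟨s', e, hR'⟩ := exec_bodyCmd hR hout (L := (4 * M.pcBound + 4).size)
      (Nat.size_le_size (by have := M.pc_le (flatten l) i; omega))
    have hgo : s.var 2 ≠ s.var 0 := by
      have h2 := hR.go
      rw [if_neg hout] at h2
      rw [h2, hR.zero]
      simp
    obtain ⟨k, hk1, hk, e'⟩ := Exec.while_iter hgo e (P := simulatorCode) (a := setupCmd.size)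
      (by simpa using hcode.right)
    refine ⟨k + t, s', by omega, by rw [iterate_add_apply, hs, e'], ?_, ?_⟩
    · rwa [M.stateAt_succ]
    · rw [Finset.sum_range_succ]
      rw [← M.stateAt_succ] at hk
      generalize (M.stateAt (flatten l) (i + 1)).clock - (M.stateAt (flatten l) i).clock = δ at *
      generalize ∑ j ∈ Finset.range i, ((M.stateAt (flatten l) (j + 1)).clock -
        (M.stateAt (flatten l) j).clock) ^ 2 = S at *
      unfold stepFactor at *
      generalize (4 * M.pcBound + 4).size = L at *
      -- The inequality `(δ + 1) ^ 2 ≤ 2 * (δ ^ 2 + 1)` separates the constant cost of a round from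
      -- the square of the time.
      nlinarith [sq_nonneg ((δ : ℤ) - 1), Nat.zero_le (L * δ ^ 2)]

theorem length_simulatorCode : simulatorCode.length = setupCmd.size + (bodyCmd.size + 2) := by
  rw [simulatorCode, Cmd.length_compile, simulator, Cmd.size, Cmd.size]

theorem iterate_step_length (x : Word) (P : List Code) (s : Store) (k : ℕ) :
    (step x P)^[k] (P.length, s) = (P.length, s) :=
  iterate_fixed (by simp [step]) k

/-- The number of steps simulated by the enumerating machine. -/
noncomputable def stepCount (n : ℕ) : ℕ := max 1 n * (max 3 (bound n) - 2) - 1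

/-- The end of the program is never left again, but after arbitrarily many steps the simulator is
found back at the head of its loop. -/
theorem not_haltsInTime {M : RAM} {l : List (Bool × Bool)} (hl : (parse l).2.2 = code M)
    (h : ∀ j, [true] ∉ (M.stateAt (flatten l) j).words) :
    ¬ HaltsInTime simulatorCode (flatten l) := by
  intro hh
  obtain ⟨t, s, ht, hs, -⟩ := exec_loop hl (stepCount (flatten l).length) fun j _ => h j
  obtain ⟨k, rfl⟩ := Nat.exists_eq_add_of_le' ht
  rw [iterate_add_apply, ← Prod.mk.eta (p := (step _ _)^[stepCount _] _),
    show ((step _ _)^[stepCount _] _).1 = simulatorCode.length from hh, iterate_step_length] at hs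
  have := congrArg Prod.fst hs
  rw [length_simulatorCode] at this
  simp only at this
  omega

theorem haltsInTime {M : RAM} {l : List (Bool × Bool)} (hl : (parse l).2.2 = code M) {i : ℕ}
    (h : ∀ j < i, [true] ∉ (M.stateAt (flatten l) j).words)
    (h' : [true] ∈ (M.stateAt (flatten l) i).words)
    (ht : setupTime l.length + stepFactor M * (i + ∑ j ∈ Finset.range i,
      ((M.stateAt (flatten l) (j + 1)).clock - (M.stateAt (flatten l) j).clock) ^ 2) <
      stepCount (flatten l).length) : HaltsInTime simulatorCode (flatten l) := by
  have hcode : CodeAt simulatorCode 0 (simulator.compile 0) := codeAt_self _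
  obtain ⟨t, s, -, hs, hR, ht'⟩ := exec_loop hl i h
  obtain ⟨k, hk, e⟩ := Exec.while_done (x := flatten l) (c := bodyCmd)
    (by rw [hR.go, if_pos h', hR.zero] : s.var 2 = s.var 0) simulatorCode setupCmd.size
    (by simpa using hcode.right)
  obtain ⟨r, hr⟩ := Nat.exists_eq_add_of_le' (show k + t ≤ stepCount (flatten l).length by omega)
  have hlen : setupCmd.size + (Cmd.whilene 2 0 bodyCmd).size = simulatorCode.length := by
    rw [length_simulatorCode, Cmd.size]
  change ((step _ _)^[stepCount _] _).1 = _
  rw [hr, iterate_add_apply, iterate_add_apply, hs, e, hlen, iterate_step_length]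

end BitMachine

namespace BitMachine

/-! ### Comparison of growth -/

theorem exists_eval_le_pow (q : Polynomial ℕ) : ∃ j, ∀ N, 2 ≤ N → q.eval N ≤ N ^ j := by
  induction q using Polynomial.induction_on' with
  | add p q hp hq =>
    obtain ⟨i, hi⟩ := hp
    obtain ⟨j, hj⟩ := hq
    refine ⟨i + j + 1, fun N hN => ?_⟩
    have h1 := (hi N hN).trans (Nat.pow_le_pow_right (by omega) (Nat.le_add_right i j))
    have h2 := (hj N hN).trans (Nat.pow_le_pow_right (by omega) (Nat.le_add_left j i))
    rw [Polynomial.eval_add, pow_succ]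
    nlinarith
  | monomial k c =>
    refine ⟨c + k, fun N hN => ?_⟩
    rw [Polynomial.eval_monomial, pow_add]
    exact Nat.mul_le_mul_right _ (Nat.lt_two_pow_self.le.trans (Nat.pow_le_pow_left hN c))

/-- Used with `m = log₂ n`: a polylogarithmic quantity is eventually at most `n`. -/
theorem eventually_eval_le_two_pow (q : Polynomial ℕ) :
    ∀ᶠ m in Filter.atTop, q.eval m ≤ 2 ^ m := by
  obtain ⟨j, hj⟩ := exists_eval_le_pow q
  have h := (tendsto_pow_const_div_const_pow_of_one_lt j (r := (2 : ℝ)) (by norm_num)).eventually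
    (gt_mem_nhds one_pos)
  filter_upwards [h, Filter.eventually_ge_atTop 2] with m hm h2
  rw [div_lt_one (by positivity)] at hm
  exact (hj m h2).trans (by exact_mod_cast hm.le)

theorem superpoly_sq (m : ℕ) : superpoly m ^ 2 = 2 ^ (m * (m + 1)) := by
  induction m with
  | zero => rfl
  | succ m ih => rw [superpoly, mul_pow, ih, ← pow_mul, ← pow_add]; congr 1; ring

/-- With `n = 2 ^ m`, a polynomial in `n` is at most `2 ^ (m * j)`, while `superpoly m` is the
square root of `2 ^ (m * (m + 1))`. -/
theorem eventually_eval_le_superpoly (q : Polynomial ℕ) :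
    ∀ᶠ m in Filter.atTop, q.eval (2 ^ m) ≤ superpoly m := by
  obtain ⟨j, hj⟩ := exists_eval_le_pow q
  filter_upwards [Filter.eventually_ge_atTop (2 * j + 1)] with m hm
  refine (hj _ ?_).trans ?_
  · exact le_self_pow₀ (by simp) (by omega)
  · rw [← Nat.pow_le_pow_iff_left (n := 2) (by simp), superpoly_sq, ← pow_mul, ← pow_mul]
    exact Nat.pow_le_pow_right (by simp) (by nlinarith)

/-! ### The diagonal argument -/

theorem length_words_le {P : List Code} {x : Word} {L : List Word} (hL : L.Nodup)
    (h : ∀ y ∈ L, y ∈ outputs P x) : L.length ≤ max 3 (bound x.length) := by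
  have : L.toFinset ⊆ (Finset.range (max 3 (bound x.length))).image numeral := fun y hy => by
    obtain ⟨v, hv, rfl⟩ := mem_outputs (h y (List.mem_toFinset.1 hy))
    exact Finset.mem_image_of_mem _ (Finset.mem_range.2 hv)
  have hc := (Finset.card_le_card this).trans Finset.card_image_le
  rwa [List.toFinset_card_of_nodup hL, Finset.card_range] at hc

/-- The point of strong polynomial delay: solutions have length polylogarithmic in the input, so the
permitted delays do too. -/
theorem length_le_of_mem_outputs {P : List Code} {x y : Word} {m : ℕ} (hx : x.length = 2 ^ m)
    (h : y ∈ outputs P x) : y.length ≤ m * (m + 1) + 3 := by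
  obtain ⟨v, hv, rfl⟩ := mem_outputs h
  refine (length_numeral_le v).trans ?_
  rw [bound, hx, Nat.clog_pow 2 m (by simp)] at hv
  suffices v.size ≤ m * (m + 1) + 2 by omega
  rw [Nat.size_le]
  refine hv.trans_le (max_le ?_ ((superpoly_le m).trans (Nat.pow_le_pow_right (by simp) (by omega))))
  calc 3 ≤ 2 ^ 2 := by simp
    _ ≤ _ := Nat.pow_le_pow_right (by simp) (by omega)

/-- If `M` outputs the word `1` on an input consisting of its own code and some padding, and it is
fast, then the simulation ends in time. -/
theorem not_solves {M : RAM} (hM : M.Solves (problem simulatorCode)) {l : List (Bool × Bool)}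
    (hl : (parse l).2.2 = code M) {p d : ℕ}
    (hp : ∀ st ∈ M.run (flatten l), st.firstTime ≤ p)
    (hd : ∀ st ∈ M.run (flatten l), ∀ k e e', e'.2 ∈ outputs simulatorCode (flatten l) →
      st.out[k]? = some e → st.out[k + 1]? = some e' → e'.1 ≤ e.1 + d)
    (hn : stepFactor M * ((d + 1) * d) + 1 ≤ (flatten l).length)
    (hK : setupTime (flatten l).length + stepFactor M * ((d + 1) * p + p * p) +
      2 * (flatten l).length + 2 ≤ bound (flatten l).length) : False := by
  classical
  set x := flatten l with hx
  obtain ⟨st, hst, hnd, hsol⟩ := hM x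
  obtain ⟨N, rfl, hN⟩ := RAM.exists_stateAt hst
  -- If `M` never output `1`, the simulation would not end, and `1` would be a solution that `M`
  -- misses.
  have hmem : [true] ∈ (M.stateAt x N).words := by
    by_contra hno
    refine hno ((hsol _).2 (true_mem_outputs.2 (not_haltsInTime hl fun j hj => hno ?_)))
    rw [← hx] at hj
    rcases le_total j N with h | h
    · exact (M.before_stateAt x h).words_subset hj
    · rwa [M.stateAt_eq_of_next_eq x h hN] at hj
  have hex : ∃ i, [true] ∈ (M.stateAt x i).words := ⟨N, hmem⟩
  have hi : Nat.find hex ≤ N := Nat.find_le hmem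
  have hmin : ∀ j < Nat.find hex, [true] ∉ (M.stateAt x j).words := fun j hj => Nat.find_min hex hj
  have hfind := Nat.find_spec hex
  generalize Nat.find hex = i at hi hmin hfind
  have hout : ∀ e ∈ (M.stateAt x N).out, e.2 ∈ outputs simulatorCode x := fun e he =>
    (hsol _).1 (List.mem_map_of_mem he)
  obtain ⟨h1, h2, h3⟩ := M.sum_sq_le (p := p) (d := d) hi hmin hfind
    (fun e he => by
      have := hp _ hst
      unfold State.firstTime at this
      cases ho : (M.stateAt x N).out with
      | nil => simp [ho] at he
      | cons e' o =>
        rw [ho] at he this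
        obtain rfl : e' = e := by simpa using he
        exact this)
    (fun k e e' he he' => hd _ hst k e e' (hout _ (List.mem_of_getElem? he')) he he')
  have h4 : (M.stateAt x N).out.length ≤ max 3 (bound x.length) := by
    have := length_words_le (P := simulatorCode) (x := x) hnd fun y hy => (hsol y).1 hy
    rwa [List.length_map] at this
  refine true_mem_outputs.1 ((hsol _).1 hmem) (haltsInTime hl hmin hfind ?_)
  have hlen : l.length ≤ x.length := by rw [hx, length_flatten]; omega
  have hset : setupTime l.length ≤ setupTime x.length := by
    unfold setupTime
    exact Nat.add_le_add_right (Nat.mul_le_mul hlen (by omega)) _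
  rw [← hx]
  generalize ∑ j ∈ Finset.range i, ((M.stateAt x (j + 1)).clock - (M.stateAt x j).clock) ^ 2 = S
    at h3 ⊢
  generalize (M.stateAt x i).clock = c at *
  generalize (M.stateAt x N).out.length = o at *
  have hKK : bound x.length ≤ max 3 (bound x.length) := le_max_right _ _
  have h5 : 3 ≤ max 3 (bound x.length) := le_max_left _ _
  unfold stepCount
  rw [max_eq_right (by omega)]
  generalize bound x.length = K at *
  generalize max 3 K = K' at *
  generalize x.length = n at *
  generalize setupTime l.length = s at *
  generalize setupTime n = s' at *
  generalize stepFactor M = f at *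
  have h6 : c ≤ p + K' * d := h2.trans (Nat.add_le_add_left (Nat.mul_le_mul_right _ h4) _)
  have h7 : i + S ≤ (d + 1) * (p + K' * d) + p * p := by nlinarith
  have h8 : f * (i + S) ≤ f * ((d + 1) * p + p * p) + f * ((d + 1) * d) * K' := by
    refine (Nat.mul_le_mul_left f h7).trans (le_of_eq ?_)
    ring
  -- The main term of the simulation time leaves at least `K'` of the available `n * K'` steps; by
  -- `hK` this margin covers the reading of the input and all terms without factor `K'`.
  have h9 : f * ((d + 1) * d) * K' + K' ≤ n * K' := by
    calc _ = (f * ((d + 1) * d) + 1) * K' := by ring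
      _ ≤ _ := Nat.mul_le_mul_right _ hn
  have h10 : n * (K' - 2) = n * K' - 2 * n := by rw [Nat.mul_sub, Nat.mul_comm n 2]
  rw [h10]
  omega

theorem not_solves_problem :
    ¬ ∃ M : RAM, M.Solves (problem simulatorCode) ∧ M.PolyPreprocessing ∧ M.StrongPolyDelay := by
  rintro ⟨M, hM, ⟨p, hp⟩, a, C, ha, hC, hd⟩
  obtain ⟨f, hf⟩ : ∃ f, f = stepFactor M := ⟨_, rfl⟩
  -- A bound for the delays as a polynomial in `m = log₂ n`, from the length bound `m * (m + 1) + 3`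
  -- for the solutions; the real constants are rounded up.
  let D : Polynomial ℕ := Polynomial.C ⌈C⌉₊ * (Polynomial.X * (Polynomial.X + 1) + 3) ^ ⌈a⌉₊
  obtain ⟨l₀, hl₀⟩ := exists_parse M.fields
  have ev := ((eventually_eval_le_two_pow (Polynomial.C f * ((D + 1) * D) + 1)).and
    (eventually_eval_le_superpoly (Polynomial.X * ((2 * Polynomial.X + 3) * 120 + 29) + 5 +
      Polynomial.C f * ((Polynomial.X + 1) * p + p * p) + 2 * Polynomial.X + 2))).and
    (Filter.eventually_ge_atTop (l₀.length + 1))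
  obtain ⟨m, ⟨h1, h2⟩, h3⟩ := ev.exists
  obtain ⟨k, rfl⟩ : ∃ k, m = k + 1 := ⟨m - 1, by omega⟩
  have hk : l₀.length ≤ 2 ^ k := le_trans (by omega) (Nat.lt_two_pow_self (n := k)).le
  -- Padding to `2 ^ k` pairs makes the input length the exact power of two `2 ^ (k + 1)`.
  set l := l₀ ++ List.replicate (2 ^ k - l₀.length) (true, true) with hl
  have hlen : (flatten l).length = 2 ^ (k + 1) := by
    rw [length_flatten, hl, List.length_append, List.length_replicate, pow_succ]
    omega
  have hcode : (parse l).2.2 = code M := by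
    rw [hl, parse_append_replicate, hl₀]
    rfl
  have hDn : D.eval (k + 1) ≤ 2 ^ (k + 1) := by
    refine le_trans ?_ h1
    simp only [Polynomial.eval_add, Polynomial.eval_mul, Polynomial.eval_C, Polynomial.eval_one]
    have : 1 ≤ f := by simp only [hf, stepFactor]; omega
    generalize D.eval (k + 1) = e
    generalize f = g at this
    nlinarith [Nat.mul_le_mul_right ((e + 1) * e) this]
  refine not_solves hM hcode (p := p.eval (2 ^ (k + 1))) (d := D.eval (k + 1))
    (fun st hst => by rw [← hlen]; exact hp _ st hst) (fun st hst j e e' hmem he he' => ?_) ?_ ?_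
  · have h4 := hd _ st hst j e e' he he'
    have h5 : max 1 e'.2.length ≤ (k + 1) * (k + 1 + 1) + 3 :=
      max_le (by omega) (length_le_of_mem_outputs hlen hmem)
    have h6 : C * ((max 1 e'.2.length : ℕ) : ℝ) ^ a ≤ (D.eval (k + 1) : ℕ) := by
      have hD : D.eval (k + 1) = ⌈C⌉₊ * ((k + 1) * (k + 1 + 1) + 3) ^ ⌈a⌉₊ := by simp [D]
      rw [hD, Nat.cast_mul, Nat.cast_pow]
      refine mul_le_mul (Nat.le_ceil C) ?_ (by positivity) (by positivity)
      rw [← Real.rpow_natCast]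
      refine (Real.rpow_le_rpow (by positivity) (Nat.cast_le.2 h5) ha).trans
        (Real.rpow_le_rpow_of_exponent_le ?_ (Nat.le_ceil a))
      exact_mod_cast (by omega : 1 ≤ (k + 1) * (k + 1 + 1) + 3)
    have h7 : (e'.1 : ℝ) < e.1 + (D.eval (k + 1) : ℕ) := by linarith
    exact_mod_cast h7.le
  · rw [hlen]
    simpa [hf] using h1
  · rw [hlen, bound, Nat.clog_pow 2 _ (by simp)]
    refine le_trans ?_ h2
    simp only [Polynomial.eval_add, Polynomial.eval_mul, Polynomial.eval_C, Polynomial.eval_one,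
      Polynomial.eval_X, Polynomial.eval_ofNat, setupTime]
    have h8 := Nat.mul_le_mul_left f (Nat.add_le_add_right (Nat.mul_le_mul_right
      (p.eval (2 ^ (k + 1))) (Nat.add_le_add_right hDn 1))
      (p.eval (2 ^ (k + 1)) * p.eval (2 ^ (k + 1))))
    rw [← hf]
    omega

end BitMachine

theorem mainTheorem10 :
    ∃ A : EnumProblem,
      (∃ M : EnumRAM.RAM,
        M.Solves A ∧ M.PolyPreprocessing ∧ M.PolyDelay ∧ M.NoPostprocessing) ∧
      ¬ ∃ M : EnumRAM.RAM,
        M.Solves A ∧ M.PolyPreprocessing ∧ M.StrongPolyDelay :=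
  ⟨BitMachine.problem BitMachine.simulatorCode,
    ⟨BitMachine.enumerator BitMachine.simulatorCode,
      BitMachine.enumerator_solves _, BitMachine.enumerator_polyPreprocessing _,
      BitMachine.enumerator_polyDelay _, BitMachine.enumerator_noPostprocessing _⟩,
    BitMachine.not_solves_problem⟩
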